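/- **Conventions.** Let $(\Omega,\mathcal F)$ be a measurable space, $C_{l,Lip}(\mathbb R^n)$ the set of functions $\varphi$ on $\mathbb R^n$ with $|\varphi(x)-\varphi(y)|\le C(1+|x|^m+|y|^m)|x-y|$ for some $C>0$, $m\in\mathbb N$, and $C_{b,Lip}(\mathbb R)$ the set of bounded Lipschitz functions. Let $\mathscr H$ be a linear space of real measurable functions on $\Omega$ such that $\varphi(X_1,\dots,X_n)\in\mathscr H$ for $X_i\in\mathscr H$, $\varphi\in C_{l,Lip}(\mathbb R^n)$. A sub-linear expectation is a map $\widehat{\mathbb E}:\mathscr H\to[-\infty,\infty]$ that is monotone, satisfies $\widehat{\mathbb E}[c]=c$ for constants $c$ and $\widehat{\mathbb E}[\lambda X]=\lambda\widehat{\mathbb E}[X]$ for $\lambda\ge0$ (with $0\cdot\infty=0$), and satisfies $\widehat{\mathbb E}[X+Y]\le\widehat{\mathbb E}[X]+\widehat{\mathbb E}[Y]$ unless the right side has the form $\infty-\infty$. Let $\mathbb V:\mathcal F\to[0,1]$ be a monotone sub-additive set function with $\mathbb V(\emptyset)=0$, $\mathbb V(\Omega)=1$ and $\widehat{\mathbb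 E}[f]\le\mathbb V(A)\le\widehat{\mathbb E}[g]$ whenever $f\le I_A\le g$, $f,g\in\mathscr H$, $A\in\mathcal F$. Put $$\widehat{\mathbb V}(A)=\inf\{\widehat{\mathbb E}[\xi]: I_A\le\xi\in\mathscr H\},\qquad \widehat{\mathbb V}^{*}(A)=\inf\Big\{\sum_{n\ge1}\widehat{\mathbb V}(A_n): A\subset\bigcup_{n\ge1} A_n,\ A_n\in\mathcal F\Big\},$$ $$C_{\mathbb V}[X]=\int_0^\infty\mathbb V(X\ge t)\,dt+\int_{-\infty}^0[\mathbb V(X\ge t)-1]\,dt,\qquad \breve{\mathbb E}[X]=\lim_{c\to\infty}\widehat{\mathbb E}[(-c)\vee(X\wedge c)]\ \text{ if the limit exists.}$$ Write $\log x=\ln\max(e,x)$ and $d_n=\sqrt{2n\log\log n}$. A random vector $\boldsymbol Y$ is independent to $\boldsymbol X$ if $\widehat{\mathbb E}[\varphi(\boldsymbol X,\boldsymbol Y)]=\widehat{\mathbb E}\big[\widehat{\mathbb E}[\varphi(\boldsymbol x,\boldsymbol Y)]|_{\boldsymbol x=\boldsymbol X}\big]$ for each $\varphi\in C_{l,Lip}$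 such that $\overline\varphi(\boldsymbol x):=\widehat{\mathbb E}[|\varphi(\boldsymbol x,\boldsymbol Y)|]<\infty$ for all $\boldsymbol x$, the outer expectations are defined (their arguments belong to $\mathscr H$) and $\widehat{\mathbb E}[\overline\varphi(\boldsymbol X)]<\infty$. Random variables $Y_1,Y_2,\ldots\in\mathscr H$ are independent if $Y_{i+1}$ is independent to $(Y_1,\dots,Y_i)$ for each $i\ge1$, and identically distributed if $\widehat{\mathbb E}[\varphi(Y_i)]=\widehat{\mathbb E}[\varphi(Y_1)]$ for all $i$ and all $\varphi\in C_{b,Lip}(\mathbb R)$. **Theorem (Hartman–Wintner LIL: sufficiency and necessity).** Let $\{Y_n;n\ge1\}$ be independent and identically distributed random variables in $(\Omega,\mathscr H,\widehat{\mathbb E})$, and let $\overline\sigma\in[0,\infty]$ be given by $\overline\sigma^2=\breve{\mathbb E}[Y_1^2]$ (this limit always exists, finite or infinite). Consider the conditions $$(1)\quad C_{\mathbb V}\Big[\frac{Y_1^2}{\log\log|Y_1|}\Big]<\infty,\qquad\qquad (2)\quad \breve{\mathbb E}[Y_1]=\breve{\mathbb E}[-Y_1]=0 .$$ (a) If (1)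 and (2) hold, then $$\widehat{\mathbb V}^{*}\Big(\limsup_{n\to\infty}\frac{|\sum_{i=1}^nY_i|}{d_n}>\overline\sigma\Big)=0,$$ and $$\lim_{n\to\infty}\ \sup_{N\ge n}\ \mathbb V\Big(\sigma_1\le\sup_{n\le m\le N}\frac{\sum_{i=1}^mY_i}{d_m}\le\sigma_2\Big)=1$$ for all real $\sigma_1<\overline\sigma$ and all $\sigma_2\in(\overline\sigma,\infty]$; if $\overline\sigma=\infty$, this holds for all real $\sigma_1$ and $\sigma_2=\infty$. (b) Conversely, suppose that there exist $n_0\in\mathbb N$ and $M\in\mathbb R$ such that $$\lim_{N\to\infty}\mathbb V\Big(\sup_{n\le m\le N}\frac{|\sum_{i=1}^mY_i|}{d_m}\ge M\Big)<1\qquad\text{for all } n\ge n_0 .$$ Then (1) and (2) hold, and $\overline\sigma^2=\lim_{c\to\infty}\widehat{\mathbb E}[Y_1^2\wedge c]<\infty$. -/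

import Mathlib

open MeasureTheory Filter Topology
open scoped ENNReal

/-- The class `C_{l,Lip}(E)`: locally Lipschitz functions whose local Lipschitz constant grows at
most polynomially. It is used with `E = ℝ^m` and `E = ℝ^m × ℝ^n`; as all norms on these spaces are
equivalent, the class does not depend on the norm. -/
def IsLocLip {E : Type*} [NormedAddCommGroup E] (φ : E → ℝ) : Prop :=
  ∃ C > (0 : ℝ), ∃ m : ℕ, ∀ x y : E, |φ x - φ y| ≤ C * (1 + ‖x‖ ^ m + ‖y‖ ^ m) * ‖x - y‖

/-- The class `C_{b,Lip}(E)` of bounded Lipschitz functions. -/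
def IsBddLip {E : Type*} [NormedAddCommGroup E] (φ : E → ℝ) : Prop :=
  (∃ C : ℝ, ∀ x, |φ x| ≤ C) ∧ ∃ K : NNReal, LipschitzWith K φ

/-- A sub-linear expectation space `(Ω, H, E)` over the measurable space `Ω`. The sub-linear
expectation is a function `H → [-∞, ∞]`; it is written as a total function on `Ω → ℝ`, but nothing
is assumed about its values outside `H`, and these values are never used. -/
structure SubLinearExpectationSpace (Ω : Type*) [MeasurableSpace Ω] where
  /-- the linear space of random variables -/
  H : Submodule ℝ (Ω → ℝ)
  measurable_of_mem : ∀ X ∈ H, Measurable X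
  comp_mem : ∀ (n : ℕ) (X : Fin n → Ω → ℝ), (∀ i, X i ∈ H) →
    ∀ φ : (Fin n → ℝ) → ℝ, IsLocLip φ → (fun ω => φ (fun i => X i ω)) ∈ H
  /-- the sub-linear expectation -/
  E : (Ω → ℝ) → EReal
  mono : ∀ X ∈ H, ∀ Y ∈ H, (∀ ω, Y ω ≤ X ω) → E Y ≤ E X
  const : ∀ c : ℝ, E (fun _ => c) = (c : EReal)
  add_le : ∀ X ∈ H, ∀ Y ∈ H, ¬ (E X = ⊤ ∧ E Y = ⊥) → ¬ (E X = ⊥ ∧ E Y = ⊤) →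
    E (fun ω => X ω + Y ω) ≤ E X + E Y
  smul_eq : ∀ X ∈ H, ∀ c : ℝ, 0 ≤ c → E (fun ω => c * X ω) = (c : EReal) * E X

namespace SubLinearExpectationSpace

variable {Ω : Type*} [MeasurableSpace Ω] (S : SubLinearExpectationSpace Ω)

/-- The random vector `Y` is independent to the random vector `X` under `E`: for each
`φ ∈ C_{l,Lip}(ℝ^m × ℝ^n)`, `E[φ(X, Y)] = E[E[φ(x, Y)]|_{x = X}]`, whenever
`φ̄(x) := E[|φ(x, Y)|] < ∞` for all `x` and `E[φ̄(X)] < ∞`. The two membership conditions say that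
the outer expectations are defined. The inner expectations are finite, so `toReal` loses nothing. -/
def IndepTo {m n : ℕ} (Y : Fin n → Ω → ℝ) (X : Fin m → Ω → ℝ) : Prop :=
  ∀ φ : (Fin m → ℝ) × (Fin n → ℝ) → ℝ, IsLocLip φ →
    (∀ x : Fin m → ℝ, S.E (fun ω => |φ (x, fun j => Y j ω)|) < ⊤) →
    (fun ω => (S.E (fun ω' => |φ (fun i => X i ω, fun j => Y j ω')|)).toReal) ∈ S.H →
    (fun ω => (S.E (fun ω' => φ (fun i => X i ω, fun j => Y j ω'))).toReal) ∈ S.H →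
    S.E (fun ω => (S.E (fun ω' => |φ (fun i => X i ω, fun j => Y j ω')|)).toReal) < ⊤ →
    S.E (fun ω => φ (fun i => X i ω, fun j => Y j ω)) =
      S.E (fun ω => (S.E (fun ω' => φ (fun i => X i ω, fun j => Y j ω'))).toReal)

/-- Independent and identically distributed sequence of random variables, indexed from `0`:
`Y 0, Y 1, Y 2, …` are the random variables `Y₁, Y₂, Y₃, …`. -/
structure IID (Y : ℕ → Ω → ℝ) : Prop where
  mem : ∀ i, Y i ∈ S.H
  indep : ∀ i, 1 ≤ i → S.IndepTo (fun _ : Fin 1 => Y i) (fun k : Fin i => Y k)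
  ident : ∀ i, ∀ φ : ℝ → ℝ, IsBddLip φ → S.E (fun ω => φ (Y i ω)) = S.E (fun ω => φ (Y 0 ω))

/-- `V` is an upper capacity of the sub-linear expectation space: a sub-additive capacity on the
`σ`-field (the values of `V` on other sets are never used) with `E[f] ≤ V(A) ≤ E[g]` whenever
`f ≤ I_A ≤ g`, `f, g ∈ H`. -/
structure IsUpperCapacity (V : Set Ω → ℝ≥0∞) : Prop where
  empty : V ∅ = 0
  univ : V Set.univ = 1
  mono : ∀ A B, MeasurableSet A → MeasurableSet B → A ⊆ B → V A ≤ V B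
  union_le : ∀ A B, MeasurableSet A → MeasurableSet B → V (A ∪ B) ≤ V A + V B
  le_of_le_indicator : ∀ A, MeasurableSet A → ∀ f ∈ S.H,
    (∀ ω, f ω ≤ A.indicator (fun _ => (1 : ℝ)) ω) → S.E f ≤ (V A : EReal)
  le_of_indicator_le : ∀ A, MeasurableSet A → ∀ g ∈ S.H,
    (∀ ω, A.indicator (fun _ => (1 : ℝ)) ω ≤ g ω) → (V A : EReal) ≤ S.E g

/-- `V̂(A) = inf {E[ξ] : I_A ≤ ξ, ξ ∈ H}` (here `E[ξ] ≥ 0`). -/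
noncomputable def upCap (A : Set Ω) : ℝ≥0∞ :=
  ⨅ (ξ : Ω → ℝ) (_ : ξ ∈ S.H) (_ : ∀ ω, A.indicator (fun _ => (1 : ℝ)) ω ≤ ξ ω),
    (S.E ξ).toENNReal

/-- `V̂*(A) = inf {∑ₙ V̂(Aₙ) : A ⊆ ⋃ₙ Aₙ}` with measurable `Aₙ`. -/
noncomputable def outerCap (A : Set Ω) : ℝ≥0∞ :=
  ⨅ (s : ℕ → Set Ω) (_ : ∀ n, MeasurableSet (s n)) (_ : A ⊆ ⋃ n, s n), ∑' n, S.upCap (s n)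

/-- `Ĕ[X] = lim_{c → ∞} E[(-c) ∨ (X ∧ c)]` exists in `[-∞, ∞]` and is equal to `a`. -/
def HasTruncExp (X : Ω → ℝ) (a : EReal) : Prop :=
  Tendsto (fun c : ℝ => S.E (fun ω => max (-c) (min (X ω) c))) atTop (𝓝 a)

end SubLinearExpectationSpace

/-- The Choquet integral
`C_V[X] = ∫_0^∞ V(X ≥ t) dt + ∫_{-∞}^0 (V(X ≥ t) - 1) dt`. -/
noncomputable def choquet {Ω : Type*} (V : Set Ω → ℝ≥0∞) (X : Ω → ℝ) : EReal :=
  ((∫⁻ t in Set.Ioi (0 : ℝ), V {ω | t ≤ X ω} : ℝ≥0∞) : EReal) -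
    ((∫⁻ t in Set.Iio (0 : ℝ), (1 - V {ω | t ≤ X ω}) : ℝ≥0∞) : EReal)

/-- The convention `log x = ln (max (e, x))`. -/
noncomputable def lg (x : ℝ) : ℝ := Real.log (max (Real.exp 1) x)

/-- The normalizing constants `√(2 n log log n)`. -/
noncomputable def lilNorm (n : ℕ) : ℝ := Real.sqrt (2 * n * lg (lg n))

/-- The partial sum of the first `n` variables. -/
def partialSum {Ω : Type*} (Y : ℕ → Ω → ℝ) (n : ℕ) (ω : Ω) : ℝ := ∑ i ∈ Finset.range n, Y i ω

/-- `sup_{n ≤ m ≤ N} (∑_{i ≤ m} Y_i) / √(2 m log log m)`. -/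
noncomputable def supRatio {Ω : Type*} (Y : ℕ → Ω → ℝ) (n N : ℕ) (ω : Ω) : EReal :=
  ⨆ m ∈ Finset.Icc n N, ((partialSum Y m ω / lilNorm m : ℝ) : EReal)

/-- `sup_{n ≤ m ≤ N} |∑_{i ≤ m} Y_i| / √(2 m log log m)`. -/
noncomputable def supAbsRatio {Ω : Type*} (Y : ℕ → Ω → ℝ) (n N : ℕ) (ω : Ω) : EReal :=
  ⨆ m ∈ Finset.Icc n N, ((|partialSum Y m ω| / lilNorm m : ℝ) : EReal)

/-- The moment condition `C_V[X² / log log |X|] < ∞`. -/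
def MomentCondition {Ω : Type*} (V : Set Ω → ℝ≥0∞) (X : Ω → ℝ) : Prop :=
  choquet V (fun ω => X ω ^ 2 / lg (lg |X ω|)) < ⊤

namespace SubLinearExpectationSpace

variable {Ω : Type*} [MeasurableSpace Ω] (S : SubLinearExpectationSpace Ω)

/-- The condition `Ĕ[X] = Ĕ[-X] = 0`. -/
def MeanZeroCondition (X : Ω → ℝ) : Prop :=
  S.HasTruncExp X 0 ∧ S.HasTruncExp (fun ω => -X ω) 0

/-- `σ = (Ĕ[X²])^{1/2} ∈ [0, ∞]`. -/
def IsUpperStd (X : Ω → ℝ) (σ : ℝ≥0∞) : Prop :=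
  S.HasTruncExp (fun ω => X ω ^ 2) ((σ ^ 2 : ℝ≥0∞) : EReal)

end SubLinearExpectationSpace

namespace SubLinearExpectationSpace
/-- The number `σ = (Ĕ[X²])^{1/2}` exists in `[0, ∞]` for every random variable `X`. -/
theorem exists_isUpperStd {Ω : Type*} [MeasurableSpace Ω] (S : SubLinearExpectationSpace Ω)
    (X : Ω → ℝ) (hX : X ∈ S.H) : ∃ σ : ℝ≥0∞, S.IsUpperStd X σ := by
  have hmem : ∀ c : ℝ, (fun ω => min (X ω ^ 2) c) ∈ S.H := by
    intro c
    refine S.comp_mem 1 (fun _ => X) (fun _ => hX) (fun x => min (x 0 ^ 2) c) ?_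
    refine ⟨1, one_pos, 1, fun x y => ?_⟩
    have h1 : |min (x 0 ^ 2) c - min (y 0 ^ 2) c| ≤ |x 0 ^ 2 - y 0 ^ 2| := by
      simpa using abs_min_sub_min_le_max (x 0 ^ 2) c (y 0 ^ 2) c
    have hx : |x 0| ≤ ‖x‖ := norm_le_pi_norm x 0
    have hy : |y 0| ≤ ‖y‖ := norm_le_pi_norm y 0
    have hxy : |x 0 - y 0| ≤ ‖x - y‖ := norm_le_pi_norm (x - y) 0
    have h2 : |x 0 ^ 2 - y 0 ^ 2| = |x 0 + y 0| * |x 0 - y 0| := by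
      rw [← abs_mul]; congr 1; ring
    have h3 : |x 0 + y 0| ≤ 1 + ‖x‖ + ‖y‖ := by
      have := abs_add_le (x 0) (y 0)
      linarith
    calc _ ≤ |x 0 + y 0| * |x 0 - y 0| := h1.trans h2.le
      _ ≤ (1 + ‖x‖ + ‖y‖) * ‖x - y‖ := mul_le_mul h3 hxy (abs_nonneg _) (by positivity)
      _ = _ := by ring
  let f : ℝ → EReal := fun c => S.E (fun ω => min (X ω ^ 2) (max c 0))
  have hf : Monotone f := fun a b hab => S.mono _ (hmem _) _ (hmem _)
    (fun ω => min_le_min le_rfl (max_le_max hab le_rfl))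
  have hlim := tendsto_atTop_iSup hf
  have h0 : 0 ≤ ⨆ c, f c := by
    refine le_trans ?_ (le_iSup f 0)
    have h := S.mono _ (hmem (max 0 0)) (fun _ => 0) S.H.zero_mem
      (fun ω => by simp [sq_nonneg])
    simpa [f, S.const 0] using h
  refine ⟨(⨆ c, f c).toENNReal ^ (1 / 2 : ℝ), ?_⟩
  have hsq : (((⨆ c, f c).toENNReal ^ (1 / 2 : ℝ)) ^ 2 : ℝ≥0∞) = (⨆ c, f c).toENNReal := by
    rw [← ENNReal.rpow_natCast, ← ENNReal.rpow_mul]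
    norm_num
  unfold IsUpperStd HasTruncExp
  rw [hsq, EReal.coe_toENNReal h0]
  refine hlim.congr' ?_
  filter_upwards [eventually_ge_atTop 0] with c hc
  simp only [f, max_eq_left hc]
  congr 1
  funext ω
  exact (max_eq_right (le_trans (by linarith) (le_min (sq_nonneg _) hc))).symm

end SubLinearExpectationSpace

/-! The problem is first moved from `Ω` to the real line. The distribution of one variable extends,
by an infimum over bounded Lipschitz majorants, to a sub-linear functional `L` on all bounded
functions, indicators included (`upperLaw`). Independence turns the expectation of a bounded
Lipschitz function of `n` variables into the `n`-fold iterate of `L` (`IID.eq_iterExp`). Indicators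
are not Lipschitz, but an event and a slightly larger event leave room for a Lipschitz function
between them, so `V` and `upCap` are compared with iterates of `L` at the price of an arbitrarily
small change of the level. From then on one works with `iterExp` only; conditioning arguments become
one-step inequalities for `L`.

The moment condition is equivalent in strength to summability of `4^j / llog (2^j)` times the tail
at `2^j`. Four facts follow from it: truncated second moments at the level `d_n` are `o(llog n)`;
`n` times the tail at `d_n` vanishes; the truncation bias of the mean is `o(d_n / n)`; and the
normalized truncated third moments are summable along geometric sequences.

Upper bound: truncate at `ε d_n` and apply the exponential maximal inequality. By `exists_exponent`
the probability that the maximum of the partial sums exceeds `ρ d_n`, with `ρ` above the upper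
standard deviation, is at most a constant times the normalized third moment plus `exp (-(1 + δ) llog
n)`. Both are summable along `(i + 1) 4^k` for each `i` in a finite range. Taking this range `R ≤ i
< 4R` with `R` large makes the grid fine enough to control every index, and a Borel–Cantelli
argument ends the proof.

Lower bound: by Hahn–Banach some linear functional below `L` attains the upper truncated variance
`S`. Tilting it by a density `1 + η (clip - mean)` gives the block sum a drift of about `K d_n` at
an entropy cost of about `(K² / S) llog n`, less than `llog n` if `K² < S`. A block ending at `n`
therefore succeeds with probability at least `exp (-(1 - δ) llog n) / 2`. With blocks ending at
`(k!)²` these probabilities have a divergent sum, whereas the probabilities that the past spoils a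
block are summable.

Necessity: if the moment condition fails, single summands exceed multiples of `d_n` with functional
close to one, by divergence of the tail sums. If it holds but the truncated means do not vanish, a
linear functional attaining such a mean makes the sum grow linearly, far beyond `d_n`. If both hold
and the variance is infinite, the lower bound applies with every `K`. Each case contradicts a
capacity bounded away from one. -/

/-! ### Sub-linear functionals on bounded functions -/

/-- The real function `f` is bounded. -/
def IsBdd {α : Type*} (f : α → ℝ) : Prop := ∃ C, ∀ x, |f x| ≤ C

/-- The real indicator function of a set. -/
noncomputable def ind {α : Type*} (A : Set α) : α → ℝ := A.indicator (fun _ => 1)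

section IsBdd
variable {α β : Type*} {f g : α → ℝ}

theorem IsBdd.const (c : ℝ) : IsBdd (fun _ : α => c) := ⟨|c|, fun _ => le_rfl⟩

theorem IsBdd.add (hf : IsBdd f) (hg : IsBdd g) : IsBdd (fun x => f x + g x) := by
  obtain ⟨C, hC⟩ := hf
  obtain ⟨D, hD⟩ := hg
  exact ⟨C + D, fun x => (abs_add_le _ _).trans (add_le_add (hC x) (hD x))⟩

theorem IsBdd.neg (hf : IsBdd f) : IsBdd (fun x => -f x) := by
  obtain ⟨C, hC⟩ := hf
  exact ⟨C, fun x => by simpa using hC x⟩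

theorem IsBdd.sub (hf : IsBdd f) (hg : IsBdd g) : IsBdd (fun x => f x - g x) := by
  simpa only [sub_eq_add_neg] using hf.add hg.neg

theorem IsBdd.mul (hf : IsBdd f) (hg : IsBdd g) : IsBdd (fun x => f x * g x) := by
  obtain ⟨C, hC⟩ := hf
  obtain ⟨D, hD⟩ := hg
  refine ⟨C * D, fun x => ?_⟩
  rw [abs_mul]
  exact mul_le_mul (hC x) (hD x) (abs_nonneg _) ((abs_nonneg _).trans (hC x))

theorem IsBdd.const_mul (hf : IsBdd f) (c : ℝ) : IsBdd (fun x => c * f x) :=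
  (IsBdd.const c).mul hf

theorem IsBdd.pow (hf : IsBdd f) (n : ℕ) : IsBdd (fun x => f x ^ n) := by
  obtain ⟨C, hC⟩ := hf
  refine ⟨C ^ n, fun x => ?_⟩
  rw [abs_pow]
  exact pow_le_pow_left₀ (abs_nonneg _) (hC x) n

theorem IsBdd.abs (hf : IsBdd f) : IsBdd (fun x => |f x|) := by
  obtain ⟨C, hC⟩ := hf
  exact ⟨C, fun x => by simpa using hC x⟩

theorem IsBdd.comp (hf : IsBdd f) (u : β → α) : IsBdd (fun x => f (u x)) := by
  obtain ⟨C, hC⟩ := hf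
  exact ⟨C, fun x => hC (u x)⟩

theorem IsBdd.sum {ι : Type*} (s : Finset ι) {F : ι → α → ℝ} (h : ∀ i ∈ s, IsBdd (F i)) :
    IsBdd (fun x => ∑ i ∈ s, F i x) := by
  classical
  induction s using Finset.induction_on with
  | empty => simpa using IsBdd.const (α := α) 0
  | insert a s ha ih =>
    simp only [Finset.sum_insert ha]
    exact (h a (Finset.mem_insert_self _ _)).add
      (ih fun i hi => h i (Finset.mem_insert_of_mem hi))

theorem IsBdd.prod {ι : Type*} (s : Finset ι) {F : ι → α → ℝ} (h : ∀ i ∈ s, IsBdd (F i)) :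
    IsBdd (fun x => ∏ i ∈ s, F i x) := by
  classical
  induction s using Finset.induction_on with
  | empty => simpa using IsBdd.const (α := α) 1
  | insert a s ha ih =>
    simp only [Finset.prod_insert ha]
    exact (h a (Finset.mem_insert_self _ _)).mul
      (ih fun i hi => h i (Finset.mem_insert_of_mem hi))

theorem IsBdd.of_Icc {a b : ℝ} (h : ∀ x, a ≤ f x ∧ f x ≤ b) : IsBdd f :=
  ⟨max |a| |b|, fun x => abs_le_max_abs_abs (h x).1 (h x).2⟩

theorem IsBdd.exp (hf : IsBdd f) : IsBdd (fun x => Real.exp (f x)) := by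
  obtain ⟨C, hC⟩ := hf
  exact IsBdd.of_Icc (a := 0) (b := Real.exp C) fun x =>
    ⟨(Real.exp_pos _).le, Real.exp_le_exp.2 ((le_abs_self _).trans (hC x))⟩

theorem ind_nonneg (A : Set α) (x : α) : 0 ≤ ind A x :=
  Set.indicator_nonneg (fun _ _ => zero_le_one) x

theorem ind_le_one (A : Set α) (x : α) : ind A x ≤ 1 :=
  Set.indicator_le_self' (fun _ _ => zero_le_one) x

theorem isBdd_ind (A : Set α) : IsBdd (ind A) :=
  IsBdd.of_Icc fun x => ⟨ind_nonneg A x, ind_le_one A x⟩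

theorem ind_of_mem {A : Set α} {x : α} (h : x ∈ A) : ind A x = 1 := Set.indicator_of_mem h _

theorem ind_of_notMem {A : Set α} {x : α} (h : x ∉ A) : ind A x = 0 := Set.indicator_of_notMem h _

theorem ind_mono {A B : Set α} (h : A ⊆ B) (x : α) : ind A x ≤ ind B x :=
  Set.indicator_le_indicator_of_subset h (fun _ => zero_le_one) x

/-- An indicator is below a nonnegative function which is at least one on the set. -/
theorem ind_le {A : Set α} {x : α} {c : ℝ} (h0 : 0 ≤ c) (h1 : x ∈ A → 1 ≤ c) : ind A x ≤ c := by
  by_cases h : x ∈ A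
  · rw [ind_of_mem h]; exact h1 h
  · rw [ind_of_notMem h]; exact h0

end IsBdd

/-- A sub-linear functional on the bounded functions on `ℝ`; its values at unbounded functions are
never used. -/
structure IsUpperExp (L : (ℝ → ℝ) → ℝ) : Prop where
  mono : ∀ f g, IsBdd f → IsBdd g → (∀ x, f x ≤ g x) → L f ≤ L g
  const : ∀ c : ℝ, L (fun _ => c) = c
  add_le : ∀ f g, IsBdd f → IsBdd g → L (fun x => f x + g x) ≤ L f + L g
  smul : ∀ f, IsBdd f → ∀ c : ℝ, 0 ≤ c → L (fun x => c * f x) = c * L f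

/-- A positive normalized linear functional on the bounded functions on `ℝ`. -/
structure IsLinExp (L : (ℝ → ℝ) → ℝ) : Prop extends IsUpperExp L where
  add_eq : ∀ f g, IsBdd f → IsBdd g → L (fun x => f x + g x) = L f + L g

namespace IsUpperExp
variable {L : (ℝ → ℝ) → ℝ} (hL : IsUpperExp L) {f g : ℝ → ℝ}
include hL

theorem le_const (hf : IsBdd f) {c : ℝ} (h : ∀ x, f x ≤ c) : L f ≤ c :=
  (hL.mono _ _ hf (IsBdd.const c) h).trans_eq (hL.const c)

theorem const_le (hf : IsBdd f) {c : ℝ} (h : ∀ x, c ≤ f x) : c ≤ L f :=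
  (hL.const c).symm.le.trans (hL.mono _ _ (IsBdd.const c) hf h)

theorem nonneg (hf : IsBdd f) (h : ∀ x, 0 ≤ f x) : 0 ≤ L f := hL.const_le hf h

theorem abs_le {C : ℝ} (h : ∀ x, |f x| ≤ C) : |L f| ≤ C :=
  _root_.abs_le.2 ⟨hL.const_le ⟨C, h⟩ fun x => (_root_.abs_le.1 (h x)).1,
    hL.le_const ⟨C, h⟩ fun x => (_root_.abs_le.1 (h x)).2⟩

theorem add_const (hf : IsBdd f) (c : ℝ) : L (fun x => f x + c) = L f + c := by
  apply le_antisymm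
  · simpa [hL.const] using hL.add_le f (fun _ => c) hf (IsBdd.const c)
  · have h := hL.add_le (fun x => f x + c) (fun _ => -c) (hf.add (IsBdd.const c)) (IsBdd.const _)
    simp only [add_neg_cancel_right, hL.const] at h
    linarith

theorem affine (hf : IsBdd f) {a : ℝ} (ha : 0 ≤ a) (c : ℝ) :
    L (fun x => a * f x + c) = a * L f + c := by
  rw [hL.add_const (hf.const_mul a), hL.smul f hf a ha]

theorem neg_neg_le (hf : IsBdd f) : -L (fun x => -f x) ≤ L f := by
  have h := hL.add_le f (fun x => -f x) hf hf.neg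
  simp only [add_neg_cancel, hL.const] at h
  linarith

theorem sum_le {ι : Type*} (s : Finset ι) {F : ι → ℝ → ℝ} (h : ∀ i ∈ s, IsBdd (F i)) :
    L (fun x => ∑ i ∈ s, F i x) ≤ ∑ i ∈ s, L (F i) := by
  classical
  induction s using Finset.induction_on with
  | empty => simp [hL.const]
  | insert a s ha ih =>
    simp only [Finset.sum_insert ha]
    have h1 := hL.add_le (F a) (fun x => ∑ i ∈ s, F i x) (h a (Finset.mem_insert_self _ _))
      (IsBdd.sum s fun i hi => h i (Finset.mem_insert_of_mem hi))
    have h2 := ih fun i hi => h i (Finset.mem_insert_of_mem hi)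
    linarith

end IsUpperExp

/-! ### Iterated functionals on functions of a sequence -/

/-- Apply `L` in the coordinate `i`. -/
def stepExp (L : (ℝ → ℝ) → ℝ) (i : ℕ) (Φ : (ℕ → ℝ) → ℝ) (x : ℕ → ℝ) : ℝ :=
  L fun y => Φ (Function.update x i y)

/-- Apply `L` in the coordinates `a + n - 1, …, a + 1, a`, in this order. -/
def iterExp (L : (ℝ → ℝ) → ℝ) (a : ℕ) : ℕ → ((ℕ → ℝ) → ℝ) → (ℕ → ℝ) → ℝ
  | 0, Φ => Φ
  | n + 1, Φ => iterExp L a n (stepExp L (a + n) Φ)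

/-- `Φ` does not depend on the coordinates from `a` on. -/
def NoDepFrom (a : ℕ) (Φ : (ℕ → ℝ) → ℝ) : Prop :=
  ∀ x i y, a ≤ i → Φ (Function.update x i y) = Φ x

theorem iterExp_add (L : (ℝ → ℝ) → ℝ) (a n m : ℕ) (Φ : (ℕ → ℝ) → ℝ) :
    iterExp L a (n + m) Φ = iterExp L a n (iterExp L (a + n) m Φ) := by
  induction m generalizing Φ with
  | zero => rfl
  | succ m ih =>
    change iterExp L a (n + m) (stepExp L (a + (n + m)) Φ) = _
    rw [ih, ← add_assoc a n m]
    rfl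

namespace IsUpperExp
variable {L : (ℝ → ℝ) → ℝ} (hL : IsUpperExp L) {Φ Ψ : (ℕ → ℝ) → ℝ}
include hL

theorem isBdd_step (h : IsBdd Φ) (i : ℕ) : IsBdd (stepExp L i Φ) := by
  obtain ⟨C, hC⟩ := h
  exact ⟨C, fun x => hL.abs_le fun y => hC _⟩

theorem isBdd_iter (h : IsBdd Φ) (a n : ℕ) : IsBdd (iterExp L a n Φ) := by
  induction n generalizing Φ with
  | zero => exact h
  | succ n ih => exact ih (hL.isBdd_step h _)

theorem step_mono (hΦ : IsBdd Φ) (hΨ : IsBdd Ψ) (h : ∀ x, Φ x ≤ Ψ x) (i : ℕ) (x : ℕ → ℝ) :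
    stepExp L i Φ x ≤ stepExp L i Ψ x :=
  hL.mono _ _ (hΦ.comp _) (hΨ.comp _) fun _ => h _

theorem iter_mono (hΦ : IsBdd Φ) (hΨ : IsBdd Ψ) (h : ∀ x, Φ x ≤ Ψ x) (a n : ℕ) (x : ℕ → ℝ) :
    iterExp L a n Φ x ≤ iterExp L a n Ψ x := by
  induction n generalizing Φ Ψ with
  | zero => exact h x
  | succ n ih => exact ih (hL.isBdd_step hΦ _) (hL.isBdd_step hΨ _) (hL.step_mono hΦ hΨ h _)

theorem iter_const (c : ℝ) (a n : ℕ) (x : ℕ → ℝ) : iterExp L a n (fun _ => c) x = c := by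
  induction n with
  | zero => rfl
  | succ n ih =>
    have : stepExp L (a + n) (fun _ => c) = fun _ => c := funext fun x => hL.const c
    rw [iterExp, this, ih]

theorem iter_add_le (hΦ : IsBdd Φ) (hΨ : IsBdd Ψ) (a n : ℕ) (x : ℕ → ℝ) :
    iterExp L a n (fun x => Φ x + Ψ x) x ≤ iterExp L a n Φ x + iterExp L a n Ψ x := by
  induction n generalizing Φ Ψ with
  | zero => exact le_rfl
  | succ n ih =>
    refine le_trans ?_ (ih (hL.isBdd_step hΦ _) (hL.isBdd_step hΨ _))
    exact hL.iter_mono (hL.isBdd_step (hΦ.add hΨ) _)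
      ((hL.isBdd_step hΦ _).add (hL.isBdd_step hΨ _))
      (fun x => hL.add_le _ _ (hΦ.comp _) (hΨ.comp _)) _ _ _

/-- This is the substitute for taking out what is known: coefficients that depend on the past are
constants while the later coordinates are integrated. The sign of `B` matters because `L` is
homogeneous for nonnegative scalars only. -/
theorem iter_affine (hΦ : IsBdd Φ) {B C : (ℕ → ℝ) → ℝ} (hB : ∀ x, 0 ≤ B x) {a : ℕ}
    (hBa : NoDepFrom a B) (hCa : NoDepFrom a C) (n : ℕ) (x : ℕ → ℝ) :
    iterExp L a n (fun x => B x * Φ x + C x) x = B x * iterExp L a n Φ x + C x := by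
  induction n generalizing Φ with
  | zero => rfl
  | succ n ih =>
    have : stepExp L (a + n) (fun x => B x * Φ x + C x) =
        fun x => B x * stepExp L (a + n) Φ x + C x := by
      funext x
      simp only [stepExp, hBa x _ _ (Nat.le_add_right a n), hCa x _ _ (Nat.le_add_right a n)]
      exact hL.affine (hΦ.comp _) (hB x) _
    rw [iterExp, this, ih (hL.isBdd_step hΦ _)]
    rfl

theorem iter_of_noDep {a : ℕ} (h : NoDepFrom a Φ) (n : ℕ) : iterExp L a n Φ = Φ := by
  funext x
  have h1 := hL.iter_affine (IsBdd.const 0) (B := fun _ => 0) (C := Φ) (fun _ => le_rfl)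
    (fun _ _ _ _ => rfl) h n x
  simpa using h1

theorem iter_const_mul (hΦ : IsBdd Φ) {c : ℝ} (hc : 0 ≤ c) (a n : ℕ) (x : ℕ → ℝ) :
    iterExp L a n (fun x => c * Φ x) x = c * iterExp L a n Φ x := by
  have h1 := hL.iter_affine hΦ (B := fun _ => c) (C := fun _ => 0) (fun _ => hc)
    (a := a) (fun _ _ _ _ => rfl) (fun _ _ _ _ => rfl) n x
  simpa using h1

theorem iter_nonneg (hΦ : IsBdd Φ) (h : ∀ x, 0 ≤ Φ x) (a n : ℕ) (x : ℕ → ℝ) :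
    0 ≤ iterExp L a n Φ x :=
  (hL.iter_const 0 a n x).symm.le.trans (hL.iter_mono (IsBdd.const 0) hΦ h a n x)

theorem iter_le_one (hΦ : IsBdd Φ) (h : ∀ x, Φ x ≤ 1) (a n : ℕ) (x : ℕ → ℝ) :
    iterExp L a n Φ x ≤ 1 :=
  (hL.iter_mono hΦ (IsBdd.const 1) h a n x).trans_eq (hL.iter_const 1 a n x)

theorem iter_sum_le {ι : Type*} (s : Finset ι) {F : ι → (ℕ → ℝ) → ℝ} (h : ∀ i ∈ s, IsBdd (F i))
    (a n : ℕ) (x : ℕ → ℝ) :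
    iterExp L a n (fun x => ∑ i ∈ s, F i x) x ≤ ∑ i ∈ s, iterExp L a n (F i) x := by
  classical
  induction s using Finset.induction_on with
  | empty => simp [hL.iter_const]
  | insert b s hb ih =>
    simp only [Finset.sum_insert hb]
    have h1 := hL.iter_add_le (h b (Finset.mem_insert_self _ _))
      (IsBdd.sum s fun i hi => h i (Finset.mem_insert_of_mem hi)) a n x
    have h2 := ih fun i hi => h i (Finset.mem_insert_of_mem hi)
    linarith

/-- A dominated functional has dominated iterates. -/
theorem iter_le_of_le {L' : (ℝ → ℝ) → ℝ} (hL' : IsUpperExp L')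
    (h : ∀ f, IsBdd f → L' f ≤ L f) (hΦ : IsBdd Φ) (a n : ℕ) (x : ℕ → ℝ) :
    iterExp L' a n Φ x ≤ iterExp L a n Φ x := by
  induction n generalizing Φ with
  | zero => exact le_rfl
  | succ n ih =>
    exact (ih (hL'.isBdd_step hΦ _)).trans
      (hL.iter_mono (hL'.isBdd_step hΦ _) (hL.isBdd_step hΦ _) (fun x => h _ (hΦ.comp _)) _ _ _)

/-- The supermartingale principle. -/
theorem iter_le_of_supermartingale {a n : ℕ} (G : ℕ → (ℕ → ℝ) → ℝ) (hG : ∀ j, IsBdd (G j))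
    (h : ∀ j < n, ∀ x, L (fun y => G (j + 1) (Function.update x (a + j) y)) ≤ G j x)
    (x : ℕ → ℝ) : iterExp L a n (G n) x ≤ G 0 x := by
  induction n with
  | zero => exact le_rfl
  | succ n ih =>
    refine le_trans ?_ (ih fun j hj => h j (hj.trans n.lt_succ_self))
    exact hL.iter_mono (hL.isBdd_step (hG _) _) (hG _) (h n n.lt_succ_self) _ _ _

end IsUpperExp

theorem noDepFrom_ind {a : ℕ} {A : Set (ℕ → ℝ)}
    (h : ∀ x z : ℕ → ℝ, (∀ i < a, x i = z i) → x ∈ A → z ∈ A) : NoDepFrom a (ind A) := by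
  intro x i y hi
  have h1 : ∀ j < a, Function.update x i y j = x j := fun j hj =>
    Function.update_of_ne (by omega) _ _
  by_cases hx : x ∈ A
  · rw [ind_of_mem hx, ind_of_mem (h _ _ (fun j hj => (h1 j hj).symm) hx)]
  · rw [ind_of_notMem hx, ind_of_notMem fun hA => hx (h _ _ h1 hA)]

/-- The sum of `f` over the coordinates `a, …, a + j - 1`. -/
def coordSum (f : ℝ → ℝ) (a j : ℕ) (x : ℕ → ℝ) : ℝ := ∑ i ∈ Finset.range j, f (x (a + i))

theorem coordSum_succ (f : ℝ → ℝ) (a j : ℕ) (x : ℕ → ℝ) :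
    coordSum f a (j + 1) x = coordSum f a j x + f (x (a + j)) := Finset.sum_range_succ _ _

theorem coordSum_congr (f : ℝ → ℝ) (a j : ℕ) {x z : ℕ → ℝ} (h : ∀ i < a + j, x i = z i) :
    coordSum f a j x = coordSum f a j z :=
  Finset.sum_congr rfl fun i hi => by rw [h _ (by have := Finset.mem_range.1 hi; omega)]

theorem coordSum_update (f : ℝ → ℝ) (a j k : ℕ) (hk : a + j ≤ k) (x : ℕ → ℝ) (y : ℝ) :
    coordSum f a j (Function.update x k y) = coordSum f a j x :=
  coordSum_congr f a j fun i hi => Function.update_of_ne (by omega) _ _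

theorem coordSum_succ_update (f : ℝ → ℝ) (a j : ℕ) (x : ℕ → ℝ) (y : ℝ) :
    coordSum f a (j + 1) (Function.update x (a + j) y) = coordSum f a j x + f y := by
  rw [coordSum_succ, coordSum_update f a j _ le_rfl, Function.update_self]

theorem isBdd_coordSum {f : ℝ → ℝ} (hf : IsBdd f) (a j : ℕ) : IsBdd (coordSum f a j) :=
  IsBdd.sum _ fun i _ => hf.comp fun x : ℕ → ℝ => x (a + i)

theorem IsBdd.ite {α : Type*} {f g : α → ℝ} (hf : IsBdd f) (hg : IsBdd g) (p : α → Prop)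
    [DecidablePred p] : IsBdd (fun x => if p x then f x else g x) := by
  obtain ⟨C, hC⟩ := hf
  obtain ⟨D, hD⟩ := hg
  refine ⟨max C D, fun x => ?_⟩
  dsimp only
  split_ifs
  · exact (hC x).trans (le_max_left _ _)
  · exact (hD x).trans (le_max_right _ _)

/-! ### Exponential, second moment and union bounds -/

namespace IsUpperExp
variable {L : (ℝ → ℝ) → ℝ} (hL : IsUpperExp L) {f : ℝ → ℝ}
include hL

/-- The exponential maximal inequality. -/
theorem iter_max_le (hf : IsBdd f) {r M t : ℝ} (hr : 0 ≤ r) (hM1 : 1 ≤ M)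
    (hM : L (fun y => Real.exp (r * f y)) ≤ M) (ht : 0 < t) (a n : ℕ) (x : ℕ → ℝ) :
    iterExp L a n (ind {x | ∃ m ≤ n, t ≤ coordSum f a m x}) x ≤ Real.exp (-(r * t)) * M ^ n := by
  classical
  -- A stopped exponential supermartingale: it is frozen at one once the level has been crossed, and
  -- before that the power of `M` pays for the steps still to come.
  let G : ℕ → (ℕ → ℝ) → ℝ := fun j x => if ∃ m ≤ j, t ≤ coordSum f a m x then 1 else
    M ^ (n - j) * Real.exp (r * (coordSum f a j x - t))
  have hG : ∀ j, IsBdd (G j) := fun j => IsBdd.ite (IsBdd.const 1)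
    ((((isBdd_coordSum hf a j).sub (IsBdd.const t)).const_mul r).exp.const_mul _) _
  have h0 : G 0 x = Real.exp (-(r * t)) * M ^ n := by
    have : ¬ ∃ m ≤ 0, t ≤ coordSum f a m x := by
      rintro ⟨m, hm, h⟩
      obtain rfl : m = 0 := by omega
      simp [coordSum] at h
      linarith
    have h1 : G 0 x = M ^ (n - 0) * Real.exp (r * (coordSum f a 0 x - t)) := if_neg this
    rw [h1, mul_comm, Nat.sub_zero]
    congr 2
    simp [coordSum]
  rw [← h0]
  refine le_trans (hL.iter_mono (isBdd_ind _) (hG n) (fun x => ?_) a n x)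
    (hL.iter_le_of_supermartingale G hG ?_ x)
  · refine ind_le ?_ fun h => ?_
    · simp only [G]; split_ifs <;> positivity
    · have h1 : G n x = 1 := if_pos h
      rw [h1]
  · intro j hj x
    have hbd : IsBdd (fun y => G (j + 1) (Function.update x (a + j) y)) := (hG _).comp _
    by_cases hE : ∃ m ≤ j, t ≤ coordSum f a m x
    · have h1 : G j x = 1 := if_pos hE
      rw [h1]
      refine hL.le_const hbd fun y => ?_
      obtain ⟨m, hm, h⟩ := hE
      have : ∃ m ≤ j + 1, t ≤ coordSum f a m (Function.update x (a + j) y) :=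
        ⟨m, by omega, by rwa [coordSum_update f a m _ (by omega)]⟩
      simp only [G]; rw [if_pos this]
    · have h1 : G j x = M ^ (n - j) * Real.exp (r * (coordSum f a j x - t)) := if_neg hE
      set c := M ^ (n - (j + 1)) * Real.exp (r * (coordSum f a j x - t)) with hc
      have hM0 : 0 < M := by linarith
      have hbe : IsBdd fun y => Real.exp (r * f y) := (hf.const_mul r).exp
      have h2 : ∀ y, G (j + 1) (Function.update x (a + j) y) ≤ c * Real.exp (r * f y) := by
        intro y
        have h3 : c * Real.exp (r * f y) =
            M ^ (n - (j + 1)) * Real.exp (r * (coordSum f a j x + f y - t)) := by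
          rw [hc, mul_assoc, ← Real.exp_add]; congr 2; ring
        simp only [G]
        split_ifs with h4
        -- The level is crossed exactly at step `j + 1`; there the exponential and the power of `M`
        -- are both at least one, so they dominate the frozen value.
        · obtain ⟨m, hm, h⟩ := h4
          have hmj : m = j + 1 := by
            by_contra hne
            rw [coordSum_update f a m _ (by omega)] at h
            exact hE ⟨m, by omega, h⟩
          subst hmj
          rw [coordSum_succ_update] at h
          rw [h3]
          have h5 : (1 : ℝ) ≤ M ^ (n - (j + 1)) := one_le_pow₀ hM1
          have h6 : (1 : ℝ) ≤ Real.exp (r * (coordSum f a j x + f y - t)) :=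
            Real.one_le_exp (mul_nonneg hr (by linarith))
          nlinarith
        · rw [coordSum_succ_update, h3]
      have hc0 : 0 ≤ c := by positivity
      calc _ ≤ L (fun y => c * Real.exp (r * f y)) := hL.mono _ _ hbd (hbe.const_mul c) h2
        _ = c * L (fun y => Real.exp (r * f y)) := hL.smul _ hbe c hc0
        _ ≤ c * M := mul_le_mul_of_nonneg_left hM hc0
        _ = G j x := by
          rw [h1, hc, show n - j = n - (j + 1) + 1 by omega, pow_succ]; ring

/-- A bound for the second moment of a sum. -/
theorem iter_sq_le (hf : IsBdd f) {v m : ℝ} (hv : L (fun y => f y ^ 2) ≤ v)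
    (hm : L f ≤ m) (hm' : L (fun y => -f y) ≤ m) (a n : ℕ) (x : ℕ → ℝ) :
    iterExp L a n (fun x => coordSum f a n x ^ 2) x ≤ 3 * (n * v + n ^ 2 * m ^ 2) := by
  rcases Nat.eq_zero_or_pos n with rfl | hn
  · simp [iterExp, coordSum]
  have hn0 : (0 : ℝ) < n := by exact_mod_cast hn
  have hv0 : 0 ≤ v := (hL.nonneg (hf.pow 2) fun y => sq_nonneg _).trans hv
  set q := v + n * m ^ 2 with hq
  have hq0 : 0 ≤ q := by positivity
  -- Each step multiplies the second moment by at most `1 + 1/n` and adds `q`. The exponential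
  -- weight absorbs these factors; their total is at most `e < 3`, which is the constant in the
  -- bound.
  let G : ℕ → (ℕ → ℝ) → ℝ := fun j x =>
    Real.exp (((n : ℝ) - j) / n) * (coordSum f a j x ^ 2 + ((n : ℝ) - j) * q)
  have hG : ∀ j, IsBdd (G j) := fun j =>
    (((isBdd_coordSum hf a j).pow 2).add (IsBdd.const _)).const_mul _
  have hend : iterExp L a n (G n) x = iterExp L a n (fun x => coordSum f a n x ^ 2) x := by
    congr 1; funext x; simp [G]
  have h0 : G 0 x ≤ 3 * (n * v + n ^ 2 * m ^ 2) := by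
    have : G 0 x = Real.exp 1 * (n * q) := by
      simp [G, coordSum, hn0.ne']
    rw [this, show n * v + n ^ 2 * m ^ 2 = n * q by rw [hq]; ring]
    exact mul_le_mul_of_nonneg_right Real.exp_one_lt_three.le (by positivity)
  rw [← hend]
  refine le_trans (hL.iter_le_of_supermartingale G hG ?_ x) h0
  intro j hj x
  have hjn : (j : ℝ) + 1 ≤ n := by exact_mod_cast hj
  set s := coordSum f a j x with hs
  -- The cross term has the sign of the past sum, hence the bound on the means of both `f` and `-f`.
  have hcross : L (fun y => 2 * s * f y) ≤ 2 * |s| * m := by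
    rcases le_total 0 s with h | h
    · rw [hL.smul f hf _ (by positivity), abs_of_nonneg h]
      exact mul_le_mul_of_nonneg_left hm (by positivity)
    · have : (fun y => 2 * s * f y) = fun y => (2 * -s) * -f y := by funext y; ring
      rw [this, hL.smul _ hf.neg _ (by linarith), abs_of_nonpos h]
      exact mul_le_mul_of_nonneg_left hm' (by linarith)
  have h1 : L (fun y => (s + f y) ^ 2 + ((n : ℝ) - (j + 1)) * q) ≤
      (1 + 1 / n) * (s ^ 2 + ((n : ℝ) - j) * q) := by
    have e1 : (fun y => (s + f y) ^ 2 + ((n : ℝ) - (j + 1)) * q) =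
        fun y => (2 * s * f y + f y ^ 2) + (s ^ 2 + ((n : ℝ) - (j + 1)) * q) := by
      funext y; ring
    rw [e1, hL.add_const ((hf.const_mul _).add (hf.pow 2))]
    have e2 := hL.add_le _ _ (hf.const_mul (2 * s)) (hf.pow 2)
    -- Young's inequality with weight `n`: one part is charged to the factor `1 + 1/n`, the other to
    -- `q`.
    have e3 : 2 * |s| * m ≤ s ^ 2 / n + n * m ^ 2 := by
      have : 0 ≤ (|s| - n * m) ^ 2 / n := by positivity
      have h2 : (|s| - n * m) ^ 2 / n = s ^ 2 / n + n * m ^ 2 - 2 * |s| * m := by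
        rw [sub_sq, sq_abs]; field_simp; ring
      linarith
    have e4 : 0 ≤ 1 / (n : ℝ) * (((n : ℝ) - j) * q) :=
      mul_nonneg (by positivity) (mul_nonneg (by linarith) hq0)
    have e5 : (1 + 1 / (n : ℝ)) * (s ^ 2 + ((n : ℝ) - j) * q) =
      s ^ 2 + s ^ 2 / n + ((n : ℝ) - j) * q + 1 / (n : ℝ) * (((n : ℝ) - j) * q) := by ring
    rw [e5]
    have e6 : ((n : ℝ) - (j + 1)) * q = ((n : ℝ) - j) * q - q := by ring
    linarith
  have h2 : (1 + 1 / (n : ℝ)) ≤ Real.exp (1 / n) := by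
    linarith [Real.add_one_le_exp (1 / (n : ℝ))]
  have h3 : 0 ≤ s ^ 2 + ((n : ℝ) - j) * q :=
    add_nonneg (sq_nonneg _) (mul_nonneg (by linarith) hq0)
  have e0 : (fun y => G (j + 1) (Function.update x (a + j) y)) = fun y =>
      Real.exp (((n : ℝ) - (j + 1)) / n) * ((s + f y) ^ 2 + ((n : ℝ) - (j + 1)) * q) := by
    funext y; simp only [G, coordSum_succ_update, ← hs]; push_cast; rfl
  rw [e0, hL.smul _ ((((IsBdd.const s).add hf).pow 2).add (IsBdd.const _)) _ (Real.exp_pos _).le]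
  calc _ ≤ Real.exp (((n : ℝ) - (j + 1)) / n) * (Real.exp (1 / n) * (s ^ 2 + ((n : ℝ) - j) * q)) :=
        mul_le_mul_of_nonneg_left (h1.trans (mul_le_mul_of_nonneg_right h2 h3)) (Real.exp_pos _).le
    _ = G j x := by
      rw [← mul_assoc, ← Real.exp_add]; simp only [G]; congr 2; field_simp; ring

/-- Chebyshev's inequality for sums. -/
theorem iter_cheb (hf : IsBdd f) {v m t : ℝ} (hv : L (fun y => f y ^ 2) ≤ v)
    (hm : L f ≤ m) (hm' : L (fun y => -f y) ≤ m) (ht : 0 < t) (a n : ℕ) (x : ℕ → ℝ) :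
    iterExp L a n (ind {x | t ≤ |coordSum f a n x|}) x ≤
      3 * (n * v + n ^ 2 * m ^ 2) / t ^ 2 := by
  have hb := (isBdd_coordSum hf a n).pow 2
  calc _ ≤ iterExp L a n (fun x => (1 / t ^ 2) * coordSum f a n x ^ 2) x := by
        refine hL.iter_mono (isBdd_ind _) (hb.const_mul _) (fun x => ?_) a n x
        refine ind_le (by positivity) fun h => ?_
        have h' : t ≤ |coordSum f a n x| := h
        rw [one_div, inv_mul_eq_div, one_le_div (by positivity), ← sq_abs (coordSum f a n x)]
        exact pow_le_pow_left₀ ht.le h' 2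
    _ = (1 / t ^ 2) * iterExp L a n (fun x => coordSum f a n x ^ 2) x :=
        hL.iter_const_mul hb (by positivity) a n x
    _ ≤ (1 / t ^ 2) * (3 * (n * v + n ^ 2 * m ^ 2)) :=
        mul_le_mul_of_nonneg_left (hL.iter_sq_le hf hv hm hm' a n x) (by positivity)
    _ = _ := by ring

theorem iter_coordSum_le (hf : IsBdd f) {m : ℝ} (hm : L f ≤ m) (a n : ℕ) (x : ℕ → ℝ) :
    iterExp L a n (coordSum f a n) x ≤ n * m := by
  let G : ℕ → (ℕ → ℝ) → ℝ := fun j x => coordSum f a j x + ((n : ℝ) - j) * m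
  have hG : ∀ j, IsBdd (G j) := fun j => (isBdd_coordSum hf a j).add (IsBdd.const _)
  have h := hL.iter_le_of_supermartingale (a := a) (n := n) G hG ?_ x
  · have e : G n = coordSum f a n := by funext x; simp [G]
    rw [e] at h
    simpa [G, coordSum] using h
  · intro j _ x
    simp only [G, coordSum_succ_update]
    have e : (fun y => coordSum f a j x + f y + ((n : ℝ) - (j + 1 : ℕ)) * m) =
        fun y => f y + (coordSum f a j x + ((n : ℝ) - (j + 1 : ℕ)) * m) := by funext y; ring
    rw [e, hL.add_const hf]
    push_cast
    linarith

/-- The union bound for the event that some coordinate lies in a given set. -/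
theorem iter_exists_le (A : Set ℝ) (a n : ℕ) (x : ℕ → ℝ) :
    iterExp L a n (ind {x | ∃ i < n, x (a + i) ∈ A}) x ≤ n * L (ind A) := by
  refine le_trans ?_ (hL.iter_coordSum_le (isBdd_ind A) le_rfl a n x)
  refine hL.iter_mono (isBdd_ind _) (isBdd_coordSum (isBdd_ind A) a n) (fun x => ?_) a n x
  refine ind_le (Finset.sum_nonneg fun i _ => ind_nonneg _ _) fun h => ?_
  obtain ⟨i, hi, hA⟩ := h
  rw [← ind_of_mem hA]
  exact Finset.single_le_sum (f := fun i => ind A (x (a + i))) (fun i _ => ind_nonneg _ _)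
    (Finset.mem_range.2 hi)

/-- Independent blocks: a lower bound for the functional of `1 - ∏ (1 - gₖ)`. -/
theorem iter_blocks {c : ℕ → ℕ} (hc : Monotone c) {g : ℕ → (ℕ → ℝ) → ℝ} {p : ℕ → ℝ}
    (hg0 : ∀ k x, 0 ≤ g k x) (hg1 : ∀ k x, g k x ≤ 1) (hdep : ∀ k, NoDepFrom (c (k + 1)) (g k))
    {k₀ : ℕ} (hp1 : ∀ k, p k ≤ 1)
    (hp : ∀ k, k₀ ≤ k → ∀ x, p k ≤ iterExp L (c k) (c (k + 1) - c k) (g k) x)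
    (K : ℕ) (hK : k₀ ≤ K) (x : ℕ → ℝ) :
    1 - ∏ k ∈ Finset.Ico k₀ K, (1 - p k) ≤
      iterExp L 0 (c K) (fun x => 1 - ∏ k ∈ Finset.Ico k₀ K, (1 - g k x)) x := by
  have hgb : ∀ k, IsBdd (g k) := fun k => IsBdd.of_Icc fun x => ⟨hg0 k x, hg1 k x⟩
  have hPb : ∀ K, IsBdd fun x => ∏ k ∈ Finset.Ico k₀ K, (1 - g k x) := fun K =>
    IsBdd.prod _ fun k _ => (IsBdd.const 1).sub (hgb k)
  induction K, hK using Nat.le_induction with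
  | base => simp [hL.iter_const]
  | succ K hK ih =>
    set P : (ℕ → ℝ) → ℝ := fun x => ∏ k ∈ Finset.Ico k₀ K, (1 - g k x) with hP
    have hP0 : ∀ x, 0 ≤ P x := fun x => Finset.prod_nonneg fun k _ => sub_nonneg.2 (hg1 k x)
    have hPdep : NoDepFrom (c K) P := fun x i y hi => by
      refine Finset.prod_congr rfl fun k hk => ?_
      rw [hdep k x i y ((hc (Finset.mem_Ico.1 hk).2).trans hi)]
    -- In this form the last block enters with the nonnegative coefficient `P`, which depends on the
    -- past only, so a lower bound survives the sub-linear functional.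
    have e1 : (fun x => 1 - ∏ k ∈ Finset.Ico k₀ (K + 1), (1 - g k x)) =
        fun x => P x * g K x + (1 - P x) := by
      funext x; rw [Finset.prod_Ico_succ_top hK]; simp only [hP]; ring
    have e2 : c (K + 1) = c K + (c (K + 1) - c K) := by
      have : c K ≤ c (K + 1) := hc (Nat.le_succ K)
      omega
    have hQb : IsBdd fun x => 1 - P x := (IsBdd.const 1).sub (hPb K)
    have h1 : iterExp L 0 (c K) (fun x => (1 - p K) * (1 - P x) + p K) x ≤
        iterExp L 0 (c (K + 1)) (fun x => P x * g K x + (1 - P x)) x := by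
      rw [e2, iterExp_add, zero_add]
      refine hL.iter_mono ((hQb.const_mul _).add (IsBdd.const _))
        (hL.isBdd_iter (((hPb K).mul (hgb K)).add hQb) _ _) (fun x => ?_) _ _ _
      rw [hL.iter_affine (hgb K) hP0 hPdep (fun x i y hi => by rw [hPdep x i y hi])]
      have := mul_le_mul_of_nonneg_left (hp K hK x) (hP0 x)
      linarith
    rw [e1]
    refine le_trans ?_ h1
    rw [hL.iter_affine hQb (B := fun _ => 1 - p K) (C := fun _ => p K)
      (fun _ => sub_nonneg.2 (hp1 K)) (fun _ _ _ _ => rfl) (fun _ _ _ _ => rfl),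
      Finset.prod_Ico_succ_top hK]
    have := mul_le_mul_of_nonneg_left ih (sub_nonneg.2 (hp1 K))
    linarith

/-- The Hahn–Banach theorem. -/
theorem exists_linear (hf : IsBdd f) :
    ∃ l : (ℝ → ℝ) → ℝ, IsLinExp l ∧ (∀ g, IsBdd g → l g ≤ L g) ∧ l f = L f := by
  classical
  let B : Submodule ℝ (ℝ → ℝ) :=
    { carrier := {g | IsBdd g}
      add_mem' := fun ha hb => ha.add hb
      zero_mem' := IsBdd.const 0
      smul_mem' := fun c g hg => hg.const_mul c }
  let N : B → ℝ := fun g => L g.1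
  have key : ∃ l : B →ₗ[ℝ] ℝ, (∀ g, l g ≤ N g) ∧ l ⟨f, hf⟩ = L f := by
    -- The functional to be extended lives on the line spanned by `f`; for `f = 0` there is no line
    -- and one extends from the zero subspace.
    by_cases h0 : (⟨f, hf⟩ : B) = 0
    · obtain ⟨l, -, hl⟩ := exists_extension_of_le_sublinear (⊥ : B →ₗ.[ℝ] ℝ) N
        (fun c hc g => hL.smul _ g.2 c hc.le) (fun g h => hL.add_le _ _ g.2 h.2)
        (by
          rintro ⟨g, hg⟩
          have hg' : g = 0 := (Submodule.mem_bot ℝ).1 hg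
          subst hg'
          have h1 : (⊥ : B →ₗ.[ℝ] ℝ) ⟨0, hg⟩ = 0 := LinearPMap.map_zero _
          rw [h1]
          exact (hL.const 0).symm.le)
      refine ⟨l, hl, ?_⟩
      have hf0 : f = fun _ => 0 := congrArg Subtype.val h0
      rw [h0, map_zero, hf0, hL.const]
    · obtain ⟨l, hl1, hl⟩ := exists_extension_of_le_sublinear
        (LinearPMap.mkSpanSingleton (K := ℝ) (⟨f, hf⟩ : B) (L f) h0) N
        (fun c hc g => hL.smul _ g.2 c hc.le) (fun g h => hL.add_le _ _ g.2 h.2)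
        (by
          rintro ⟨g, hg⟩
          obtain ⟨c, rfl⟩ := Submodule.mem_span_singleton.1 hg
          erw [LinearPMap.mkSpanSingleton'_apply]
          rcases le_total 0 c with hc | hc
          · exact (hL.smul f hf c hc).symm.le
          -- Domination at negative multiples is where sub-additivity is used: the values at a
          -- function and its negative have a nonnegative sum.
          · have h1 := hL.neg_neg_le (hf.const_mul c)
            have e : (fun x => -(c * f x)) = fun x => (-c) * f x := by funext x; ring
            rw [e, hL.smul f hf (-c) (by linarith)] at h1
            change c * L f ≤ L (fun x => c * f x)
            linarith)
      refine ⟨l, hl, ?_⟩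
      have := hl1 ⟨⟨f, hf⟩, Submodule.mem_span_singleton_self _⟩
      rw [this]
      exact LinearPMap.mkSpanSingleton_apply ℝ ℝ h0 (L f)
  obtain ⟨l, hl, hlf⟩ := key
  let l' : (ℝ → ℝ) → ℝ := fun g => if h : IsBdd g then l ⟨g, h⟩ else 0
  have e : ∀ g (h : IsBdd g), l' g = l ⟨g, h⟩ := fun g h => dif_pos h
  have hle : ∀ g, IsBdd g → l' g ≤ L g := fun g h => (e g h).trans_le (hl _)
  have hadd : ∀ f g, IsBdd f → IsBdd g → l' (fun x => f x + g x) = l' f + l' g := by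
    intro f g hf hg
    rw [e _ hf, e _ hg, e _ (hf.add hg), ← map_add]; rfl
  have hsmul : ∀ g, IsBdd g → ∀ c : ℝ, l' (fun x => c * g x) = c * l' g := by
    intro g hg c
    rw [e _ hg, e _ (hg.const_mul c), ← smul_eq_mul, ← map_smul]; rfl
  have hneg : ∀ g, IsBdd g → l' (fun x => -g x) = -l' g := fun g hg => by
    simpa using hsmul g hg (-1)
  refine ⟨l', ⟨⟨?_, ?_, fun f g hf hg => (hadd f g hf hg).le, fun g hg c _ => hsmul g hg c⟩, hadd⟩,
    hle, by rw [e f hf, hlf]⟩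
  · intro g h hg hh hgh
    -- Positivity of the extension comes from domination: `L` is nonpositive on nonpositive
    -- functions.
    have h1 : l' (fun x => g x + -h x) ≤ 0 :=
      (hle _ (hg.add hh.neg)).trans (hL.le_const (hg.add hh.neg) fun x => by linarith [hgh x])
    rw [hadd _ _ hg hh.neg, hneg h hh] at h1
    linarith
  · intro c
    have h1 := hle (fun _ => c) (IsBdd.const c)
    have h2 := hle (fun _ => -c) (IsBdd.const (-c))
    rw [hneg (fun _ => c) (IsBdd.const c), hL.const] at h2
    rw [hL.const] at h1
    linarith

end IsUpperExp

/-! ### Linear functionals and change of measure. -/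

namespace IsLinExp
variable {l : (ℝ → ℝ) → ℝ} (hl : IsLinExp l) {f g w : ℝ → ℝ}
include hl

theorem neg_eq (hf : IsBdd f) : l (fun x => -f x) = -l f := by
  have h := hl.add_eq f (fun x => -f x) hf hf.neg
  simp only [add_neg_cancel, hl.const] at h
  linarith

theorem sub_eq (hf : IsBdd f) (hg : IsBdd g) : l (fun x => f x - g x) = l f - l g := by
  simp only [sub_eq_add_neg]
  rw [hl.add_eq f _ hf hg.neg, hl.neg_eq hg]

theorem mul_eq (hf : IsBdd f) (c : ℝ) : l (fun x => c * f x) = c * l f := by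
  rcases le_total 0 c with hc | hc
  · exact hl.smul f hf c hc
  · have h := hl.smul f hf (-c) (by linarith)
    have e : (fun x => -c * f x) = fun x => -(c * f x) := by funext x; ring
    rw [e, hl.neg_eq (hf.const_mul c)] at h
    linarith

/-- A change of measure with a density is again a linear functional. -/
theorem tilt (hw : IsBdd w) (hw0 : ∀ x, 0 ≤ w x) (hw1 : l w = 1) :
    IsLinExp fun φ => l fun x => w x * φ x where
  mono f g hf hg h := hl.mono _ _ (hw.mul hf) (hw.mul hg) fun x =>
    mul_le_mul_of_nonneg_left (h x) (hw0 x)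
  const c := by
    have : (fun x => w x * c) = fun x => c * w x := by funext x; ring
    rw [this, hl.mul_eq hw, hw1, mul_one]
  add_eq f g hf hg := by
    simp only [mul_add]
    exact hl.add_eq _ _ (hw.mul hf) (hw.mul hg)
  add_le f g hf hg := by
    simp only [mul_add]
    exact hl.add_le _ _ (hw.mul hf) (hw.mul hg)
  smul f hf c _ := by
    have : (fun x => w x * (c * f x)) = fun x => c * (w x * f x) := by funext x; ring
    rw [this, hl.mul_eq (hw.mul hf)]

/-- The likelihood ratio of a block is a product, so its last factor can be absorbed by the
functional acting in the last coordinate while the others stay frozen. -/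
theorem iter_mul_prod (hw : IsBdd w) (hw0 : ∀ x, 0 ≤ w x) (hw1 : l w = 1) {Φ : (ℕ → ℝ) → ℝ}
    (hΦ : IsBdd Φ) (a n : ℕ) (x : ℕ → ℝ) :
    iterExp l a n (fun x => (∏ i ∈ Finset.range n, w (x (a + i))) * Φ x) x =
      iterExp (fun φ => l fun x => w x * φ x) a n Φ x := by
  induction n generalizing Φ with
  | zero => simp [iterExp]
  | succ n ih =>
    have hQ := hl.tilt hw hw0 hw1
    rw [iterExp, iterExp, ← ih (hQ.isBdd_step hΦ _)]
    congr 1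
    funext x
    simp only [stepExp, Finset.prod_range_succ, Function.update_self]
    have e : ∀ y, ∏ i ∈ Finset.range n, w (Function.update x (a + n) y (a + i)) =
        ∏ i ∈ Finset.range n, w (x (a + i)) := fun y => Finset.prod_congr rfl fun i hi => by
      rw [Function.update_of_ne (by have := Finset.mem_range.1 hi; omega)]
    simp only [e, mul_assoc]
    exact hl.mul_eq (hw.mul (hΦ.comp _)) _

/-- Lower bound of a probability by a change of measure. -/
theorem iter_tilt_ge (hw : IsBdd w) (hw0 : ∀ x, 0 < w x) (hw1 : l w = 1) (A : Set (ℕ → ℝ))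
    (κ : ℝ) (a n : ℕ) (x : ℕ → ℝ) :
    Real.exp (-κ) * (1 - iterExp (fun φ => l fun x => w x * φ x) a n (ind Aᶜ) x
      - iterExp (fun φ => l fun x => w x * φ x) a n
        (ind {x | κ ≤ coordSum (fun y => Real.log (w y)) a n x}) x) ≤ iterExp l a n (ind A) x := by
  have hQ := hl.tilt hw (fun x => (hw0 x).le) hw1
  set Q : (ℝ → ℝ) → ℝ := fun φ => l fun x => w x * φ x
  set B : Set (ℕ → ℝ) := {x | κ ≤ coordSum (fun y => Real.log (w y)) a n x} with hB
  -- `Ψ` is one on `A \ B`, where the likelihood ratio is below `exp κ`, and nonpositive elsewhere.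
  -- So the likelihood ratio times `exp (-κ) Ψ` stays below the indicator of `A`.
  set Ψ : (ℕ → ℝ) → ℝ := fun x => 1 - ind Aᶜ x - ind B x
  have hΨ : IsBdd Ψ := ((IsBdd.const 1).sub (isBdd_ind _)).sub (isBdd_ind _)
  have hW : IsBdd fun x : ℕ → ℝ => ∏ i ∈ Finset.range n, w (x (a + i)) :=
    IsBdd.prod _ fun i _ => hw.comp fun x : ℕ → ℝ => x (a + i)
  have h1 : 1 ≤ iterExp Q a n Ψ x + (iterExp Q a n (ind Aᶜ) x + iterExp Q a n (ind B) x) := by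
    have e1 := hQ.iter_add_le hΨ ((isBdd_ind Aᶜ).add (isBdd_ind B)) a n x
    have e2 := hQ.iter_add_le (isBdd_ind Aᶜ) (isBdd_ind B) a n x
    have e3 : (fun x => Ψ x + (ind Aᶜ x + ind B x)) = fun _ => 1 := by
      funext x; simp only [Ψ]; ring
    rw [e3, hQ.iter_const] at e1
    linarith
  have h2 : Real.exp (-κ) * iterExp Q a n Ψ x ≤ iterExp l a n (ind A) x := by
    rw [← hQ.iter_const_mul hΨ (Real.exp_pos _).le,
      ← hl.iter_mul_prod hw (fun x => (hw0 x).le) hw1 (hΨ.const_mul _)]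
    refine hl.iter_mono (hW.mul (hΨ.const_mul _)) (isBdd_ind _) (fun x => ?_) a n x
    have hW0 : 0 ≤ ∏ i ∈ Finset.range n, w (x (a + i)) :=
      Finset.prod_nonneg fun i _ => (hw0 _).le
    by_cases hA : x ∈ A
    · by_cases hxB : x ∈ B
      · have : Ψ x = 0 := by
          simp only [Ψ]; rw [ind_of_mem hxB, ind_of_notMem (by simpa using hA)]; ring
        rw [this, mul_zero, mul_zero]; exact ind_nonneg _ _
      · have : Ψ x = 1 := by
          simp only [Ψ]; rw [ind_of_notMem hxB, ind_of_notMem (by simpa using hA)]; ring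
        rw [this, mul_one, ind_of_mem hA]
        have e : ∏ i ∈ Finset.range n, w (x (a + i)) =
            Real.exp (coordSum (fun y => Real.log (w y)) a n x) := by
          rw [coordSum, Real.exp_sum]
          exact Finset.prod_congr rfl fun i _ => (Real.exp_log (hw0 _)).symm
        rw [e, ← Real.exp_add]
        have : ¬ κ ≤ coordSum (fun y => Real.log (w y)) a n x := hxB
        exact Real.exp_le_one_iff.2 (by linarith)
    · have : Ψ x ≤ 0 := by
        simp only [Ψ]; rw [ind_of_mem (show x ∈ Aᶜ from hA)]; linarith [ind_nonneg B x]
      refine le_trans ?_ (ind_nonneg _ _)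
      exact mul_nonpos_of_nonneg_of_nonpos hW0
        (mul_nonpos_of_nonneg_of_nonpos (Real.exp_pos _).le this)
  refine le_trans ?_ h2
  exact mul_le_mul_of_nonneg_left (by linarith) (Real.exp_pos _).le

/-- Chebyshev's inequality for centered sums under a linear functional. -/
theorem iter_cheb_centered (hf : IsBdd f) {v t : ℝ} (hv : l (fun y => f y ^ 2) ≤ v) (ht : 0 < t)
    (a n : ℕ) (x : ℕ → ℝ) :
    iterExp l a n (ind {x | t ≤ |coordSum f a n x - n * l f|}) x ≤ 3 * (n * v) / t ^ 2 := by
  set c := l f with hc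
  have hfc : IsBdd fun y => f y - c := hf.sub (IsBdd.const c)
  have h0 : l (fun y => f y - c) = 0 := by
    rw [hl.sub_eq hf (IsBdd.const c), hl.const, ← hc, sub_self]
  have h1 : l (fun y => (f y - c) ^ 2) ≤ v := by
    have e : (fun y => (f y - c) ^ 2) = fun y => f y ^ 2 + ((-2 * c) * f y + c ^ 2) := by
      funext y; ring
    rw [e, hl.add_eq _ _ (hf.pow 2) ((hf.const_mul _).add (IsBdd.const _)),
      hl.add_const (hf.const_mul _), hl.mul_eq hf, ← hc]
    nlinarith [sq_nonneg c]
  have h2 := hl.iter_cheb hfc h1 h0.le (by rw [hl.neg_eq hfc, h0, neg_zero]) ht a n x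
  have e : ∀ x, coordSum (fun y => f y - c) a n x = coordSum f a n x - n * c := fun x => by
    simp [coordSum, Finset.sum_sub_distrib]
  simp only [e] at h2
  simpa using h2

end IsLinExp

/-! ### Bounded Lipschitz functions of the random variables -/

section BddLip
variable {E F : Type*} [NormedAddCommGroup E] [NormedAddCommGroup F] {φ ψ : E → ℝ}

theorem isBddLip_of_abs_le {C : ℝ} {K : NNReal} (h : ∀ x, |φ x| ≤ C)
    (hK : ∀ x y, |φ x - φ y| ≤ K * ‖x - y‖) : IsBddLip φ :=
  ⟨⟨C, h⟩, K, LipschitzWith.of_dist_le_mul fun x y => by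
    rw [Real.dist_eq, dist_eq_norm]; exact hK x y⟩

theorem IsBddLip.exists_lip (h : IsBddLip φ) :
    ∃ K : NNReal, ∀ x y, |φ x - φ y| ≤ K * ‖x - y‖ := by
  obtain ⟨-, K, hK⟩ := h
  exact ⟨K, fun x y => by simpa [Real.dist_eq, dist_eq_norm] using hK.dist_le_mul x y⟩

theorem IsBddLip.isLocLip (h : IsBddLip φ) : IsLocLip φ := by
  obtain ⟨K, hK⟩ := h.exists_lip
  refine ⟨K + 1, by positivity, 0, fun x y => (hK x y).trans ?_⟩
  refine mul_le_mul_of_nonneg_right ?_ (norm_nonneg _)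
  simp only [pow_zero]
  nlinarith [K.2]

theorem IsBddLip.const (c : ℝ) : IsBddLip (fun _ : E => c) :=
  ⟨IsBdd.const c, 0, LipschitzWith.const c⟩

theorem IsBddLip.add (h : IsBddLip φ) (h' : IsBddLip ψ) : IsBddLip fun x => φ x + ψ x := by
  obtain ⟨hb, K, hK⟩ := h
  obtain ⟨hb', K', hK'⟩ := h'
  exact ⟨IsBdd.add hb hb', _, hK.add hK'⟩

theorem IsBddLip.const_mul (h : IsBddLip φ) (c : ℝ) : IsBddLip fun x => c * φ x := by
  obtain ⟨C, hC⟩ := h.1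
  obtain ⟨K, hK⟩ := h.exists_lip
  obtain ⟨D, hD⟩ := IsBdd.const_mul ⟨C, hC⟩ c
  refine isBddLip_of_abs_le (K := Real.toNNReal |c| * K) hD fun x y => ?_
  rw [← mul_sub, abs_mul, NNReal.coe_mul, Real.coe_toNNReal _ (abs_nonneg c), mul_assoc]
  exact mul_le_mul_of_nonneg_left (hK x y) (abs_nonneg c)

theorem IsBddLip.abs (h : IsBddLip φ) : IsBddLip fun x => |φ x| := by
  obtain ⟨C, hC⟩ := h.1
  obtain ⟨K, hK⟩ := h.exists_lip
  exact isBddLip_of_abs_le (K := K) (C := C) (fun x => by simpa using hC x) fun x y =>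
    (abs_abs_sub_abs_le_abs_sub _ _).trans (hK x y)

theorem IsBddLip.comp (h : IsBddLip φ) {u : F → E} (hu : LipschitzWith 1 u) :
    IsBddLip fun x => φ (u x) := by
  obtain ⟨⟨C, hC⟩, K, hK⟩ := h
  exact ⟨⟨C, fun x => hC _⟩, _, hK.comp hu⟩

end BddLip

theorem lipschitz_snoc (n : ℕ) : LipschitzWith 1
    fun p : (Fin n → ℝ) × (Fin 1 → ℝ) => (Fin.snoc p.1 (p.2 0) : Fin (n + 1) → ℝ) := by
  refine LipschitzWith.of_dist_le_mul fun p q => ?_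
  rw [NNReal.coe_one, one_mul, dist_pi_le_iff dist_nonneg]
  intro i
  refine Fin.lastCases ?_ (fun j => ?_) i
  · simp only [Fin.snoc_last]
    exact (dist_le_pi_dist p.2 q.2 0).trans (le_max_right _ _)
  · simp only [Fin.snoc_castSucc]
    exact (dist_le_pi_dist p.1 q.1 j).trans (le_max_left _ _)

theorem isBdd_comp {α : Type*} {X : α → ℝ} {φ : ℝ → ℝ} (hφ : IsBddLip φ) :
    IsBdd fun ω => φ (X ω) :=
  IsBdd.comp hφ.1 X

/-! ### The law of one variable and the iterated form of independence. -/

namespace SubLinearExpectationSpace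
variable {Ω : Type*} [MeasurableSpace Ω] (S : SubLinearExpectationSpace Ω)

theorem const_mem (c : ℝ) : (fun _ => c) ∈ S.H :=
  S.comp_mem 0 (fun i => i.elim0) (fun i => i.elim0) (fun _ => c) (IsBddLip.const c).isLocLip

theorem bddLip_mem {n : ℕ} {X : Fin n → Ω → ℝ} (hX : ∀ i, X i ∈ S.H) {φ : (Fin n → ℝ) → ℝ}
    (hφ : IsBddLip φ) : (fun ω => φ fun i => X i ω) ∈ S.H :=
  S.comp_mem n X hX φ hφ.isLocLip

theorem bddLip_mem_one {X : Ω → ℝ} (hX : X ∈ S.H) {φ : ℝ → ℝ} (hφ : IsBddLip φ) :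
    (fun ω => φ (X ω)) ∈ S.H :=
  S.bddLip_mem (X := fun _ : Fin 1 => X) (fun _ => hX) (φ := fun x => φ (x 0))
    (hφ.comp (LipschitzWith.eval 0))

variable {Z Z' : Ω → ℝ}

theorem le_of_le_const (hZ : Z ∈ S.H) {c : ℝ} (h : ∀ ω, Z ω ≤ c) : S.E Z ≤ c :=
  (S.mono _ (S.const_mem c) _ hZ h).trans_eq (S.const c)

theorem const_le_of_le (hZ : Z ∈ S.H) {c : ℝ} (h : ∀ ω, c ≤ Z ω) : (c : EReal) ≤ S.E Z :=
  (S.const c).symm.le.trans (S.mono _ hZ _ (S.const_mem c) h)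

theorem coe_toReal (hZ : Z ∈ S.H) (hb : IsBdd Z) : ((S.E Z).toReal : EReal) = S.E Z := by
  obtain ⟨C, hC⟩ := hb
  have h1 := S.le_of_le_const hZ fun ω => (le_abs_self _).trans (hC ω)
  have h2 := S.const_le_of_le hZ fun ω => (abs_le.1 (hC ω)).1
  exact EReal.coe_toReal (ne_top_of_le_ne_top (EReal.coe_ne_top _) h1)
    (ne_bot_of_le_ne_bot (EReal.coe_ne_bot _) h2)

theorem toReal_mono (hZ : Z ∈ S.H) (hb : IsBdd Z) (hZ' : Z' ∈ S.H) (hb' : IsBdd Z')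
    (h : ∀ ω, Z ω ≤ Z' ω) : (S.E Z).toReal ≤ (S.E Z').toReal := by
  rw [← EReal.coe_le_coe_iff, S.coe_toReal hZ hb, S.coe_toReal hZ' hb']
  exact S.mono _ hZ' _ hZ h

theorem toReal_add_le (hZ : Z ∈ S.H) (hb : IsBdd Z) (hZ' : Z' ∈ S.H) (hb' : IsBdd Z') :
    (S.E fun ω => Z ω + Z' ω).toReal ≤ (S.E Z).toReal + (S.E Z').toReal := by
  have hmem : (fun ω => Z ω + Z' ω) ∈ S.H := S.H.add_mem hZ hZ'
  rw [← EReal.coe_le_coe_iff, EReal.coe_add, S.coe_toReal hmem (hb.add hb'),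
    S.coe_toReal hZ hb, S.coe_toReal hZ' hb']
  refine S.add_le _ hZ _ hZ' (fun h => ?_) (fun h => ?_)
  · have := S.coe_toReal hZ hb
    rw [h.1] at this
    exact EReal.coe_ne_top _ this
  · have := S.coe_toReal hZ hb
    rw [h.1] at this
    exact EReal.coe_ne_bot _ this

theorem toReal_const (c : ℝ) : (S.E fun _ => c).toReal = c := by
  rw [S.const c, EReal.toReal_coe]

theorem abs_toReal_le (hZ : Z ∈ S.H) {C : ℝ} (hC : ∀ ω, |Z ω| ≤ C) : |(S.E Z).toReal| ≤ C := by
  have h1 := S.toReal_mono hZ ⟨C, hC⟩ (S.const_mem C) (IsBdd.const C)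
    fun ω => (abs_le.1 (hC ω)).2
  have h2 := S.toReal_mono (S.const_mem (-C)) (IsBdd.const _) hZ ⟨C, hC⟩
    fun ω => (abs_le.1 (hC ω)).1
  rw [S.toReal_const] at h1 h2
  exact abs_le.2 ⟨h2, h1⟩

theorem toReal_sub_le (hZ : Z ∈ S.H) (hb : IsBdd Z) (hZ' : Z' ∈ S.H) (hb' : IsBdd Z') {d : ℝ}
    (h : ∀ ω, Z ω - Z' ω ≤ d) : (S.E Z).toReal - (S.E Z').toReal ≤ d := by
  have h1 := S.toReal_add_le hZ' hb' (S.const_mem d) (IsBdd.const d)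
  rw [S.toReal_const] at h1
  have h2 := S.toReal_mono hZ hb (S.H.add_mem hZ' (S.const_mem d)) (hb'.add (IsBdd.const d))
    fun ω => by have := h ω; simp only [Pi.add_apply]; linarith
  have h3 : (Z' + fun _ => d) = fun ω => Z' ω + d := rfl
  rw [h3] at h2
  linarith

/-- Freezing one group of variables in a bounded Lipschitz function. -/
theorem isBddLip_freeze {m n : ℕ} {Y : Fin n → Ω → ℝ} (hY : ∀ i, Y i ∈ S.H)
    {φ : (Fin m → ℝ) × (Fin n → ℝ) → ℝ} (hφ : IsBddLip φ) :
    IsBddLip fun x : Fin m → ℝ => (S.E fun ω => φ (x, fun j => Y j ω)).toReal := by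
  obtain ⟨C, hC⟩ := hφ.1
  obtain ⟨K, hK⟩ := hφ.exists_lip
  have hmem : ∀ x : Fin m → ℝ, (fun ω => φ (x, fun j => Y j ω)) ∈ S.H := fun x =>
    S.bddLip_mem hY (φ := fun y => φ (x, y)) (hφ.comp (LipschitzWith.prodMk_left x))
  have hb : ∀ x : Fin m → ℝ, IsBdd fun ω => φ (x, fun j => Y j ω) := fun x => ⟨C, fun _ => hC _⟩
  have hd : ∀ (x x' : Fin m → ℝ) (y : Fin n → ℝ), |φ (x, y) - φ (x', y)| ≤ K * ‖x - x'‖ := by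
    intro x x' y
    refine (hK _ _).trans_eq ?_
    rw [Prod.mk_sub_mk, sub_self, Prod.norm_mk, norm_zero, max_eq_left (norm_nonneg _)]
  refine isBddLip_of_abs_le (K := K) (fun x => S.abs_toReal_le (hmem x) fun ω => hC _)
    fun x x' => ?_
  rw [abs_sub_le_iff]
  refine ⟨S.toReal_sub_le (hmem x) (hb x) (hmem x') (hb x') fun ω =>
    (le_abs_self _).trans (hd _ _ _), ?_⟩
  exact S.toReal_sub_le (hmem x') (hb x') (hmem x) (hb x) fun ω => by
    rw [norm_sub_rev]; exact (le_abs_self _).trans (hd _ _ _)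

/-- For bounded Lipschitz functions the frozen expectations are again bounded Lipschitz, so every
side condition in the definition of independence holds. -/
theorem IndepTo.eq_of_bddLip {m n : ℕ} {Y : Fin n → Ω → ℝ} {X : Fin m → Ω → ℝ}
    (h : S.IndepTo Y X) (hY : ∀ i, Y i ∈ S.H) (hX : ∀ i, X i ∈ S.H)
    {φ : (Fin m → ℝ) × (Fin n → ℝ) → ℝ} (hφ : IsBddLip φ) :
    S.E (fun ω => φ (fun i => X i ω, fun j => Y j ω)) =
      S.E (fun ω => (S.E (fun ω' => φ (fun i => X i ω, fun j => Y j ω'))).toReal) := by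
  have h1 := S.isBddLip_freeze (m := m) hY hφ.abs
  have h2 := S.isBddLip_freeze (m := m) hY hφ
  obtain ⟨C, hC⟩ := hφ.1
  obtain ⟨D, hD⟩ := h1.1
  refine h φ hφ.isLocLip (fun x => ?_) (S.bddLip_mem hX h1) (S.bddLip_mem hX h2) ?_
  · exact (S.le_of_le_const (S.bddLip_mem hY (φ := fun y => |φ (x, y)|)
      (hφ.abs.comp (LipschitzWith.prodMk_left x))) fun ω => hC _).trans_lt (EReal.coe_lt_top C)
  · exact (S.le_of_le_const (S.bddLip_mem hX h1) fun ω =>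
      (le_abs_self _).trans (hD fun i => X i ω)).trans_lt (EReal.coe_lt_top D)

/-- The upper extension of the distribution of `X` to all bounded functions. -/
noncomputable def upperLaw (X : Ω → ℝ) (f : ℝ → ℝ) : ℝ :=
  sInf {r | ∃ ψ, IsBddLip ψ ∧ (∀ x, f x ≤ ψ x) ∧ r = (S.E fun ω => ψ (X ω)).toReal}

section upperLaw
variable {X : Ω → ℝ} (hX : X ∈ S.H)
include hX

theorem upperLaw_le {f ψ : ℝ → ℝ} (hf : IsBdd f) (hψ : IsBddLip ψ) (h : ∀ x, f x ≤ ψ x) :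
    S.upperLaw X f ≤ (S.E fun ω => ψ (X ω)).toReal := by
  obtain ⟨C, hC⟩ := hf
  refine csInf_le ⟨-C, ?_⟩ ⟨ψ, hψ, h, rfl⟩
  rintro r ⟨ψ', hψ', h', rfl⟩
  rw [← S.toReal_const (-C)]
  exact S.toReal_mono (S.const_mem _) (IsBdd.const _) (S.bddLip_mem_one hX hψ') (isBdd_comp hψ')
    fun ω => (abs_le.1 (hC _)).1.trans (h' _)

omit hX in
theorem le_upperLaw {f : ℝ → ℝ} (hf : IsBdd f) {c : ℝ} (h : ∀ ψ, IsBddLip ψ → (∀ x, f x ≤ ψ x) →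
    c ≤ (S.E fun ω => ψ (X ω)).toReal) : c ≤ S.upperLaw X f := by
  obtain ⟨C, hC⟩ := hf
  refine le_csInf ⟨_, fun _ => C, IsBddLip.const C, fun x => (le_abs_self _).trans (hC x), rfl⟩ ?_
  rintro r ⟨ψ', hψ', h', rfl⟩
  exact h ψ' hψ' h'

theorem upperLaw_eq {φ : ℝ → ℝ} (hφ : IsBddLip φ) :
    S.upperLaw X φ = (S.E fun ω => φ (X ω)).toReal :=
  le_antisymm (S.upperLaw_le hX hφ.1 hφ fun _ => le_rfl)
    (S.le_upperLaw hφ.1 fun _ hψ h => S.toReal_mono (S.bddLip_mem_one hX hφ) (isBdd_comp hφ)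
      (S.bddLip_mem_one hX hψ) (isBdd_comp hψ) fun _ => h _)

theorem coe_upperLaw {φ : ℝ → ℝ} (hφ : IsBddLip φ) :
    (S.upperLaw X φ : EReal) = S.E fun ω => φ (X ω) := by
  rw [S.upperLaw_eq hX hφ, S.coe_toReal (S.bddLip_mem_one hX hφ) (isBdd_comp hφ)]

theorem isUpperExp_upperLaw : IsUpperExp (S.upperLaw X) where
  mono f g hf hg h := S.le_upperLaw hg fun ψ hψ hgψ =>
    S.upperLaw_le hX hf hψ fun x => (h x).trans (hgψ x)
  const c := by rw [S.upperLaw_eq hX (IsBddLip.const c), S.toReal_const]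
  add_le f g hf hg := by
    rw [← sub_le_iff_le_add]
    refine S.le_upperLaw hf fun ψ hψ hfψ => ?_
    rw [sub_le_comm]
    refine S.le_upperLaw hg fun ψ' hψ' hgψ => ?_
    have h1 := S.upperLaw_le hX (hf.add hg) (hψ.add hψ') fun x => add_le_add (hfψ x) (hgψ x)
    have h2 := S.toReal_add_le (S.bddLip_mem_one hX hψ) (isBdd_comp hψ)
      (S.bddLip_mem_one hX hψ') (isBdd_comp hψ')
    linarith
  smul f hf c hc := by
    have key : ∀ ψ, IsBddLip ψ → ∀ c : ℝ, 0 ≤ c →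
        (S.E fun ω => c * ψ (X ω)).toReal = c * (S.E fun ω => ψ (X ω)).toReal := by
      intro ψ hψ c hc
      rw [S.smul_eq _ (S.bddLip_mem_one hX hψ) c hc, EReal.toReal_mul, EReal.toReal_coe]
    rcases hc.eq_or_lt with rfl | hc'
    · simp only [zero_mul]
      rw [S.upperLaw_eq hX (IsBddLip.const 0), S.toReal_const]
    have hle : ∀ f, IsBdd f → ∀ c : ℝ, 0 < c →
        S.upperLaw X (fun x => c * f x) ≤ c * S.upperLaw X f := by
      intro f hf c hc
      rw [← div_le_iff₀' hc]
      refine S.le_upperLaw hf fun ψ hψ hfψ => ?_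
      rw [div_le_iff₀' hc, ← key ψ hψ c hc.le]
      exact S.upperLaw_le hX (hf.const_mul c) (hψ.const_mul c) fun x =>
        mul_le_mul_of_nonneg_left (hfψ x) hc.le
    refine le_antisymm (hle f hf c hc') ?_
    -- The reverse inequality is the same one after scaling back.
    have h1 := hle _ (hf.const_mul c) c⁻¹ (inv_pos.2 hc')
    have e : (fun x => c⁻¹ * (c * f x)) = f := by
      funext x; rw [inv_mul_cancel_left₀ hc'.ne']
    rw [e, inv_mul_eq_div, le_div_iff₀ hc'] at h1
    linarith

end upperLaw

/-- The sub-linear expectation of a bounded Lipschitz function of independent identically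
distributed variables is an iterated functional. -/
theorem IID.eq_iterExp {Y : ℕ → Ω → ℝ} (hY : S.IID Y) (n : ℕ) {g : (Fin n → ℝ) → ℝ}
    (hg : IsBddLip g) (x : ℕ → ℝ) : S.E (fun ω => g fun i => Y i ω) =
      ((iterExp (S.upperLaw (Y 0)) 0 n (fun z => g fun i : Fin n => z i) x : ℝ) : EReal) := by
  induction n with
  | zero =>
    have e : (fun ω => g fun i : Fin 0 => Y i ω) = fun _ => g fun i : Fin 0 => x i := by
      funext ω; congr 1; funext i; exact i.elim0
    rw [e, S.const]
    rfl
  | succ n ih =>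
    let φ : (Fin n → ℝ) × (Fin 1 → ℝ) → ℝ := fun p => g (Fin.snoc p.1 (p.2 0))
    have hφ : IsBddLip φ := hg.comp (lipschitz_snoc n)
    let ψ : (Fin n → ℝ) → ℝ := fun u => (S.E fun ω => φ (u, fun _ => Y n ω)).toReal
    have hψ : IsBddLip ψ := S.isBddLip_freeze (Y := fun _ : Fin 1 => Y n) (fun _ => hY.mem n) hφ
    have e1 : (fun ω => g fun i : Fin (n + 1) => Y i ω) =
        fun ω => φ (fun i : Fin n => Y i ω, fun _ => Y n ω) := by
      funext ω
      simp only [φ]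
      congr 1
      funext i
      refine Fin.lastCases ?_ (fun j => ?_) i <;> simp
    have h1 : S.E (fun ω => g fun i : Fin (n + 1) => Y i ω) =
        S.E (fun ω => ψ fun i : Fin n => Y i ω) := by
      rw [e1]
      rcases Nat.eq_zero_or_pos n with rfl | hn
      -- Independence is assumed from the second variable on; for the first one the past is the
      -- empty vector and the frozen function is a constant.
      · have e2 : ∀ u v : Fin 0 → ℝ, u = v := fun u v => Subsingleton.elim _ _
        have e3 : (fun ω => ψ fun i : Fin 0 => Y i ω) = fun _ => ψ 0 := by
          funext ω; exact congrArg ψ (e2 _ _)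
        have e4 : (fun ω => φ (fun i : Fin 0 => Y i ω, fun _ => Y 0 ω)) =
          fun ω => φ (0, fun _ => Y 0 ω) := by
          funext ω; rw [e2 (fun i : Fin 0 => Y i ω) 0]
        rw [e3, S.const, e4]
        refine (S.coe_toReal ?_ ?_).symm
        · exact S.bddLip_mem (X := fun _ : Fin 1 => Y 0) (fun _ => hY.mem 0)
            (φ := fun y => φ (0, y)) (hφ.comp (LipschitzWith.prodMk_left _))
        · obtain ⟨C, hC⟩ := hφ.1
          exact ⟨C, fun ω => hC _⟩
      · exact (hY.indep n hn).eq_of_bddLip S (fun _ => hY.mem n) (fun k => hY.mem k) hφ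
    have h2 : stepExp (S.upperLaw (Y 0)) (0 + n) (fun z => g fun i : Fin (n + 1) => z i) =
        fun z => ψ fun i : Fin n => z i := by
      funext z
      have hb : IsBddLip fun y : ℝ => φ (fun i : Fin n => z i, fun _ => y) := by
        refine hφ.comp (LipschitzWith.of_dist_le_mul fun y y' => ?_)
        rw [Prod.dist_eq, dist_self, NNReal.coe_one, one_mul]
        exact max_le dist_nonneg (by rw [dist_pi_le_iff dist_nonneg]; exact fun _ => le_rfl)
      have e3 : (fun y => g fun i : Fin (n + 1) => Function.update z (0 + n) y i) =
          fun y => φ (fun i : Fin n => z i, fun _ => y) := by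
        funext y
        simp only [φ, zero_add]
        congr 1
        funext i
        refine Fin.lastCases ?_ (fun j => ?_) i
        · simp
        · have : (j : ℕ) ≠ n := j.2.ne
          simp [Function.update_of_ne this]
      simp only [stepExp]
      -- Identical distribution enters here: the law of `Y n` in the last coordinate is replaced by
      -- that of `Y 0`.
      rw [e3, S.upperLaw_eq (hY.mem 0) hb, ← hY.ident n _ hb]
    rw [h1, ih hψ, iterExp, h2]

/-! ### Comparison of the capacities with the iterated functional -/

/-- A bounded Lipschitz function between the indicators of a set and of a neighbourhood of it. -/
theorem exists_bddLip_between {N : ℕ} {A B : Set (ℕ → ℝ)} {δ : ℝ} (hδ : 0 < δ)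
    (h : ∀ x ∈ A, ∀ z : ℕ → ℝ, (∀ i < N, |x i - z i| < δ) → z ∈ B) :
    ∃ g : (Fin N → ℝ) → ℝ, IsBddLip g ∧ (∀ z : ℕ → ℝ, ind A z ≤ g fun i => z i) ∧
      ∀ z : ℕ → ℝ, (g fun i => z i) ≤ ind B z := by
  -- The distance to the empty set is zero by convention, so the tent function below would be one
  -- instead of zero.
  rcases A.eq_empty_or_nonempty with rfl | hA
  · refine ⟨fun _ => 0, IsBddLip.const 0, fun z => ?_, fun z => ind_nonneg _ _⟩
    exact ind_le le_rfl fun h => h.elim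
  let A' : Set (Fin N → ℝ) := (fun x i => x i) '' A
  have hA' : A'.Nonempty := hA.image _
  let g : (Fin N → ℝ) → ℝ := fun u => max 0 (1 - Metric.infDist u A' / δ)
  have hg1 : ∀ u, g u ≤ 1 := fun u => max_le zero_le_one
    (by have := div_nonneg (Metric.infDist_nonneg (x := u) (s := A')) hδ.le; linarith)
  refine ⟨g, ?_, fun z => ind_le (le_max_left _ _) fun hz => ?_, fun z => ?_⟩
  · refine isBddLip_of_abs_le (C := 1) (K := Real.toNNReal δ⁻¹)
      (fun u => by rw [abs_of_nonneg (le_max_left _ _)]; exact hg1 u) fun u v => ?_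
    rw [Real.coe_toNNReal _ (inv_nonneg.2 hδ.le)]
    have h1 : |g u - g v| ≤ |(1 - Metric.infDist u A' / δ) - (1 - Metric.infDist v A' / δ)| := by
      simpa using abs_max_sub_max_le_max 0 (1 - Metric.infDist u A' / δ) 0
        (1 - Metric.infDist v A' / δ)
    refine h1.trans ?_
    have h2 : (1 - Metric.infDist u A' / δ) - (1 - Metric.infDist v A' / δ) =
        δ⁻¹ * (Metric.infDist v A' - Metric.infDist u A') := by ring
    rw [h2, abs_mul, abs_of_pos (inv_pos.2 hδ)]
    refine mul_le_mul_of_nonneg_left ?_ (inv_nonneg.2 hδ.le)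
    have h3 := (Metric.lipschitz_infDist_pt A').dist_le_mul u v
    rw [Real.dist_eq, dist_eq_norm, NNReal.coe_one, one_mul, abs_sub_comm] at h3
    exact h3
  · have : Metric.infDist (fun i : Fin N => z i) A' = 0 :=
      Metric.infDist_zero_of_mem ⟨z, hz, rfl⟩
    simp [g, this]
  · by_cases hz : z ∈ B
    · rw [ind_of_mem hz]; exact hg1 _
    · rw [ind_of_notMem hz]
      refine max_le le_rfl ?_
      have : δ ≤ Metric.infDist (fun i : Fin N => z i) A' := by
        refine (Metric.le_infDist hA').2 ?_
        rintro _ ⟨x, hx, rfl⟩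
        by_contra hlt
        push Not at hlt
        refine hz (h x hx z fun i hi => ?_)
        rw [abs_sub_comm]
        exact (dist_le_pi_dist (fun i : Fin N => z i) (fun i : Fin N => x i) ⟨i, hi⟩).trans_lt hlt
      have := (one_le_div hδ).2 this
      linarith

section capacity
variable {V : Set Ω → ℝ≥0∞} {Y : ℕ → Ω → ℝ} (hY : S.IID Y)
  {N : ℕ} {A B : Set (ℕ → ℝ)} {δ : ℝ} (hδ : 0 < δ)
  (h : ∀ x ∈ A, ∀ z : ℕ → ℝ, (∀ i < N, |x i - z i| < δ) → z ∈ B)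
include hY hδ h

/-- The capacity is tied to the expectation only through elements of `H`. The margin `δ` leaves room
for a Lipschitz function of the first `N` coordinates, whose expectation is exactly an iterate of
`L`. -/
theorem iterExp_le_capacity (hV : S.IsUpperCapacity V) (hB : MeasurableSet {ω | (fun i => Y i ω) ∈ B})
    (x : ℕ → ℝ) :
    ENNReal.ofReal (iterExp (S.upperLaw (Y 0)) 0 N (ind A) x) ≤ V {ω | (fun i => Y i ω) ∈ B} := by
  obtain ⟨g, hg, hgA, hgB⟩ := exists_bddLip_between hδ h
  have hU := S.isUpperExp_upperLaw (hY.mem 0)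
  have h1 := hV.le_of_le_indicator _ hB _ (S.bddLip_mem (X := fun i : Fin N => Y i)
    (fun i => hY.mem i) hg) fun ω => hgB fun i => Y i ω
  rw [IID.eq_iterExp S hY N hg x] at h1
  have h2 := hU.iter_mono (isBdd_ind A) (IsBdd.comp hg.1 _) hgA 0 N x
  have h3 := (EReal.coe_le_coe_iff.2 h2).trans h1
  rw [← EReal.coe_ennreal_le_coe_ennreal_iff, EReal.coe_ennreal_ofReal,
    max_eq_left (hU.iter_nonneg (isBdd_ind A) (ind_nonneg A) 0 N x)]
  exact h3

theorem capacity_le_iterExp (hV : S.IsUpperCapacity V) (hA : MeasurableSet {ω | (fun i => Y i ω) ∈ A})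
    (x : ℕ → ℝ) :
    V {ω | (fun i => Y i ω) ∈ A} ≤ ENNReal.ofReal (iterExp (S.upperLaw (Y 0)) 0 N (ind B) x) := by
  obtain ⟨g, hg, hgA, hgB⟩ := exists_bddLip_between hδ h
  have hU := S.isUpperExp_upperLaw (hY.mem 0)
  have h1 := hV.le_of_indicator_le _ hA _ (S.bddLip_mem (X := fun i : Fin N => Y i)
    (fun i => hY.mem i) hg) fun ω => hgA fun i => Y i ω
  rw [IID.eq_iterExp S hY N hg x] at h1
  have h2 := hU.iter_mono (IsBdd.comp hg.1 _) (isBdd_ind B) hgB 0 N x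
  have h3 := h1.trans (EReal.coe_le_coe_iff.2 h2)
  rw [← EReal.coe_ennreal_le_coe_ennreal_iff, EReal.coe_ennreal_ofReal,
    max_eq_left (hU.iter_nonneg (isBdd_ind B) (ind_nonneg B) 0 N x)]
  exact h3

theorem upCap_le_iterExp (x : ℕ → ℝ) : S.upCap {ω | (fun i => Y i ω) ∈ A} ≤
    ENNReal.ofReal (iterExp (S.upperLaw (Y 0)) 0 N (ind B) x) := by
  obtain ⟨g, hg, hgA, hgB⟩ := exists_bddLip_between hδ h
  have hU := S.isUpperExp_upperLaw (hY.mem 0)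
  refine (iInf₂_le_of_le (fun ω => g fun i : Fin N => Y i ω)
    (S.bddLip_mem (X := fun i : Fin N => Y i) (fun i => hY.mem i) hg) (iInf_le_of_le
    (fun ω => hgA fun i => Y i ω) le_rfl)).trans ?_
  rw [IID.eq_iterExp S hY N hg x]
  exact ENNReal.ofReal_le_ofReal (hU.iter_mono (IsBdd.comp hg.1 _) (isBdd_ind B) hgB 0 N x)

end capacity
end SubLinearExpectationSpace

/-! ### The iterated logarithm -/

/-- The iterated logarithm. -/
noncomputable def llog (t : ℝ) : ℝ := lg (lg t)

theorem one_le_lg (x : ℝ) : 1 ≤ lg x :=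
  (Real.le_log_iff_exp_le (lt_max_of_lt_left (Real.exp_pos 1))).2 (le_max_left _ _)

theorem lg_mono {x y : ℝ} (h : x ≤ y) : lg x ≤ lg y :=
  Real.log_le_log (lt_max_of_lt_left (Real.exp_pos 1)) (max_le_max le_rfl h)

/-- A crude form of slow variation, from `log s ≤ s - 1` and `lg ≥ 1`. Applied twice it serves
`llog`, and it is all the regularity needed for `lilNorm`. -/
theorem lg_mul_le {s : ℝ} (hs : 1 ≤ s) (t : ℝ) : lg (s * t) ≤ s * lg t := by
  have he := Real.exp_pos 1
  have h1 : max (Real.exp 1) (s * t) ≤ s * max (Real.exp 1) t := by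
    refine max_le ?_ (mul_le_mul_of_nonneg_left (le_max_right _ _) (by linarith))
    have := le_max_left (Real.exp 1) t
    nlinarith
  have h2 : lg (s * t) ≤ Real.log s + lg t := by
    rw [lg, lg, ← Real.log_mul (by linarith) (lt_max_of_lt_left he).ne']
    exact Real.log_le_log (lt_max_of_lt_left he) h1
  have h3 := Real.log_le_sub_one_of_pos (show 0 < s by linarith)
  nlinarith [one_le_lg t]

theorem lg_le_self {x : ℝ} (hx : 1 ≤ x) : lg x ≤ x := by
  rcases le_total (Real.exp 1) x with h | h
  · rw [lg, max_eq_right h]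
    linarith [Real.log_le_sub_one_of_pos (show 0 < x by linarith)]
  · rw [lg, max_eq_left h, Real.log_exp]; exact hx

theorem log_le_lg {x : ℝ} (hx : 0 < x) : Real.log x ≤ lg x :=
  Real.log_le_log hx (le_max_right _ _)

theorem tendsto_lg : Tendsto lg atTop atTop := by
  refine tendsto_atTop_mono' _ ?_ Real.tendsto_log_atTop
  filter_upwards [eventually_gt_atTop 0] with x hx using log_le_lg hx

theorem one_le_llog (x : ℝ) : 1 ≤ llog x := one_le_lg _

theorem llog_pos (x : ℝ) : 0 < llog x := one_pos.trans_le (one_le_llog x)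

theorem llog_mono {x y : ℝ} (h : x ≤ y) : llog x ≤ llog y := lg_mono (lg_mono h)

theorem llog_mul_le {s : ℝ} (hs : 1 ≤ s) (t : ℝ) : llog (s * t) ≤ s * llog t :=
  (lg_mono (lg_mul_le hs t)).trans (lg_mul_le hs _)

theorem llog_le_self {x : ℝ} (hx : 1 ≤ x) : llog x ≤ x :=
  (lg_le_self (one_le_lg x)).trans (lg_le_self hx)

theorem tendsto_llog : Tendsto llog atTop atTop := tendsto_lg.comp tendsto_lg

theorem tendsto_llog_nat : Tendsto (fun n : ℕ => llog n) atTop atTop :=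
  tendsto_llog.comp tendsto_natCast_atTop_atTop

/-- `llog t / t` is antitone. -/
theorem llog_div_anti {t u : ℝ} (ht : 0 < t) (htu : t ≤ u) : llog u / u ≤ llog t / t := by
  have h1 := llog_mul_le ((one_le_div ht).2 htu) t
  rw [div_mul_cancel₀ _ ht.ne'] at h1
  rw [div_le_div_iff₀ (ht.trans_le htu) ht]
  calc llog u * t ≤ (u / t * llog t) * t := mul_le_mul_of_nonneg_right h1 ht.le
    _ = llog t * u := by field_simp

/-- `t² / llog t` is monotone. -/
theorem sq_div_llog_mono {t u : ℝ} (ht : 0 ≤ t) (htu : t ≤ u) :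
    t ^ 2 / llog t ≤ u ^ 2 / llog u := by
  rcases ht.eq_or_lt with rfl | ht
  · simpa using div_nonneg (sq_nonneg u) (llog_pos u).le
  have hu := ht.trans_le htu
  have h1 := llog_div_anti ht htu
  rw [div_le_div_iff₀ hu ht] at h1
  rw [div_le_div_iff₀ (llog_pos _) (llog_pos _)]
  have h2 := mul_le_mul_of_nonneg_left h1 ht.le
  have h3 : 0 < u * llog t := mul_pos hu (llog_pos t)
  nlinarith

theorem lilNorm_sq (n : ℕ) : lilNorm n ^ 2 = 2 * n * llog n :=
  Real.sq_sqrt (mul_nonneg (by positivity) (llog_pos n).le)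

theorem lilNorm_nonneg (n : ℕ) : 0 ≤ lilNorm n := Real.sqrt_nonneg _

theorem lilNorm_mono {m n : ℕ} (h : m ≤ n) : lilNorm m ≤ lilNorm n := by
  have h' : (m : ℝ) ≤ n := by exact_mod_cast h
  refine Real.sqrt_le_sqrt (mul_le_mul (by linarith) (llog_mono h') (llog_pos _).le ?_)
  positivity

theorem sqrt_le_lilNorm (n : ℕ) : Real.sqrt n ≤ lilNorm n := by
  refine Real.sqrt_le_sqrt ?_
  change (n : ℝ) ≤ 2 * n * llog n
  have := one_le_llog n
  have hn : (0 : ℝ) ≤ n := n.cast_nonneg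
  nlinarith

theorem one_le_lilNorm {n : ℕ} (hn : 1 ≤ n) : 1 ≤ lilNorm n :=
  le_trans (by rw [Real.one_le_sqrt]; exact_mod_cast hn) (sqrt_le_lilNorm n)

theorem lilNorm_pos {n : ℕ} (hn : 1 ≤ n) : 0 < lilNorm n := one_pos.trans_le (one_le_lilNorm hn)

theorem lilNorm_le {n : ℕ} (hn : 1 ≤ n) : lilNorm n ≤ 2 * n := by
  have hn' : (1 : ℝ) ≤ n := by exact_mod_cast hn
  refine abs_le_of_sq_le_sq' ?_ (by positivity) |>.2
  rw [lilNorm_sq]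
  nlinarith [llog_le_self hn']

theorem tendsto_lilNorm : Tendsto lilNorm atTop atTop :=
  tendsto_atTop_mono sqrt_le_lilNorm
    (Real.tendsto_sqrt_atTop.comp tendsto_natCast_atTop_atTop)

/-- `lilNorm n ≤ s * lilNorm m` if `n ≤ s * m`, `s ≥ 1`. -/
theorem lilNorm_le_mul {m n : ℕ} {s : ℝ} (hs : 1 ≤ s) (h : (n : ℝ) ≤ s * m) :
    lilNorm n ≤ s * lilNorm m := by
  refine abs_le_of_sq_le_sq' ?_ (mul_nonneg (by linarith) (lilNorm_nonneg m)) |>.2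
  rw [mul_pow, lilNorm_sq, lilNorm_sq]
  have h1 : llog n ≤ s * llog m := (llog_mono h).trans (llog_mul_le hs _)
  have h2 : (n : ℝ) * llog n ≤ (s * m) * (s * llog m) :=
    mul_le_mul h h1 (llog_pos _).le (by positivity)
  nlinarith

/-- The norming constants at least double along powers of four, which makes sums over blocks
geometric. -/
theorem two_mul_lilNorm_le (n : ℕ) : 2 * lilNorm n ≤ lilNorm (4 * n) := by
  refine abs_le_of_sq_le_sq' ?_ (lilNorm_nonneg _) |>.2
  rw [mul_pow, lilNorm_sq, lilNorm_sq]
  have h1 : llog n ≤ llog ((4 * n : ℕ) : ℝ) :=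
    llog_mono (by push_cast; linarith [(n.cast_nonneg : (0 : ℝ) ≤ n)])
  have h2 : (0 : ℝ) ≤ n := n.cast_nonneg
  have h3 := mul_le_mul_of_nonneg_left h1 h2
  push_cast at h3 ⊢
  linarith

theorem llog_le_of_le_lilNorm {n : ℕ} (hn : 1 ≤ n) {t : ℝ} (ht : t ≤ lilNorm n) :
    llog t ≤ 2 * llog n :=
  (llog_mono (ht.trans (lilNorm_le hn))).trans (llog_mul_le one_le_two _)

/-- Since `e < 4`, the logarithm of `n` is at least `k` and its iterated logarithm at least `log k`.
For `p > 1` this gives a summable bound over the blocks. -/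
theorem exp_neg_llog_le {n k : ℕ} (hk : 1 ≤ k) (h : 4 ^ k ≤ n) {p : ℝ} (hp : 0 ≤ p) :
    Real.exp (-(p * llog n)) ≤ 1 / (k : ℝ) ^ p := by
  have hk0 : (0 : ℝ) < k := by exact_mod_cast hk
  have h1 : (k : ℝ) ≤ lg n := by
    have h4 : ((4 : ℝ) ^ k) ≤ n := by exact_mod_cast h
    refine le_trans ?_ (log_le_lg (by linarith [pow_pos (show (0 : ℝ) < 4 by norm_num) k]))
    rw [Real.le_log_iff_exp_le (by linarith [pow_pos (show (0 : ℝ) < 4 by norm_num) k])]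
    refine le_trans ?_ h4
    rw [← Real.exp_one_pow]
    exact pow_le_pow_left₀ (Real.exp_pos 1).le (by linarith [Real.exp_one_lt_three]) k
  have h2 : Real.log k ≤ llog n := (log_le_lg hk0).trans (lg_mono h1)
  rw [Real.rpow_def_of_pos hk0, one_div, ← Real.exp_neg]
  exact Real.exp_le_exp.2 (by nlinarith)

/-! ### Truncation -/

/-- The function `x ↦ (-y) ∨ (x ∧ y)`. -/
noncomputable def clip (y x : ℝ) : ℝ := max (-y) (min x y)

theorem abs_clip {y : ℝ} (hy : 0 ≤ y) (x : ℝ) : |clip y x| = min |x| y := by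
  unfold clip
  rcases abs_cases x with ⟨h, h'⟩ | ⟨h, h'⟩ <;> rw [h]
  · rw [max_eq_right (by linarith [le_min h' hy]), abs_of_nonneg (le_min h' hy)]
  · rw [min_eq_left (h'.le.trans hy), abs_of_nonpos (max_le (by linarith) h'.le)]
    rcases le_total (-y) x with h1 | h1
    · rw [max_eq_right h1, min_eq_left (by linarith)]
    · rw [max_eq_left h1, min_eq_right (by linarith), neg_neg]

theorem abs_clip_le {y : ℝ} (hy : 0 ≤ y) (x : ℝ) : |clip y x| ≤ y :=
  (abs_clip hy x).trans_le (min_le_right _ _)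

theorem clip_of_abs_le {y x : ℝ} (h : |x| ≤ y) : clip y x = x := by
  have := abs_le.1 h
  rw [clip, min_eq_left this.2, max_eq_right this.1]

theorem isBdd_clip {y : ℝ} (hy : 0 ≤ y) : IsBdd (clip y) := ⟨y, abs_clip_le hy⟩

theorem isBddLip_clip {y : ℝ} (hy : 0 ≤ y) : IsBddLip (clip y) :=
  ⟨isBdd_clip hy, 1, (LipschitzWith.id.min_const y).const_max (-y)⟩

/-- `b ≤ y` implies `clip b x * clip y x ≥ (clip b x)²`. -/
theorem clip_sq_le_mul {b y : ℝ} (hb : 0 ≤ b) (hby : b ≤ y) (x : ℝ) :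
    clip b x ^ 2 ≤ clip b x * clip y x := by
  rcases le_total 0 x with h | h
  · have h1 : clip b x = min x b := max_eq_right (by linarith [le_min h hb])
    have h2 : clip y x = min x y := max_eq_right (by linarith [le_min h (hb.trans hby)])
    rw [h1, h2, sq]
    exact mul_le_mul_of_nonneg_left (min_le_min le_rfl hby) (le_min h hb)
  · have h1 : clip b x = max (-b) x := by rw [clip, min_eq_left (h.trans hb)]
    have h2 : clip y x = max (-y) x := by rw [clip, min_eq_left (h.trans (hb.trans hby))]
    rw [h1, h2, sq]
    exact mul_le_mul_of_nonpos_left (max_le_max (by linarith) le_rfl)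
      (max_le (by linarith) h)

theorem exists_dyadic {t : ℝ} (ht : 1 ≤ t) : ∃ j : ℕ, (2 : ℝ) ^ j ≤ t ∧ t < 2 ^ (j + 1) :=
  exists_nat_pow_near ht one_lt_two

/-- The finite set of all `j` with `2 ^ j ≤ y`. -/
noncomputable def dyadicBelow (y : ℝ) : Finset ℕ :=
  (Finset.range (⌊y⌋₊ + 1)).filter fun j => (2 : ℝ) ^ j ≤ y

theorem mem_dyadicBelow {y : ℝ} {j : ℕ} : j ∈ dyadicBelow y ↔ (2 : ℝ) ^ j ≤ y := by
  rw [dyadicBelow, Finset.mem_filter, Finset.mem_range, and_iff_right_iff_imp]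
  intro h
  have h1 : (j : ℝ) < 2 ^ j := by exact_mod_cast Nat.lt_two_pow_self
  exact Nat.lt_succ_of_le (Nat.le_floor (h1.le.trans h))

/-- A layer decomposition: the dyadic level of the clipped modulus contributes a large enough term,
and values at most one are covered by the summand `1`. -/
theorem abs_clip_pow_le {y : ℝ} (hy : 0 ≤ y) (q : ℕ) (x : ℝ) : |clip y x| ^ q ≤
    ∑ j ∈ dyadicBelow y, (2 : ℝ) ^ (q * (j + 1)) * ind {x | (2 : ℝ) ^ j ≤ |x|} x + 1 := by
  have h0 : ∀ j, 0 ≤ (2 : ℝ) ^ (q * (j + 1)) * ind {x | (2 : ℝ) ^ j ≤ |x|} x := fun j =>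
    mul_nonneg (by positivity) (ind_nonneg _ _)
  rcases le_total |clip y x| 1 with h | h
  · have := pow_le_one₀ (n := q) (abs_nonneg (clip y x)) h
    linarith [Finset.sum_nonneg fun j (_ : j ∈ dyadicBelow y) => h0 j]
  · obtain ⟨j, hj1, hj2⟩ := exists_dyadic h
    rw [abs_clip hy] at hj1
    have hjm : j ∈ dyadicBelow y := mem_dyadicBelow.2 (hj1.trans (min_le_right _ _))
    have h1 := Finset.single_le_sum (fun j _ => h0 j) hjm
    have hx : x ∈ {x : ℝ | (2 : ℝ) ^ j ≤ |x|} := hj1.trans (min_le_left _ _)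
    rw [ind_of_mem hx, mul_one] at h1
    have h2 : |clip y x| ^ q ≤ ((2 : ℝ) ^ (j + 1)) ^ q :=
      pow_le_pow_left₀ (abs_nonneg _) hj2.le q
    rw [← pow_mul, mul_comm (j + 1) q] at h2
    linarith

/-- The tail `L (|x| ≥ t)`. -/
noncomputable def tail (L : (ℝ → ℝ) → ℝ) (t : ℝ) : ℝ := L (ind {x | t ≤ |x|})

/-- The terms of the dyadic form of the moment condition. -/
noncomputable def dyadicTail (L : (ℝ → ℝ) → ℝ) (j : ℕ) : ℝ :=
  (4 : ℝ) ^ j / llog (2 ^ j) * tail L (2 ^ j)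

theorem sum_dyadicBelow_eq_tsum (y : ℝ) (f : ℕ → ℝ) :
    ∑ j ∈ dyadicBelow y, f j = ∑' j, if (2 : ℝ) ^ j ≤ y then f j else 0 := by
  rw [tsum_eq_sum (s := dyadicBelow y)]
  · exact Finset.sum_congr rfl fun j hj => by rw [if_pos (mem_dyadicBelow.1 hj)]
  · intro j hj
    rw [if_neg fun h => hj (mem_dyadicBelow.2 h)]

theorem summable_dyadicBelow (y : ℝ) (f : ℕ → ℝ) :
    Summable fun j => if (2 : ℝ) ^ j ≤ y then f j else 0 := by
  refine summable_of_ne_finset_zero (s := dyadicBelow y) fun j hj => ?_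
  rw [if_neg fun h => hj (mem_dyadicBelow.2 h)]

/-- Along a sequence which grows at least by the factor `2`. -/
theorem sum_geom_le {D : ℕ → ℝ} (hD0 : ∀ k, 0 < D k) (hD : ∀ k, 2 * D k ≤ D (k + 1)) {t : ℝ}
    (ht : 0 < t) (K : ℕ) : ∑ k ∈ Finset.range K, (if t ≤ D k then t / D k else 0) ≤ 2 := by
  -- The term `2 * (t / D K)` kept in reserve pays for the next summand, because the ratio at least
  -- halves at each step.
  suffices h : (D K < t → ∑ k ∈ Finset.range K, (if t ≤ D k then t / D k else 0) = 0) ∧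
      (t ≤ D K → ∑ k ∈ Finset.range K, (if t ≤ D k then t / D k else 0) ≤ 2 - 2 * (t / D K)) by
    rcases lt_or_ge (D K) t with h' | h'
    · rw [h.1 h']; norm_num
    · have := div_pos ht (hD0 K)
      linarith [h.2 h']
  induction K with
  | zero =>
    refine ⟨fun _ => by simp, fun h => ?_⟩
    have := (div_le_one (hD0 0)).2 h
    simp only [Finset.range_zero, Finset.sum_empty]
    linarith
  | succ K ih =>
    have hK := hD0 K
    have hDK := hD K
    rw [Finset.sum_range_succ]
    refine ⟨fun h => ?_, fun h => ?_⟩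
    · rw [ih.1 (by linarith), if_neg (by linarith), add_zero]
    · by_cases h' : t ≤ D K
      · rw [if_pos h']
        have h1 := ih.2 h'
        have h2 : t / D (K + 1) ≤ t / (2 * D K) :=
          div_le_div_of_nonneg_left ht.le (by linarith) hDK
        have h3 : t / (2 * D K) = t / D K / 2 := by field_simp
        linarith
      · push Not at h'
        rw [if_neg (by linarith), ih.1 h']
        have := (div_le_one (hD0 (K + 1))).2 h
        linarith

/-! ### Consequences of the dyadic moment condition. -/

namespace IsUpperExp
variable {L : (ℝ → ℝ) → ℝ} (hL : IsUpperExp L)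
include hL

theorem tail_nonneg (t : ℝ) : 0 ≤ tail L t := hL.nonneg (isBdd_ind _) (ind_nonneg _)

theorem tail_le_one (t : ℝ) : tail L t ≤ 1 := hL.le_const (isBdd_ind _) (ind_le_one _)

theorem dyadicTail_nonneg (j : ℕ) : 0 ≤ dyadicTail L j :=
  mul_nonneg (div_nonneg (by positivity) (llog_pos _).le) (hL.tail_nonneg _)

theorem clip_pow_le {y : ℝ} (hy : 0 ≤ y) (q : ℕ) : L (fun x => |clip y x| ^ q) ≤
    ∑ j ∈ dyadicBelow y, (2 : ℝ) ^ (q * (j + 1)) * tail L (2 ^ j) + 1 := by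
  have hb : ∀ j, IsBdd fun x => (2 : ℝ) ^ (q * (j + 1)) * ind {x | (2 : ℝ) ^ j ≤ |x|} x :=
    fun j => (isBdd_ind _).const_mul _
  have hs := IsBdd.sum (dyadicBelow y) fun j _ => hb j
  refine (hL.mono _ _ ((isBdd_clip hy).abs.pow q) (hs.add (IsBdd.const 1))
    (abs_clip_pow_le hy q)).trans ?_
  rw [hL.add_const hs]
  refine add_le_add_left ((hL.sum_le _ fun j _ => hb j).trans_eq ?_) 1
  exact Finset.sum_congr rfl fun j _ => hL.smul _ (isBdd_ind _) _ (by positivity)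

theorem tail_le_div {y : ℝ} (hy : 0 < y) (q : ℕ) :
    tail L y ≤ L (fun x => |clip y x| ^ q) / y ^ q := by
  rw [le_div_iff₀ (by positivity), mul_comm, tail, ← hL.smul _ (isBdd_ind _) _ (by positivity)]
  refine hL.mono _ _ ((isBdd_ind _).const_mul _) ((isBdd_clip hy.le).abs.pow q) fun x => ?_
  by_cases hx : x ∈ {x : ℝ | y ≤ |x|}
  · rw [ind_of_mem hx, mul_one, abs_clip hy.le, min_eq_right hx]
  · rw [ind_of_notMem hx, mul_zero]; positivity

/-- `L (clip_{d_n}²) = o(log log n)`. -/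
theorem tendsto_clip_sq (ha : Summable (dyadicTail L)) :
    Tendsto (fun n : ℕ => L (fun x => clip (lilNorm n) x ^ 2) / llog n) atTop (𝓝 0) := by
  have h1 : ∀ n : ℕ, L (fun x => clip (lilNorm n) x ^ 2) / llog n ≤
      4 * ∑' j, (if (2 : ℝ) ^ j ≤ lilNorm n then llog (2 ^ j) * dyadicTail L j / llog n else 0)
        + 1 / llog n := by
    intro n
    have h := hL.clip_pow_le (lilNorm_nonneg n) 2
    simp only [sq_abs] at h
    have e : ∑ j ∈ dyadicBelow (lilNorm n), (2 : ℝ) ^ (2 * (j + 1)) * tail L (2 ^ j) =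
        4 * llog n * ∑ j ∈ dyadicBelow (lilNorm n), llog (2 ^ j) * dyadicTail L j / llog n := by
      rw [Finset.mul_sum]
      refine Finset.sum_congr rfl fun j _ => ?_
      have := (llog_pos n).ne'
      have := (llog_pos ((2 : ℝ) ^ j)).ne'
      rw [dyadicTail, pow_mul, pow_succ]
      norm_num
      field_simp
    rw [← sum_dyadicBelow_eq_tsum, div_le_iff₀ (llog_pos n), add_mul,
      one_div_mul_cancel (llog_pos n).ne']
    rw [e] at h
    linarith
  have h2 : Tendsto (fun n : ℕ => 4 * ∑' j, (if (2 : ℝ) ^ j ≤ lilNorm n then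
      llog (2 ^ j) * dyadicTail L j / llog n else 0) + 1 / llog n) atTop (𝓝 0) := by
    have hz : Tendsto (fun n : ℕ => 1 / llog (n : ℝ)) atTop (𝓝 0) := by
      simp only [one_div]
      exact tendsto_llog_nat.inv_tendsto_atTop
    -- Each level is killed by `1 / llog n`. The levels below `d_n` satisfy `llog (2 ^ j) ≤ 2 * llog
    -- n`, which gives the summable majorant.
    have ht := tendsto_tsum_of_dominated_convergence (𝓕 := atTop)
      (f := fun (n : ℕ) j => if (2 : ℝ) ^ j ≤ lilNorm n then
        llog (2 ^ j) * dyadicTail L j / llog n else 0) (g := fun _ => 0)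
      (bound := fun j => 2 * dyadicTail L j) (ha.mul_left 2) ?_ ?_
    · rw [tsum_zero] at ht
      simpa using (ht.const_mul 4).add hz
    · intro j
      refine squeeze_zero (g := fun n : ℕ => llog (2 ^ j) * dyadicTail L j * (1 / llog n))
        (fun n => ?_) (fun n => ?_) (by simpa using hz.const_mul (llog (2 ^ j) * dyadicTail L j))
      · split_ifs
        · exact div_nonneg (mul_nonneg (llog_pos _).le (hL.dyadicTail_nonneg j)) (llog_pos _).le
        · exact le_rfl
      · have h0 := mul_nonneg (llog_pos (2 ^ j)).le (hL.dyadicTail_nonneg j)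
        split_ifs
        · exact (mul_one_div _ _).symm.le
        · exact mul_nonneg h0 (one_div_nonneg.2 (llog_pos _).le)
    · filter_upwards [eventually_ge_atTop 1] with n hn j
      have ha0 := hL.dyadicTail_nonneg j
      rw [Real.norm_eq_abs]
      split_ifs with h
      · rw [abs_of_nonneg (div_nonneg (mul_nonneg (llog_pos _).le ha0) (llog_pos _).le),
          div_le_iff₀ (llog_pos _)]
        nlinarith [mul_le_mul_of_nonneg_right (llog_le_of_le_lilNorm hn h) ha0]
      · rw [abs_zero]; positivity
  refine squeeze_zero (fun n => div_nonneg (hL.nonneg ((isBdd_clip (lilNorm_nonneg n)).pow 2)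
    fun x => sq_nonneg _) (llog_pos _).le) h1 h2

/-- `n L(|x| ≥ d_n) → 0`. -/
theorem tendsto_mul_tail (ha : Summable (dyadicTail L)) :
    Tendsto (fun n : ℕ => n * tail L (lilNorm n)) atTop (𝓝 0) := by
  refine squeeze_zero' (Eventually.of_forall fun n => mul_nonneg n.cast_nonneg (hL.tail_nonneg _))
    ?_ (hL.tendsto_clip_sq ha)
  filter_upwards [eventually_ge_atTop 1] with n hn
  -- Markov's inequality with `d_n² = 2 n llog n` reduces the claim to the estimate of the second
  -- moment.
  have h := hL.tail_le_div (lilNorm_pos hn) 2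
  simp only [sq_abs] at h
  rw [lilNorm_sq, le_div_iff₀ (mul_pos (by positivity) (llog_pos _))] at h
  rw [le_div_iff₀ (llog_pos _)]
  have h0 : 0 ≤ n * tail L (lilNorm n) * llog n :=
    mul_nonneg (mul_nonneg n.cast_nonneg (hL.tail_nonneg _)) (llog_pos _).le
  linarith

/-- The error of truncation at the level `y` in the mean. -/
noncomputable def _root_.truncErr (L : (ℝ → ℝ) → ℝ) (y : ℝ) : ℝ :=
  ∑' j : ℕ, if y < 2 ^ (j + 1) then (2 : ℝ) ^ (j + 1) * tail L (2 ^ j) else 0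

omit hL in
-- First-moment layers are the moment-condition layers times `llog t / t`, which is antitone and
-- thus gains on high levels.
theorem two_pow_mul_tail_eq (j : ℕ) :
    (2 : ℝ) ^ (j + 1) * tail L (2 ^ j) = 2 * (llog (2 ^ j) / 2 ^ j) * dyadicTail L j := by
  have := (llog_pos ((2 : ℝ) ^ j)).ne'
  rw [dyadicTail, show (4 : ℝ) = 2 ^ 2 by norm_num, ← pow_mul, pow_succ, mul_comm 2 j, pow_mul]
  field_simp

theorem summable_two_pow_mul_tail (ha : Summable (dyadicTail L)) :
    Summable fun j : ℕ => (2 : ℝ) ^ (j + 1) * tail L (2 ^ j) := by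
  refine Summable.of_nonneg_of_le (fun j => mul_nonneg (by positivity) (hL.tail_nonneg _))
    (fun j => ?_) (ha.mul_left 2)
  rw [two_pow_mul_tail_eq]
  refine mul_le_mul_of_nonneg_right ?_ (hL.dyadicTail_nonneg j)
  have : llog ((2 : ℝ) ^ j) / 2 ^ j ≤ 1 :=
    (div_le_one (by positivity)).2 (llog_le_self (one_le_pow₀ one_le_two))
  linarith

theorem summable_truncErr (ha : Summable (dyadicTail L)) (y : ℝ) :
    Summable fun j : ℕ => if y < 2 ^ (j + 1) then (2 : ℝ) ^ (j + 1) * tail L (2 ^ j) else 0 := by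
  have h0 : ∀ j : ℕ, 0 ≤ (2 : ℝ) ^ (j + 1) * tail L (2 ^ j) := fun j =>
    mul_nonneg (by positivity) (hL.tail_nonneg _)
  refine Summable.of_nonneg_of_le (fun j => ?_) (fun j => ?_) (hL.summable_two_pow_mul_tail ha)
  · split_ifs
    exacts [h0 j, le_rfl]
  · split_ifs
    exacts [le_rfl, h0 j]

theorem tendsto_truncErr (ha : Summable (dyadicTail L)) :
    Tendsto (truncErr L) atTop (𝓝 0) := by
  have h0 : ∀ j : ℕ, 0 ≤ (2 : ℝ) ^ (j + 1) * tail L (2 ^ j) := fun j =>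
    mul_nonneg (by positivity) (hL.tail_nonneg _)
  have h := tendsto_tsum_of_dominated_convergence (𝓕 := atTop)
      (f := fun (y : ℝ) (j : ℕ) => if y < 2 ^ (j + 1) then (2 : ℝ) ^ (j + 1) * tail L (2 ^ j)
        else 0) (g := fun _ => 0) (hL.summable_two_pow_mul_tail ha) ?_ ?_
  · rwa [tsum_zero] at h
  · intro j
    refine tendsto_const_nhds.congr' ?_
    filter_upwards [eventually_ge_atTop ((2 : ℝ) ^ (j + 1))] with y hy
    rw [if_neg (not_lt.2 hy)]
  · refine Eventually.of_forall fun y j => ?_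
    rw [Real.norm_eq_abs]
    split_ifs
    · rw [abs_of_nonneg (h0 j)]
    · rw [abs_zero]; exact h0 j

/-- Changing the truncation level. The sign `s` is `1` or `-1`. -/
theorem clip_le_clip_add (ha : Summable (dyadicTail L)) {y y' : ℝ} (hy : 1 ≤ y) (hyy : y ≤ y')
    {s : ℝ} (hs : |s| = 1) :
    L (fun x => s * clip y x) ≤ L (fun x => s * clip y' x) + truncErr L y := by
  have hy0 : 0 ≤ y := by linarith
  have hy0' : 0 ≤ y' := by linarith
  let F : ℕ → ℝ → ℝ := fun j x =>
    if y < 2 ^ (j + 1) then (2 : ℝ) ^ (j + 1) * ind {x | (2 : ℝ) ^ j ≤ |x|} x else 0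
  have hF0 : ∀ j x, 0 ≤ F j x := fun j x => by
    simp only [F]; split_ifs
    exacts [mul_nonneg (by positivity) (ind_nonneg _ _), le_rfl]
  have hFb : ∀ j, IsBdd (F j) := fun j =>
    IsBdd.ite ((isBdd_ind _).const_mul _) (IsBdd.const 0) fun _ => y < 2 ^ (j + 1)
  have hFL : ∀ j, L (F j) = if y < 2 ^ (j + 1) then (2 : ℝ) ^ (j + 1) * tail L (2 ^ j) else 0 := by
    intro j
    by_cases h : y < 2 ^ (j + 1)
    · simp only [F, if_pos h]; exact hL.smul _ (isBdd_ind _) _ (by positivity)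
    · simp only [F, if_neg h]; exact hL.const 0
  have hSb := IsBdd.sum (dyadicBelow y') fun j _ => hFb j
  have hpt : ∀ x, s * clip y x ≤ s * clip y' x + ∑ j ∈ dyadicBelow y', F j x := by
    intro x
    have hS0 : 0 ≤ ∑ j ∈ dyadicBelow y', F j x := Finset.sum_nonneg fun j _ => hF0 j x
    by_cases hx : |x| ≤ y
    · rw [clip_of_abs_le hx, clip_of_abs_le (hx.trans hyy)]; linarith
    push Not at hx
    have hm : 1 ≤ min |x| y' := le_min (by linarith) (by linarith)
    obtain ⟨j, hj1, hj2⟩ := exists_dyadic hm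
    -- The dyadic interval containing `min |x| y'` ends above `y`, so its layer is among those kept
    -- in `F`, and its weight exceeds the discrepancy of the two truncations, which have the same
    -- sign.
    have h1 : y < 2 ^ (j + 1) := lt_of_le_of_lt (le_min hx.le hyy) hj2
    have h2 := Finset.single_le_sum (fun j _ => hF0 j x)
      (mem_dyadicBelow.2 (hj1.trans (min_le_right _ _)))
    have h3 : F j x = 2 ^ (j + 1) := by
      simp only [F, if_pos h1]
      rw [ind_of_mem (show x ∈ {x : ℝ | (2 : ℝ) ^ j ≤ |x|} from hj1.trans (min_le_left _ _)),
        mul_one]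
    have h4 : |clip y x - clip y' x| ≤ min |x| y' := by
      rcases le_total 0 x with h | h
      · rw [abs_of_nonneg h] at hx ⊢
        have e1 : clip y x = y := by rw [clip, min_eq_right hx.le, max_eq_right (by linarith)]
        have e2 : clip y' x = min x y' := max_eq_right (by linarith [le_min h hy0'])
        rw [e1, e2, abs_sub_comm, abs_of_nonneg (sub_nonneg.2 (le_min hx.le hyy))]
        linarith
      · rw [abs_of_nonpos h] at hx ⊢
        have e1 : clip y x = -y := by
          rw [clip, min_eq_left (h.trans hy0), max_eq_left (by linarith)]
        have e2 : clip y' x = -min (-x) y' := by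
          rw [clip, min_eq_left (h.trans hy0'), ← max_neg_neg, neg_neg, max_comm]
        have := le_min hx.le hyy
        rw [e1, e2, abs_of_nonneg (by linarith)]
        linarith
    have h5 : s * clip y x - s * clip y' x ≤ |clip y x - clip y' x| := by
      rw [← mul_sub]
      refine (le_abs_self _).trans_eq ?_
      rw [abs_mul, hs, one_mul]
    linarith
  have hc := (isBdd_clip hy0).const_mul s
  have hc' := (isBdd_clip hy0').const_mul s
  refine (hL.mono _ _ hc (hc'.add hSb) hpt).trans ((hL.add_le _ _ hc' hSb).trans ?_)
  refine add_le_add le_rfl ((hL.sum_le _ fun j _ => hFb j).trans ?_)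
  simp only [hFL]
  exact (hL.summable_truncErr ha y).sum_le_tsum _ fun j _ => by
    rw [← hFL]; exact hL.nonneg (hFb j) (hF0 j)

/-- `(n / d_n)` times the truncation error at the level `ε d_n` tends to `0`. -/
theorem tendsto_mul_truncErr (ha : Summable (dyadicTail L)) {ε : ℝ} (hε : 0 < ε) (hε1 : ε ≤ 1) :
    Tendsto (fun n : ℕ => n / lilNorm n * truncErr L (ε * lilNorm n)) atTop (𝓝 0) := by
  have h0 : ∀ j : ℕ, 0 ≤ (2 : ℝ) ^ (j + 1) * tail L (2 ^ j) := fun j =>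
    mul_nonneg (by positivity) (hL.tail_nonneg _)
  have ht := tendsto_tsum_of_dominated_convergence (𝓕 := atTop)
      (f := fun (n : ℕ) (j : ℕ) => n / lilNorm n * if ε * lilNorm n < 2 ^ (j + 1) then
        (2 : ℝ) ^ (j + 1) * tail L (2 ^ j) else 0) (g := fun _ => 0)
      (bound := fun j => 4 / ε * dyadicTail L j) (ha.mul_left _) ?_ ?_
  · rw [tsum_zero] at ht
    simp only [tsum_mul_left] at ht
    exact ht
  · intro j
    refine tendsto_const_nhds.congr' ?_
    have := (tendsto_lilNorm.const_mul_atTop hε).eventually_ge_atTop ((2 : ℝ) ^ (j + 1))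
    filter_upwards [this] with n hn
    rw [if_neg (not_lt.2 hn), mul_zero]
  · filter_upwards [eventually_ge_atTop 1] with n hn j
    have hD := lilNorm_pos hn
    have ha0 := hL.dyadicTail_nonneg j
    have hb0 : 0 ≤ 4 / ε * dyadicTail L j := by positivity
    rw [Real.norm_eq_abs]
    split_ifs with h
    · rw [abs_of_nonneg (mul_nonneg (by positivity) (h0 j)), two_pow_mul_tail_eq]
      -- Only levels with `2 ^ j > ε d_n / 2` occur. Monotonicity of `llog t / t` and `d_n² = 2 n
      -- llog n` then bound the coefficients uniformly in `n`.
      have h1 : llog (2 ^ j) / 2 ^ j ≤ llog (ε / 2 * lilNorm n) / (ε / 2 * lilNorm n) :=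
        llog_div_anti (by positivity) (by rw [pow_succ] at h; linarith)
      have h2 : llog (ε / 2 * lilNorm n) ≤ 2 * llog n :=
        llog_le_of_le_lilNorm hn (by nlinarith)
      have h3 : llog (2 ^ j) / 2 ^ j ≤ 2 * llog n / (ε / 2 * lilNorm n) :=
        h1.trans (div_le_div_of_nonneg_right h2 (by positivity))
      have h4 : n / lilNorm n * (2 * llog n / (ε / 2 * lilNorm n)) = 2 / ε := by
        have : (n : ℝ) / lilNorm n * (2 * llog n / (ε / 2 * lilNorm n)) =
          (2 * n * llog n) / lilNorm n ^ 2 * (2 / ε) := by field_simp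
        rw [this, ← lilNorm_sq, div_self (by positivity), one_mul]
      have h5 : n / lilNorm n * (llog (2 ^ j) / 2 ^ j) ≤ 2 / ε :=
        (mul_le_mul_of_nonneg_left h3 (by positivity)).trans_eq h4
      calc _ = 2 * (n / lilNorm n * (llog (2 ^ j) / 2 ^ j)) * dyadicTail L j := by ring
        _ ≤ 2 * (2 / ε) * dyadicTail L j :=
          mul_le_mul_of_nonneg_right (by linarith) ha0
        _ = _ := by ring
    · rw [mul_zero, abs_zero]; exact hb0

/-- The normalized third moment. -/
noncomputable def _root_.thirdMoment (L : (ℝ → ℝ) → ℝ) (ε : ℝ) (n : ℕ) : ℝ :=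
  n * L (fun x => |clip (ε * lilNorm n) x| ^ 3) / lilNorm n ^ 3

theorem thirdMoment_nonneg {ε : ℝ} (hε : 0 < ε) (n : ℕ) : 0 ≤ thirdMoment L ε n := by
  have hD := lilNorm_nonneg n
  have := hL.nonneg ((isBdd_clip (mul_nonneg hε.le hD)).abs.pow 3)
    fun x => by positivity
  unfold thirdMoment
  positivity

/-- At block `k`, up to a constant and a summable remainder, level `j` contributes its
moment-condition term times `2 ^ j / D k`, and only if `2 ^ j ≤ D k`. Since `D` at least doubles,
summing over the blocks first costs a factor two for each level. -/
theorem summable_thirdMoment (ha : Summable (dyadicTail L)) {ε : ℝ} (hε : 0 < ε) (hε1 : ε ≤ 1)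
    {i : ℕ} (hi : 1 ≤ i) : Summable fun k : ℕ => thirdMoment L ε (i * 4 ^ k) := by
  let N : ℕ → ℕ := fun k => i * 4 ^ k
  have hN : ∀ k, 1 ≤ N k := fun k => Nat.one_le_iff_ne_zero.2 (by positivity)
  let D : ℕ → ℝ := fun k => lilNorm (N k)
  have hD0 : ∀ k, 0 < D k := fun k => lilNorm_pos (hN k)
  have hD : ∀ k, 2 * D k ≤ D (k + 1) := fun k => by
    have : N (k + 1) = 4 * N k := by simp only [N, pow_succ]; ring
    simp only [D, this]; exact two_mul_lilNorm_le _
  let F : ℕ → ℕ → ℝ := fun k j =>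
    dyadicTail L j * if (2 : ℝ) ^ j ≤ D k then (2 : ℝ) ^ j / D k else 0
  have hFs : ∀ k, Summable (F k) := fun k => by
    have := summable_dyadicBelow (D k) fun j => dyadicTail L j * ((2 : ℝ) ^ j / D k)
    refine this.congr fun j => ?_
    simp only [F, mul_ite, mul_zero]
  have hF0 : ∀ k j, 0 ≤ F k j := fun k j => by
    have := hD0 k
    have := hL.dyadicTail_nonneg j
    simp only [F]
    split_ifs
    · positivity
    · simp
  have hle : ∀ k, thirdMoment L ε (N k) ≤
      8 * ∑' j, F k j + if (1 : ℝ) ≤ D k then 1 / D k else 0 := by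
    intro k
    have hDk := hD0 k
    have hΛ := llog_pos (N k)
    have hNk : (0 : ℝ) < N k := by exact_mod_cast hN k
    rw [if_pos (one_le_lilNorm (hN k))]
    have h1 := hL.clip_pow_le (mul_nonneg hε.le hDk.le) 3
    have e0 : thirdMoment L ε (N k) =
        L (fun x => |clip (ε * D k) x| ^ 3) / (2 * llog (N k) * D k) := by
      rw [thirdMoment, show lilNorm (N k) ^ 3 = lilNorm (N k) ^ 2 * lilNorm (N k) by ring,
        lilNorm_sq]
      change (N k : ℝ) * L (fun x => |clip (ε * D k) x| ^ 3) / (2 * N k * llog (N k) * D k) = _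
      field_simp
    have h2 : ∑ j ∈ dyadicBelow (ε * D k), (2 : ℝ) ^ (3 * (j + 1)) * tail L (2 ^ j) ≤
        2 * llog (N k) * D k * (8 * ∑' j, F k j) := by
      have h3 : ∀ j ∈ dyadicBelow (ε * D k), (2 : ℝ) ^ (3 * (j + 1)) * tail L (2 ^ j) ≤
          2 * llog (N k) * D k * (8 * F k j) := by
        intro j hj
        have hj' : (2 : ℝ) ^ j ≤ D k := (mem_dyadicBelow.1 hj).trans (by nlinarith)
        have hlj := llog_pos ((2 : ℝ) ^ j)
        have e1 : (2 : ℝ) ^ (3 * (j + 1)) * tail L (2 ^ j) =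
            8 * 2 ^ j * dyadicTail L j * llog (2 ^ j) := by
          rw [dyadicTail, show (4 : ℝ) = 2 ^ 2 by norm_num, ← pow_mul]
          field_simp
          ring
        have e2 : 2 * llog (N k) * D k * (8 * F k j) =
            8 * 2 ^ j * dyadicTail L j * (2 * llog (N k)) := by
          simp only [F, if_pos hj']; field_simp
        rw [e1, e2]
        refine mul_le_mul_of_nonneg_left (llog_le_of_le_lilNorm (hN k) hj') ?_
        have := hL.dyadicTail_nonneg j
        positivity
      refine (Finset.sum_le_sum h3).trans ?_
      rw [← Finset.mul_sum, ← Finset.mul_sum]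
      refine mul_le_mul_of_nonneg_left ?_ (by positivity)
      refine mul_le_mul_of_nonneg_left ?_ (by norm_num)
      exact (hFs k).sum_le_tsum _ fun j _ => hF0 k j
    rw [e0, div_le_iff₀ (by positivity), add_mul]
    have h4 : 1 ≤ 1 / D k * (2 * llog (N k) * D k) := by
      have : 1 / D k * (2 * llog (N k) * D k) = 2 * llog (N k) := by field_simp
      rw [this]; linarith [one_le_llog (N k)]
    linarith
  have hrow : ∀ K, ∑ k ∈ Finset.range K, ∑' j, F k j ≤ 2 * ∑' j, dyadicTail L j := by
    intro K
    rw [← Summable.tsum_finsetSum fun k _ => hFs k, ← tsum_mul_left]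
    refine Summable.tsum_le_tsum (fun j => ?_) (summable_sum fun k _ => hFs k) (ha.mul_left 2)
    rw [← Finset.mul_sum, mul_comm 2]
    exact mul_le_mul_of_nonneg_left (sum_geom_le hD0 hD (by positivity) K)
      (hL.dyadicTail_nonneg j)
  refine summable_of_sum_range_le (c := 8 * (2 * ∑' j, dyadicTail L j) + 2)
    (fun k => hL.thirdMoment_nonneg hε _) fun K => ?_
  refine (Finset.sum_le_sum fun k _ => hle k).trans ?_
  rw [Finset.sum_add_distrib, ← Finset.mul_sum]
  exact add_le_add (mul_le_mul_of_nonneg_left (hrow K) (by norm_num))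
    (sum_geom_le hD0 hD one_pos K)

end IsUpperExp

/-! ### The upper bound -/

theorem exp_le_taylor (u : ℝ) : Real.exp u ≤ 1 + u + u ^ 2 / 2 + |u| ^ 3 * Real.exp |u| := by
  have h := Complex.norm_exp_sub_sum_le_norm_mul_exp (u : ℂ) 3
  have e : Complex.exp u - ∑ m ∈ Finset.range 3, (u : ℂ) ^ m / (m.factorial : ℂ) =
      ((Real.exp u - (1 + u + u ^ 2 / 2) : ℝ) : ℂ) := by
    simp [Finset.sum_range_succ, Nat.factorial]
  rw [e, Complex.norm_real, Complex.norm_real, Real.norm_eq_abs, Real.norm_eq_abs] at h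
  linarith [le_abs_self (Real.exp u - (1 + u + u ^ 2 / 2))]

theorem cube_mul_exp_neg_le {c x : ℝ} (hc : 0 < c) (hx : 0 ≤ x) :
    x ^ 3 * Real.exp (-(c * x)) ≤ 6 / c ^ 3 := by
  have h := Real.pow_div_factorial_le_exp (c * x) (by positivity) 3
  rw [Real.exp_neg, ← div_eq_mul_inv, div_le_div_iff₀ (Real.exp_pos _) (by positivity)]
  have e : ((Nat.factorial 3 : ℕ) : ℝ) = 6 := by norm_num [Nat.factorial]
  rw [e, div_le_iff₀ (by norm_num)] at h
  nlinarith

/-- The choice of the parameter in the exponential inequality. -/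
theorem exists_exponent {s ρ : ℝ} (hs : 0 < s) (hsρ : s < ρ) :
    ∃ ε C δ μ₀ : ℝ, 0 < ε ∧ ε ≤ 1 ∧ 0 < C ∧ 0 < δ ∧ 0 < μ₀ ∧
      ∀ Λ μ β : ℝ, 0 < Λ → μ ≤ μ₀ → 0 ≤ β → β ≤ 1 →
        ∃ τ, 0 ≤ τ ∧ Real.exp (-(ρ * τ) + (τ * μ + τ ^ 2 * s ^ 2 / (4 * Λ) +
          τ ^ 3 * Real.exp (ε * τ) * β)) ≤ C * (β + Real.exp (-((1 + δ) * Λ))) := by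
  have hρ : 0 < ρ := hs.trans hsρ
  -- The quadratic `-ρ τ + τ² s² / (4 Λ)` is minimal at `τ = 2 a Λ`, with value `-ρ a Λ = -(1 + 2 δ)
  -- Λ`. One `δ Λ` is given away to the mean term.
  set a := ρ / s ^ 2 with ha
  have ha0 : 0 < a := by positivity
  set δ := (ρ * a - 1) / 2 with hδ
  have hδ0 : 0 < δ := by
    have : 1 < ρ * a := by
      rw [ha, ← mul_div_assoc, one_lt_div (by positivity)]; nlinarith
    linarith
  -- The bound by `1 / (6 a)` keeps the quadratic term small in the second case below, and the bound
  -- by `ρ / 4` lets `exp (ε τ)` use at most half of the exponent there.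
  set ε := min 1 (min (1 / (6 * a)) (ρ / 4)) with hε
  have hε0 : 0 < ε := lt_min one_pos (lt_min (by positivity) (by positivity))
  have hεa : 3 * a * ε ≤ 1 / 2 := by
    have : ε ≤ 1 / (6 * a) := (min_le_right _ _).trans (min_le_left _ _)
    calc 3 * a * ε ≤ 3 * a * (1 / (6 * a)) := by gcongr
      _ = 1 / 2 := by field_simp; norm_num
  have hερ : ε ≤ ρ / 4 := (min_le_right _ _).trans (min_le_right _ _)
  set μ₀ := min (δ / (2 * a)) (ρ / 4) with hμ₀
  refine ⟨ε, max (Real.exp (48 / ε ^ 3)) (Real.exp (384 / ρ ^ 3)), δ, μ₀, hε0, min_le_left _ _,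
    lt_max_of_lt_left (Real.exp_pos _), hδ0, lt_min (by positivity) (by positivity), ?_⟩
  intro Λ μ β hΛ hμ hβ0 hβ1
  have hC0 : 0 < max (Real.exp (48 / ε ^ 3)) (Real.exp (384 / ρ ^ 3)) :=
    lt_max_of_lt_left (Real.exp_pos _)
  -- If the third moment is this small, the optimal `τ` is affordable: `exp (ε τ) = exp (2 a ε Λ)`
  -- is beaten by `β`, and the cubic term is bounded by a constant.
  by_cases hβ : β ≤ Real.exp (-(3 * a * ε * Λ))
  · refine ⟨2 * a * Λ, by positivity, ?_⟩
    have h3 : (2 * a * Λ) ^ 3 * Real.exp (ε * (2 * a * Λ)) * β ≤ 48 / ε ^ 3 := by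
      calc _ ≤ (2 * a * Λ) ^ 3 * Real.exp (ε * (2 * a * Λ)) * Real.exp (-(3 * a * ε * Λ)) := by
            gcongr
        _ = 8 * a ^ 3 * (Λ ^ 3 * Real.exp (-(a * ε * Λ))) := by
            rw [mul_assoc, ← Real.exp_add, show ε * (2 * a * Λ) + -(3 * a * ε * Λ) =
              -(a * ε * Λ) by ring]; ring
        _ ≤ 8 * a ^ 3 * (6 / (a * ε) ^ 3) := by
            gcongr; exact cube_mul_exp_neg_le (by positivity) hΛ.le
        _ = 48 / ε ^ 3 := by field_simp; norm_num
    have h2 : (2 * a * Λ) ^ 2 * s ^ 2 / (4 * Λ) = ρ * a * Λ := by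
      rw [ha]; field_simp; ring
    have h1 : 2 * a * Λ * μ ≤ δ * Λ := by
      have : μ ≤ δ / (2 * a) := hμ.trans (min_le_left _ _)
      calc 2 * a * Λ * μ ≤ 2 * a * Λ * (δ / (2 * a)) := by gcongr
        _ = δ * Λ := by field_simp
    have h4 : -(ρ * (2 * a * Λ)) + (2 * a * Λ * μ + (2 * a * Λ) ^ 2 * s ^ 2 / (4 * Λ) +
        (2 * a * Λ) ^ 3 * Real.exp (ε * (2 * a * Λ)) * β) ≤ 48 / ε ^ 3 + -((1 + δ) * Λ) := by
      rw [h2]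
      have : ρ * a = 1 + 2 * δ := by rw [hδ]; ring
      have h5 : ρ * (2 * a * Λ) = 2 * (ρ * a * Λ) := by ring
      rw [h5, this]
      linarith
    refine (Real.exp_le_exp.2 h4).trans ?_
    rw [Real.exp_add]
    refine mul_le_mul (le_max_left _ _) (by linarith) (Real.exp_pos _).le hC0.le
  · push Not at hβ
    have hβp : 0 < β := (Real.exp_pos _).trans hβ
    -- If the third moment is not that small, the aim is the weaker bound `C β`, reached with `τ = 2
    -- l / ρ`: the linear gain is `2 l`, while the mean and quadratic terms cost at most `l / 2`
    -- each.
    set l := -Real.log β with hl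
    have hl0 : 0 ≤ l := by have := Real.log_nonpos hβ0 hβ1; linarith
    have hβl : β = Real.exp (-l) := by rw [hl, neg_neg, Real.exp_log hβp]
    have hlΛ : l ≤ 3 * a * ε * Λ := by
      have := (Real.lt_log_iff_exp_lt hβp).2 hβ
      linarith
    refine ⟨2 * l / ρ, by positivity, ?_⟩
    have h1 : 2 * l / ρ * μ ≤ l / 2 := by
      have : μ ≤ ρ / 4 := hμ.trans (min_le_right _ _)
      calc 2 * l / ρ * μ ≤ 2 * l / ρ * (ρ / 4) := by gcongr
        _ = l / 2 := by field_simp; ring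
    have h2 : (2 * l / ρ) ^ 2 * s ^ 2 / (4 * Λ) ≤ l / 2 := by
      have e : (2 * l / ρ) ^ 2 * s ^ 2 / (4 * Λ) = l * (l / Λ) * (s / ρ) ^ 2 := by
        field_simp; ring
      have e1 : l / Λ ≤ 1 / 2 := by
        rw [div_le_iff₀ hΛ]; nlinarith
      have e2 : (s / ρ) ^ 2 ≤ 1 := pow_le_one₀ (by positivity) ((div_le_one hρ).2 hsρ.le)
      rw [e]
      calc l * (l / Λ) * (s / ρ) ^ 2 ≤ l * (1 / 2) * 1 := by gcongr
        _ = l / 2 := by ring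
    have h3 : (2 * l / ρ) ^ 3 * Real.exp (ε * (2 * l / ρ)) * β ≤ 384 / ρ ^ 3 := by
      have e1 : ε * (2 * l / ρ) ≤ l / 2 := by
        calc ε * (2 * l / ρ) ≤ ρ / 4 * (2 * l / ρ) := by gcongr
          _ = l / 2 := by field_simp; ring
      calc _ ≤ (2 * l / ρ) ^ 3 * Real.exp (l / 2) * Real.exp (-l) := by
            rw [hβl]; gcongr
        _ = 8 / ρ ^ 3 * (l ^ 3 * Real.exp (-(1 / 2 * l))) := by
            rw [mul_assoc, ← Real.exp_add, show l / 2 + -l = -(1 / 2 * l) by ring]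
            field_simp; ring
        _ ≤ 8 / ρ ^ 3 * (6 / (1 / 2) ^ 3) := by
            gcongr; exact cube_mul_exp_neg_le (by norm_num) hl0
        _ = 384 / ρ ^ 3 := by field_simp; norm_num
    have h0 : ρ * (2 * l / ρ) = 2 * l := by field_simp
    have h4 : -(ρ * (2 * l / ρ)) + (2 * l / ρ * μ + (2 * l / ρ) ^ 2 * s ^ 2 / (4 * Λ) +
        (2 * l / ρ) ^ 3 * Real.exp (ε * (2 * l / ρ)) * β) ≤ 384 / ρ ^ 3 + -l := by
      rw [h0]; linarith
    refine (Real.exp_le_exp.2 h4).trans ?_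
    rw [Real.exp_add, ← hβl]
    exact mul_le_mul (le_max_right _ _) (by linarith [Real.exp_pos (-((1 + δ) * Λ))]) hβp.le hC0.le

namespace IsUpperExp
variable {L : (ℝ → ℝ) → ℝ} (hL : IsUpperExp L)
include hL

theorem iter_eq_of_noDep {n N : ℕ} (hnN : n ≤ N) {Φ : (ℕ → ℝ) → ℝ} (h : NoDepFrom n Φ) :
    iterExp L 0 N Φ = iterExp L 0 n Φ := by
  obtain ⟨k, rfl⟩ := Nat.exists_eq_add_of_le hnN
  rw [iterExp_add, zero_add, hL.iter_of_noDep h]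

/-- The maximal inequality for bounded summands in terms of the first three moments. -/
theorem iter_max_le_exp {f : ℝ → ℝ} {y m v T : ℝ} (hf : ∀ x, |f x| ≤ y) (hm0 : 0 ≤ m)
    (hm : L f ≤ m) (hv : L (fun x => f x ^ 2) ≤ v) (hT : L (fun x => |f x| ^ 3) ≤ T)
    {r t : ℝ} (hr : 0 ≤ r) (ht : 0 < t) (a n : ℕ) (x : ℕ → ℝ) :
    iterExp L a n (ind {x | ∃ m ≤ n, t ≤ coordSum f a m x}) x ≤
      Real.exp (-(r * t) + n * (r * m + r ^ 2 * v / 2 + r ^ 3 * Real.exp (r * y) * T)) := by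
  have hfb : IsBdd f := ⟨y, hf⟩
  have hv0 : 0 ≤ v := (hL.nonneg (hfb.pow 2) fun _ => sq_nonneg _).trans hv
  have hT0 : 0 ≤ T := (hL.nonneg (hfb.abs.pow 3) fun _ => by positivity).trans hT
  set q := r * m + r ^ 2 * v / 2 + r ^ 3 * Real.exp (r * y) * T with hq
  have hq0 : 0 ≤ q := by positivity
  have hM : L (fun y => Real.exp (r * f y)) ≤ 1 + q := by
    have b1 := hfb.const_mul r
    have b2 := (hfb.pow 2).const_mul (r ^ 2 / 2)
    have b3 := (hfb.abs.pow 3).const_mul (r ^ 3 * Real.exp (r * y))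
    have hpt : ∀ x, Real.exp (r * f x) ≤ r * f x + (r ^ 2 / 2 * f x ^ 2 +
        r ^ 3 * Real.exp (r * y) * |f x| ^ 3) + 1 := by
      intro x
      have h1 := exp_le_taylor (r * f x)
      have h2 : |r * f x| ≤ r * y := by
        rw [abs_mul, abs_of_nonneg hr]; exact mul_le_mul_of_nonneg_left (hf x) hr
      have h3 : |r * f x| ^ 3 * Real.exp |r * f x| ≤ |r * f x| ^ 3 * Real.exp (r * y) :=
        mul_le_mul_of_nonneg_left (Real.exp_le_exp.2 h2) (by positivity)
      rw [abs_mul, abs_of_nonneg hr, mul_pow] at h3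
      rw [abs_mul, abs_of_nonneg hr, mul_pow] at h1
      linarith
    refine (hL.mono _ _ b1.exp ((b1.add (b2.add b3)).add (IsBdd.const 1)) hpt).trans ?_
    rw [hL.add_const (b1.add (b2.add b3))]
    have h1 := hL.add_le _ _ b1 (b2.add b3)
    have h2 := hL.add_le _ _ b2 b3
    rw [hL.smul _ hfb _ hr] at h1
    rw [hL.smul _ (hfb.pow 2) _ (by positivity), hL.smul _ (hfb.abs.pow 3) _ (by positivity)] at h2
    have h3 := mul_le_mul_of_nonneg_left hm hr
    have h4 := mul_le_mul_of_nonneg_left hv (show 0 ≤ r ^ 2 / 2 by positivity)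
    have h5 := mul_le_mul_of_nonneg_left hT (show 0 ≤ r ^ 3 * Real.exp (r * y) by positivity)
    rw [hq]
    linarith
  refine (hL.iter_max_le hfb hr (by linarith) hM ht a n x).trans ?_
  rw [Real.exp_add]
  refine mul_le_mul_of_nonneg_left ?_ (Real.exp_pos _).le
  rw [Real.exp_nat_mul]
  exact pow_le_pow_left₀ (by linarith) (by linarith [Real.add_one_le_exp q]) n

/-- The event that a clipped sum differs from the sum. -/
theorem iter_ind_le_clip {y : ℝ} {n : ℕ} {a : ℕ} {A B : Set (ℕ → ℝ)}
    (h : ∀ x ∈ A, (∀ i < n, |x (a + i)| ≤ y) → x ∈ B) (x : ℕ → ℝ) :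
    iterExp L a n (ind A) x ≤ iterExp L a n (ind B) x + n * tail L y := by
  have h1 : ∀ x, ind A x ≤ ind B x + ind {x | ∃ i < n, x (a + i) ∈ {x : ℝ | y ≤ |x|}} x := by
    intro x
    refine ind_le (add_nonneg (ind_nonneg _ _) (ind_nonneg _ _)) fun hx => ?_
    by_cases hj : ∃ i < n, x (a + i) ∈ {x : ℝ | y ≤ |x|}
    · rw [ind_of_mem (A := {x : ℕ → ℝ | ∃ i < n, x (a + i) ∈ {x : ℝ | y ≤ |x|}}) hj]
      linarith [ind_nonneg B x]
    · push Not at hj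
      rw [ind_of_mem (h x hx fun i hi => (not_le.1 (hj i hi)).le)]
      linarith [ind_nonneg {x : ℕ → ℝ | ∃ i < n, x (a + i) ∈ {x : ℝ | y ≤ |x|}} x]
  refine (hL.iter_mono (isBdd_ind _) ((isBdd_ind _).add (isBdd_ind _)) h1 a n x).trans ?_
  refine (hL.iter_add_le (isBdd_ind _) (isBdd_ind _) a n x).trans ?_
  exact add_le_add le_rfl (hL.iter_exists_le _ a n x)

/-- Raising the truncation level costs at most the error at `y`, uniformly in the new level, and the
means at high levels tend to zero. -/
theorem mean_le_truncErr (ha : Summable (dyadicTail L)) {s : ℝ} (hs : |s| = 1)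
    (hmean : Tendsto (fun c => L (fun x => s * clip c x)) atTop (𝓝 0)) {y : ℝ} (hy : 1 ≤ y) :
    L (fun x => s * clip y x) ≤ truncErr L y := by
  have h : Tendsto (fun c => L (fun x => s * clip c x) + truncErr L y) atTop
      (𝓝 (0 + truncErr L y)) := hmean.add_const _
  rw [zero_add] at h
  refine ge_of_tendsto h ?_
  filter_upwards [eventually_ge_atTop y] with c hc using hL.clip_le_clip_add ha hy hc hs

theorem truncErr_nonneg (y : ℝ) : 0 ≤ truncErr L y :=
  tsum_nonneg fun j => by
    split_ifs
    exacts [mul_nonneg (by positivity) (hL.tail_nonneg _), le_rfl]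

omit hL in
theorem coordSum_eq_clip {y s : ℝ} {a n m : ℕ} {x : ℕ → ℝ} (hmn : m ≤ n)
    (h : ∀ i < n, |x (a + i)| ≤ y) :
    coordSum (fun x => s * clip y x) a m x = s * coordSum id a m x := by
  rw [coordSum, coordSum, Finset.mul_sum]
  refine Finset.sum_congr rfl fun i hi => ?_
  rw [clip_of_abs_le (h i ((Finset.mem_range.1 hi).trans_le hmn)), id]

/-- The upper bound for a block. -/
theorem eventually_iter_max_le (ha : Summable (dyadicTail L))
    (hmean : ∀ s : ℝ, |s| = 1 → Tendsto (fun c => L (fun x => s * clip c x)) atTop (𝓝 0))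
    {s ρ : ℝ} (hs : 0 < s) (hsρ : s < ρ)
    (hvar : ∀ y, 0 ≤ y → L (fun x => clip y x ^ 2) ≤ s ^ 2) :
    ∃ ε C δ : ℝ, 0 < ε ∧ ε ≤ 1 ∧ 0 < C ∧ 0 < δ ∧ ∀ᶠ n : ℕ in atTop, ∀ x,
      iterExp L 0 n (ind {x | ∃ m ≤ n, ρ * lilNorm n ≤ |coordSum id 0 m x|}) x ≤
        C * (thirdMoment L ε n + Real.exp (-((1 + δ) * llog n))) := by
  obtain ⟨ε, C, δ, μ₀, hε0, hε1, hC, hδ, hμ₀, hmain⟩ := exists_exponent hs hsρ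
  -- Each of the two signs contributes `C` from the exponential bound and `1 / ε ^ 3` from
  -- truncation; the extra `1` covers the trivial case of a normalized third moment above one.
  refine ⟨ε, 2 * (C + 1 / ε ^ 3) + 1, δ, hε0, hε1, by positivity, hδ, ?_⟩
  have hev := (hL.tendsto_mul_truncErr ha hε0 hε1).eventually_le_const hμ₀
  have hev2 := (tendsto_lilNorm.const_mul_atTop hε0).eventually_ge_atTop 1
  filter_upwards [hev, hev2, eventually_ge_atTop 1] with n hn1 hn2 hn x
  have hD := lilNorm_pos hn
  have hn0 : (0 : ℝ) < n := by exact_mod_cast hn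
  have hΛ := llog_pos n
  have hρ := hs.trans hsρ
  set D := lilNorm n
  set T := L fun x => |clip (ε * D) x| ^ 3 with hT
  set β := thirdMoment L ε n
  have hβ : β = n * T / D ^ 3 := rfl
  have hβ0 : 0 ≤ β := hL.thirdMoment_nonneg hε0 n
  have hE := Real.exp_pos (-((1 + δ) * llog n))
  have hone : iterExp L 0 n (ind {x | ∃ m ≤ n, ρ * D ≤ |coordSum id 0 m x|}) x ≤ 1 :=
    hL.iter_le_one (isBdd_ind _) (ind_le_one _) _ _ _
  rcases lt_or_ge 1 β with hβ1 | hβ1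
  · refine hone.trans ?_
    have : 0 ≤ (C + 1 / ε ^ 3) * (β + Real.exp (-((1 + δ) * llog n))) := by positivity
    nlinarith
  have hy0 : 0 ≤ ε * D := by positivity
  -- The event that some variable is truncated is charged to the third moment by Markov's
  -- inequality.
  have htail : n * tail L (ε * D) ≤ β / ε ^ 3 := by
    have h := hL.tail_le_div (y := ε * D) (by positivity) 3
    calc n * tail L (ε * D) ≤ n * (L (fun x => |clip (ε * D) x| ^ 3) / (ε * D) ^ 3) := by gcongr
      _ = β / ε ^ 3 := by rw [hβ, ← hT]; field_simp
  have hside : ∀ σ : ℝ, |σ| = 1 →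
      iterExp L 0 n (ind {x | ∃ m ≤ n, ρ * D ≤ σ * coordSum id 0 m x}) x ≤
        C * (β + Real.exp (-((1 + δ) * llog n))) + β / ε ^ 3 := by
    intro σ hσ
    have hfb : ∀ x, |σ * clip (ε * D) x| ≤ ε * D := fun x => by
      rw [abs_mul, hσ, one_mul]; exact abs_clip_le hy0 x
    obtain ⟨τ, hτ0, hτ⟩ := hmain (llog n) (n / D * truncErr L (ε * D)) β hΛ hn1 hβ0 hβ1
    have hσ2 : σ ^ 2 = 1 := by rw [← sq_abs, hσ, one_pow]
    have h1 := hL.iter_max_le_exp (f := fun x => σ * clip (ε * D) x) hfb (hL.truncErr_nonneg _)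
      (hL.mean_le_truncErr ha hσ (hmean σ hσ) hn2)
      (v := s ^ 2) (T := T)
      (by simpa only [mul_pow, hσ2, one_mul] using hvar _ hy0)
      (by simp only [abs_mul, hσ, one_mul]; exact le_rfl)
      (r := τ / D) (t := ρ * D) (by positivity) (by positivity) 0 n x
    have h2 := hL.iter_ind_le_clip (y := ε * D) (n := n) (a := 0)
      (A := {x | ∃ m ≤ n, ρ * D ≤ σ * coordSum id 0 m x})
      (B := {x | ∃ m ≤ n, ρ * D ≤ coordSum (fun x => σ * clip (ε * D) x) 0 m x})
      (fun x hx hi => by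
        obtain ⟨m, hm, hx⟩ := hx
        exact ⟨m, hm, by rwa [coordSum_eq_clip hm hi]⟩) x
    -- With `r = τ / D` and `D² = 2 n llog n` the exponent takes the normalized form treated in
    -- `exists_exponent`.
    have e : -(τ / D * (ρ * D)) + n * (τ / D * truncErr L (ε * D) + (τ / D) ^ 2 * s ^ 2 / 2 +
        (τ / D) ^ 3 * Real.exp (τ / D * (ε * D)) * T) =
        -(ρ * τ) + (τ * (n / D * truncErr L (ε * D)) + τ ^ 2 * s ^ 2 / (4 * llog n) +
          τ ^ 3 * Real.exp (ε * τ) * β) := by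
      have e1 : τ / D * (ε * D) = ε * τ := by field_simp
      have e2 : (n : ℝ) * ((τ / D) ^ 2 * s ^ 2 / 2) = τ ^ 2 * s ^ 2 / (4 * llog n) := by
        rw [div_pow, lilNorm_sq]; field_simp; norm_num
      have e3 : τ / D * (ρ * D) = ρ * τ := by field_simp
      rw [e1, e3, mul_add, mul_add, e2, hβ]
      field_simp
    rw [e] at h1
    linarith
  have hun : ∀ x, ind {x | ∃ m ≤ n, ρ * D ≤ |coordSum id 0 m x|} x ≤
      ind {x | ∃ m ≤ n, ρ * D ≤ 1 * coordSum id 0 m x} x +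
      ind {x | ∃ m ≤ n, ρ * D ≤ (-1) * coordSum id 0 m x} x := by
    intro x
    refine ind_le (add_nonneg (ind_nonneg _ _) (ind_nonneg _ _)) fun hx => ?_
    obtain ⟨m, hm, hx⟩ := hx
    rcases le_abs.1 hx with h | h
    · rw [ind_of_mem (show x ∈ {x | ∃ m ≤ n, ρ * D ≤ 1 * coordSum id 0 m x} from
        ⟨m, hm, by linarith⟩)]
      linarith [ind_nonneg {x | ∃ m ≤ n, ρ * D ≤ (-1) * coordSum id 0 m x} x]
    · rw [ind_of_mem (show x ∈ {x | ∃ m ≤ n, ρ * D ≤ (-1) * coordSum id 0 m x} from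
        ⟨m, hm, by linarith⟩)]
      linarith [ind_nonneg {x | ∃ m ≤ n, ρ * D ≤ 1 * coordSum id 0 m x} x]
  have h3 := (hL.iter_mono (isBdd_ind _) ((isBdd_ind _).add (isBdd_ind _)) hun 0 n x).trans
    (hL.iter_add_le (isBdd_ind _) (isBdd_ind _) 0 n x)
  have h4 := hside 1 (by simp)
  have h5 := hside (-1) (by simp)
  have h6 : β / ε ^ 3 ≤ 1 / ε ^ 3 * (β + Real.exp (-((1 + δ) * llog n))) := by
    rw [div_eq_mul_one_div, mul_comm]
    exact mul_le_mul_of_nonneg_left (by linarith) (by positivity)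
  linarith

/-- The events covering the oscillations above the level `ρ`. -/
def _root_.blockEvent (ρ : ℝ) (R k : ℕ) : Set (ℕ → ℝ) :=
  {x | ∃ i ∈ Finset.Ico R (4 * R), ∃ m ≤ (i + 1) * 4 ^ k,
    ρ * lilNorm ((i + 1) * 4 ^ k) ≤ |coordSum id 0 m x|}

/-- For each fixed `i` the third moments along `(i + 1) 4 ^ k` are summable and the exponential part
is at most `k ^ (-(1 + δ))`. The union over `i` is finite. -/
theorem summable_blockEvent (ha : Summable (dyadicTail L))
    (hmean : ∀ s : ℝ, |s| = 1 → Tendsto (fun c => L (fun x => s * clip c x)) atTop (𝓝 0))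
    {s ρ : ℝ} (hs : 0 < s) (hsρ : s < ρ)
    (hvar : ∀ y, 0 ≤ y → L (fun x => clip y x ^ 2) ≤ s ^ 2) (R : ℕ) (x : ℕ → ℝ) :
    Summable fun k => iterExp L 0 (4 * R * 4 ^ k) (ind (blockEvent ρ R k)) x := by
  obtain ⟨ε, C, δ, hε0, hε1, hC, hδ, hev⟩ := hL.eventually_iter_max_le ha hmean hs hsρ hvar
  let A : ℕ → ℕ → Set (ℕ → ℝ) := fun n k => {x | ∃ m ≤ n, ρ * lilNorm n ≤ |coordSum id 0 m x|}
  have hb : Summable fun k : ℕ => ∑ i ∈ Finset.Ico R (4 * R),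
      C * (thirdMoment L ε ((i + 1) * 4 ^ k) + 1 / (k : ℝ) ^ (1 + δ)) := by
    refine summable_sum fun i _ => Summable.mul_left C (Summable.add ?_ ?_)
    · exact hL.summable_thirdMoment ha hε0 hε1 (by omega)
    · exact Real.summable_one_div_nat_rpow.2 (by linarith)
  refine Summable.of_norm_bounded_eventually_nat hb ?_
  have hev2 : ∀ᶠ k : ℕ in atTop, ∀ i ∈ Finset.Ico R (4 * R), ∀ x,
      iterExp L 0 ((i + 1) * 4 ^ k) (ind {x | ∃ m ≤ (i + 1) * 4 ^ k,
        ρ * lilNorm ((i + 1) * 4 ^ k) ≤ |coordSum id 0 m x|}) x ≤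
      C * (thirdMoment L ε ((i + 1) * 4 ^ k) +
        Real.exp (-((1 + δ) * llog ((i + 1) * 4 ^ k : ℕ)))) := by
    rw [Filter.eventually_all_finset]
    intro i _
    have ht : Tendsto (fun k : ℕ => (i + 1) * 4 ^ k) atTop atTop := by
      refine tendsto_atTop_mono (fun k => ?_) (tendsto_pow_atTop_atTop_of_one_lt
        (show 1 < 4 by norm_num))
      exact Nat.le_mul_of_pos_left _ (Nat.succ_pos i)
    exact ht.eventually hev
  filter_upwards [hev2, eventually_ge_atTop 1] with k hk hk1
  rw [Real.norm_eq_abs, abs_of_nonneg (hL.iter_nonneg (isBdd_ind _) (ind_nonneg _) _ _ _)]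
  have h1 : ∀ x, ind (blockEvent ρ R k) x ≤ ∑ i ∈ Finset.Ico R (4 * R),
      ind {x | ∃ m ≤ (i + 1) * 4 ^ k,
        ρ * lilNorm ((i + 1) * 4 ^ k) ≤ |coordSum id 0 m x|} x := by
    intro x
    refine ind_le (Finset.sum_nonneg fun i _ => ind_nonneg _ _) fun hx => ?_
    obtain ⟨i, hi, hx⟩ := hx
    rw [← ind_of_mem (A := {x | ∃ m ≤ (i + 1) * 4 ^ k,
      ρ * lilNorm ((i + 1) * 4 ^ k) ≤ |coordSum id 0 m x|}) hx]
    exact Finset.single_le_sum (f := fun i => ind {x | ∃ m ≤ (i + 1) * 4 ^ k,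
      ρ * lilNorm ((i + 1) * 4 ^ k) ≤ |coordSum id 0 m x|} x) (fun i _ => ind_nonneg _ _) hi
  refine (hL.iter_mono (isBdd_ind _) (IsBdd.sum _ fun i _ => isBdd_ind _) h1 _ _ _).trans ?_
  refine (hL.iter_sum_le _ (fun i _ => isBdd_ind _) _ _ _).trans ?_
  refine Finset.sum_le_sum fun i hi => ?_
  have hi' := Finset.mem_Ico.1 hi
  -- The event of index `i` looks at the first `(i + 1) 4 ^ k` coordinates only, so the remaining
  -- integrations are void.
  rw [hL.iter_eq_of_noDep (n := (i + 1) * 4 ^ k) (Nat.mul_le_mul_right _ (by omega))]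
  · refine (hk i hi x).trans (mul_le_mul_of_nonneg_left (add_le_add le_rfl ?_) hC.le)
    exact exp_neg_llog_le hk1 (Nat.le_mul_of_pos_left _ (Nat.succ_pos i)) (by linarith)
  · refine noDepFrom_ind fun x z hxz hx => ?_
    obtain ⟨m, hm, hx⟩ := hx
    exact ⟨m, hm, by rwa [← coordSum_congr id 0 m fun i hi => hxz i (by omega)]⟩

end IsUpperExp

/-- Every such `m` lies between `i 4 ^ k` and `(i + 1) 4 ^ k` for some `R ≤ i < 4 R`. Then the right
end is at most `(1 + 1/R) m`, and so is the loss in the norming constant. The bound `k ≤ m` keeps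
unions finite when `m` is bounded. -/
theorem mem_blockEvent {ρ ρ' : ℝ} {R : ℕ} (hR : 1 ≤ R) (hρ : 0 ≤ ρ)
    (hρ' : ρ * (1 + 1 / R) ≤ ρ') {x : ℕ → ℝ} {m : ℕ} (hx : ρ' * lilNorm m ≤ |coordSum id 0 m x|)
    {k₀ : ℕ} (hm : R * 4 ^ k₀ ≤ m) :
    ∃ k, k₀ ≤ k ∧ k ≤ m ∧ x ∈ blockEvent ρ R k := by
  have hR0 : (0 : ℝ) < R := by exact_mod_cast hR
  have hm1 : 1 ≤ m / R := by
    rw [Nat.le_div_iff_mul_le (by omega)]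
    have : 1 ≤ 4 ^ k₀ := Nat.one_le_pow _ _ (by norm_num)
    nlinarith
  set k := Nat.log 4 (m / R) with hk
  have h1 : 4 ^ k ≤ m / R := Nat.pow_log_le_self 4 (by omega)
  have h2 : m / R < 4 ^ (k + 1) := Nat.lt_pow_succ_log_self (by norm_num) _
  rw [Nat.le_div_iff_mul_le (by omega)] at h1
  rw [Nat.div_lt_iff_lt_mul (by omega)] at h2
  have hpos : 0 < 4 ^ k := by positivity
  set i := m / 4 ^ k with hi
  have hi1 : R ≤ i := by rw [hi, Nat.le_div_iff_mul_le hpos]; linarith [mul_comm R (4 ^ k)]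
  have hi2 : i < 4 * R := by
    rw [hi, Nat.div_lt_iff_lt_mul hpos]; rw [pow_succ] at h2; linarith [mul_comm R (4 ^ k)]
  have hi3 : i * 4 ^ k ≤ m := Nat.div_mul_le_self m _
  have hi4 : m < (i + 1) * 4 ^ k := by
    have := Nat.lt_div_mul_add (a := m) hpos
    rw [add_mul, one_mul]; exact this
  refine ⟨k, ?_, ?_, i, Finset.mem_Ico.2 ⟨hi1, hi2⟩, m, hi4.le, ?_⟩
  · rw [hk]
    refine Nat.le_log_of_pow_le (by norm_num) ?_
    rw [Nat.le_div_iff_mul_le (by omega)]; linarith [mul_comm R (4 ^ k₀)]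
  · have : k < 4 ^ k := Nat.lt_pow_self (by norm_num)
    nlinarith
  · refine le_trans ?_ hx
    have h5 : lilNorm ((i + 1) * 4 ^ k) ≤ (1 + 1 / R) * lilNorm m := by
      refine lilNorm_le_mul (by have : (0 : ℝ) < 1 / R := by positivity
                                linarith) ?_
      have h6 : ((i : ℝ) * 4 ^ k) ≤ m := by exact_mod_cast hi3
      have h7 : (R : ℝ) ≤ i := by exact_mod_cast hi1
      have h8 : (4 : ℝ) ^ k ≤ 1 / R * (i * 4 ^ k) := by
        rw [one_div, inv_mul_eq_div, le_div_iff₀ hR0, mul_comm]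
        exact mul_le_mul_of_nonneg_right h7 (by positivity)
      have h9 : (1 / (R : ℝ)) * (i * 4 ^ k) ≤ 1 / R * m :=
        mul_le_mul_of_nonneg_left h6 (by positivity)
      push_cast
      linarith
    calc ρ * lilNorm ((i + 1) * 4 ^ k) ≤ ρ * ((1 + 1 / R) * lilNorm m) :=
          mul_le_mul_of_nonneg_left h5 hρ
      _ = ρ * (1 + 1 / R) * lilNorm m := by ring
      _ ≤ ρ' * lilNorm m := mul_le_mul_of_nonneg_right hρ' (lilNorm_nonneg m)

/-! ### The lower bound -/

theorem abs_log_one_add_le {u : ℝ} (hu : |u| ≤ 1 / 2) : |Real.log (1 + u)| ≤ 2 * |u| := by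
  have h := abs_le.1 hu
  have h0 : 0 < 1 + u := by linarith
  rw [abs_le]
  constructor
  · have h1 := Real.one_sub_inv_le_log_of_pos h0
    have h2 : 1 - (1 + u)⁻¹ = u / (1 + u) := by field_simp; ring
    rw [h2] at h1
    refine le_trans ?_ h1
    rw [le_div_iff₀ h0]
    nlinarith [neg_abs_le u, abs_nonneg u]
  · have := Real.log_le_sub_one_of_pos h0
    linarith [le_abs_self u, abs_nonneg u]

/-- The expansion of relative entropy for the density `1 + u`: after integration a centered `u`
leaves half its second moment and a cubic error. -/
theorem mul_log_one_add_le {u : ℝ} (hu : |u| ≤ 1 / 2) :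
    (1 + u) * Real.log (1 + u) ≤ u + u ^ 2 / 2 + 4 * |u| ^ 3 := by
  have h := abs_le.1 hu
  have h0 : 0 < 1 + u := by linarith
  have h1 := Real.abs_log_sub_add_sum_range_le (x := -u) (by rw [abs_neg]; linarith) 2
  simp only [Finset.sum_range_succ, Finset.sum_range_zero, abs_neg, sub_neg_eq_add] at h1
  norm_num at h1
  have h2 : |u| ^ 3 / (1 - |u|) ≤ 2 * |u| ^ 3 := by
    rw [div_le_iff₀ (by linarith)]
    nlinarith [pow_nonneg (abs_nonneg u) 3]
  have h3 : Real.log (1 + u) ≤ u - u ^ 2 / 2 + 2 * |u| ^ 3 := by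
    have := (abs_le.1 h1).2
    linarith
  have h4 : -u ^ 3 ≤ |u| ^ 3 := by rw [← abs_pow]; exact neg_le_abs _
  have h5 : u * |u| ^ 3 ≤ 1 / 2 * |u| ^ 3 :=
    mul_le_mul_of_nonneg_right h.2 (by positivity)
  calc (1 + u) * Real.log (1 + u) ≤ (1 + u) * (u - u ^ 2 / 2 + 2 * |u| ^ 3) :=
        mul_le_mul_of_nonneg_left h3 h0.le
    _ = u + u ^ 2 / 2 + (-u ^ 3 / 2 + 2 * |u| ^ 3 + 2 * (u * |u| ^ 3)) := by ring
    _ ≤ _ := by linarith [pow_nonneg (abs_nonneg u) 3]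

theorem tendsto_lilNorm_div : Tendsto (fun n : ℕ => lilNorm n / n) atTop (𝓝 0) := by
  have h1 : Tendsto (fun x : ℝ => Real.log x / x) atTop (𝓝 0) :=
    Real.isLittleO_log_id_atTop.tendsto_div_nhds_zero
  have h2 : Tendsto (fun x : ℝ => llog x / x) atTop (𝓝 0) := by
    refine squeeze_zero' ?_ ?_ h1
    · filter_upwards [eventually_gt_atTop 0] with x hx using div_nonneg (llog_pos x).le hx.le
    · filter_upwards [eventually_ge_atTop (Real.exp 1)] with x hx
      have hx0 := (Real.exp_pos 1).trans_le hx
      refine div_le_div_of_nonneg_right ?_ hx0.le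
      refine (lg_le_self (one_le_lg x)).trans_eq ?_
      rw [lg, max_eq_right hx]
  have h3 : Tendsto (fun n : ℕ => Real.sqrt (2 * (llog n / n))) atTop (𝓝 0) := by
    have := ((h2.comp tendsto_natCast_atTop_atTop).const_mul 2).sqrt
    simpa using this
  refine h3.congr' ?_
  filter_upwards [eventually_ge_atTop 1] with n hn
  have hn0 : (0 : ℝ) < n := by exact_mod_cast hn
  rw [show (2 : ℝ) * (llog n / n) = (lilNorm n / n) ^ 2 by rw [div_pow, lilNorm_sq]; field_simp]
  exact Real.sqrt_sq (div_nonneg (lilNorm_nonneg n) hn0.le)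

namespace IsUpperExp
variable {L : (ℝ → ℝ) → ℝ} (hL : IsUpperExp L)
include hL

set_option maxHeartbeats 1000000 in
/-- The lower bound of the probability that a block sum is large. -/
theorem eventually_block_ge (ha : Summable (dyadicTail L))
    (hmean : ∀ s : ℝ, |s| = 1 → Tendsto (fun c => L (fun x => s * clip c x)) atTop (𝓝 0))
    {b K t : ℝ} (hb : 0 < b) (hK : 0 < K) (hKS : K ^ 2 < L (fun x => clip b x ^ 2)) (ht : t < K) :
    ∃ δ θ : ℝ, 0 < δ ∧ δ < 1 ∧ 0 < θ ∧ ∀ᶠ n : ℕ in atTop, ∀ r ≤ n, (1 - θ) * n ≤ r → ∀ a x,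
      Real.exp (-((1 - δ) * llog n)) / 2 ≤
        iterExp L a r (ind {x | t * lilNorm n ≤ coordSum id a r x}) x := by
  have hcb := isBdd_clip hb.le
  -- A change of measure needs linearity. A functional below `L` that attains the truncated second
  -- moment suffices, because lower bounds for `l` are lower bounds for `L`.
  obtain ⟨l, hl, hlL, hlS⟩ := hL.exists_linear (hcb.pow 2)
  set S := L (fun x => clip b x ^ 2) with hSdef
  have hS : 0 < S := (sq_nonneg K).trans_lt hKS
  -- Of the four shares of `K - t`, one pays for the shortened block, one for the truncation bias
  -- and one for the fluctuation of the sum; one is spare.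
  set g := (K - t) / 4 with hg
  have hg0 : 0 < g := by linarith
  -- The entropy rate is `K² / S = 1 - 4 δ₁`. One `δ₁` covers its cubic error and one the
  -- fluctuation of the log-density, leaving the threshold `(1 - 2 δ₁) Λ`.
  set δ₁ := (1 - K ^ 2 / S) / 4 with hδ₁
  have hKS1 : K ^ 2 / S < 1 := (div_lt_one hS).2 hKS
  have hKS0 : 0 < K ^ 2 / S := by positivity
  have hδ₁0 : 0 < δ₁ := by linarith
  refine ⟨2 * δ₁, g / K, by linarith, by linarith, by positivity, ?_⟩
  set mb := l (clip b) with hmb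
  have hmbb : |mb| ≤ b := hl.abs_le (abs_clip_le hb.le)
  have ev1 : ∀ᶠ n : ℕ in atTop, K / S * b * (lilNorm n / n) ≤ 1 / 4 :=
    ((tendsto_lilNorm_div.const_mul (K / S * b)).eventually_le_const
      (by rw [mul_zero]; norm_num))
  have ev2 : ∀ᶠ n : ℕ in atTop, 64 * b ^ 3 * (K / S) ^ 3 * (lilNorm n / n) ≤ δ₁ :=
    ((tendsto_lilNorm_div.const_mul (64 * b ^ 3 * (K / S) ^ 3)).eventually_le_const
      (by rwa [mul_zero]))
  have ev3 : ∀ᶠ n : ℕ in atTop, 2 * (n / lilNorm n * truncErr L (1 * lilNorm n)) ≤ g :=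
    (((hL.tendsto_mul_truncErr ha one_pos le_rfl).const_mul 2).eventually_le_const
      (by rwa [mul_zero]))
  have ev4 : ∀ᶠ n : ℕ in atTop,
      9 / (4 * g ^ 2) * (L (fun x => clip (lilNorm n) x ^ 2) / llog n) ≤ 1 / 8 :=
    ((hL.tendsto_clip_sq ha).const_mul _).eventually_le_const (by rw [mul_zero]; norm_num)
  have ev5 : ∀ᶠ n : ℕ in atTop, 3 / 2 * (n * tail L (lilNorm n)) ≤ 1 / 8 :=
    ((hL.tendsto_mul_tail ha).const_mul _).eventually_le_const (by rw [mul_zero]; norm_num)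
  have ev6 : ∀ᶠ n : ℕ in atTop, 96 * (b * (K / S)) ^ 2 / δ₁ ^ 2 * (llog (n : ℝ))⁻¹ ≤ 1 / 8 :=
    (tendsto_llog_nat.inv_tendsto_atTop.const_mul _).eventually_le_const
      (by rw [mul_zero]; norm_num)
  filter_upwards [ev1, ev2, ev3, ev4, ev5, ev6, eventually_ge_atTop 1,
    tendsto_lilNorm.eventually_ge_atTop b] with n h1 h2 h3 h4 h5 h6 hn hbD r hrn hr a x
  have hn0 : (0 : ℝ) < n := by exact_mod_cast hn
  have hrn' : (r : ℝ) ≤ n := by exact_mod_cast hrn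
  have hr0 : (0 : ℝ) ≤ r := r.cast_nonneg
  have hD := lilNorm_pos hn
  have hD1 := one_le_lilNorm hn
  have hΛ := llog_pos n
  have hDsq := lilNorm_sq n
  set D := lilNorm n
  set Λ := llog (n : ℝ)
  -- Chosen so that the drift `n η S` of the tilted sum is `K D`; then `n η²` is of order `Λ` and
  -- `η` tends to zero.
  set η := K * D / (n * S) with hη
  have hη0 : 0 < η := by positivity
  have hηb : η * b ≤ 1 / 4 := by
    have : η * b = K / S * b * (D / n) := by rw [hη]; field_simp
    rw [this]; exact h1
  have hηS : n * η * S = K * D := by rw [hη]; field_simp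
  have hη2 : n * η ^ 2 = 2 * (K / S) ^ 2 * Λ := by
    have : n * η ^ 2 = (K / S) ^ 2 * D ^ 2 / n := by rw [hη]; field_simp
    rw [this, hDsq]; field_simp
  -- the density
  set u : ℝ → ℝ := fun x => η * (clip b x - mb) with hu
  have hub : ∀ x, |u x| ≤ 2 * (η * b) := fun x => by
    simp only [hu]
    rw [abs_mul, abs_of_pos hη0]
    have := abs_sub (clip b x) mb
    have h7 : |clip b x - mb| ≤ 2 * b := by linarith [abs_clip_le hb.le x]
    calc η * |clip b x - mb| ≤ η * (2 * b) := mul_le_mul_of_nonneg_left h7 hη0.le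
      _ = _ := by ring
  have hu2 : ∀ x, |u x| ≤ 1 / 2 := fun x => (hub x).trans (by linarith)
  have hubd : IsBdd u := ⟨_, hub⟩
  have hlu : l u = 0 := by
    simp only [hu]
    rw [hl.mul_eq (hcb.sub (IsBdd.const mb)), hl.sub_eq hcb (IsBdd.const mb), hl.const, ← hmb,
      sub_self, mul_zero]
  have hlu2 : l (fun x => u x ^ 2) ≤ η ^ 2 * S := by
    have e : (fun x => u x ^ 2) =
        fun x => η ^ 2 * (clip b x ^ 2 - (2 * mb * clip b x - mb ^ 2)) := by
      funext x; simp only [hu]; ring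
    have b1 : IsBdd fun x => 2 * mb * clip b x - mb ^ 2 :=
      (hcb.const_mul _).sub (IsBdd.const _)
    rw [e, hl.mul_eq ((hcb.pow 2).sub b1), hl.sub_eq (hcb.pow 2) b1,
      hl.sub_eq (hcb.const_mul _) (IsBdd.const _), hl.const, hl.mul_eq hcb, hlS, ← hmb]
    exact mul_le_mul_of_nonneg_left (by nlinarith [sq_nonneg mb]) (by positivity)
  set w : ℝ → ℝ := fun x => 1 + u x with hw
  have hwb : IsBdd w := (IsBdd.const 1).add hubd
  have hw0 : ∀ x, 0 < w x := fun x => by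
    have := (_root_.abs_le.1 (hu2 x)).1; simp only [hw]; linarith
  have hw32 : ∀ x, w x ≤ 3 / 2 := fun x => by
    have := (_root_.abs_le.1 (hu2 x)).2; simp only [hw]; linarith
  have hw1 : l w = 1 := by
    simp only [hw]
    rw [hl.add_eq _ _ (IsBdd.const 1) hubd, hl.const, hlu, add_zero]
  have hQ := hl.tilt hwb (fun x => (hw0 x).le) hw1
  have htl := hl.iter_tilt_ge hwb hw0 hw1 {x | t * D ≤ coordSum id a r x}
    ((1 - 2 * δ₁) * Λ) a r x
  set Q : (ℝ → ℝ) → ℝ := fun φ => l fun x => w x * φ x with hQdef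
  -- The density is at most `3/2`, so the tail and second moment estimates for `L` carry over to the
  -- tilted functional.
  have hQle : ∀ φ : ℝ → ℝ, IsBdd φ → (∀ x, 0 ≤ φ x) → Q φ ≤ 3 / 2 * L φ := by
    intro φ hφ hφ0
    have := hl.mono _ _ (hwb.mul hφ) (hφ.const_mul (3 / 2)) fun x =>
      mul_le_mul_of_nonneg_right (hw32 x) (hφ0 x)
    rw [hl.mul_eq hφ] at this
    have h7 := hlL φ hφ
    simp only [hQdef]
    linarith
  -- the sum under the new measure
  have hfb := isBdd_clip hD.le
  have hlf : |l (clip D)| ≤ truncErr L D := by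
    have e1 := hL.mean_le_truncErr ha (s := 1) (by simp) (hmean 1 (by simp)) hD1
    have e2 := hL.mean_le_truncErr ha (s := -1) (by simp) (hmean (-1) (by simp)) hD1
    have e3 := hlL _ (hfb.const_mul 1)
    have e4 := hlL _ (hfb.const_mul (-1))
    rw [hl.mul_eq hfb] at e3 e4
    exact _root_.abs_le.2 ⟨by linarith, by linarith⟩
  -- The gain in the mean is `η` times the product of the two truncations, which dominates the
  -- square of the lower one; the remaining part is the truncation bias.
  have hQf : η * S - 2 * truncErr L D ≤ Q (clip D) := by
    have e : (fun x => w x * clip D x) =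
        fun x => (1 - η * mb) * clip D x + η * (clip b x * clip D x) := by
      funext x; simp only [hw, hu]; ring
    have e1 : Q (clip D) = (1 - η * mb) * l (clip D) + η * l (fun x => clip b x * clip D x) := by
      simp only [hQdef]
      rw [e, hl.add_eq _ _ (hfb.const_mul _) ((hcb.mul hfb).const_mul _), hl.mul_eq hfb,
        hl.mul_eq (hcb.mul hfb)]
    have e2 : S ≤ l (fun x => clip b x * clip D x) := by
      rw [← hlS]
      exact hl.mono _ _ (hcb.pow 2) (hcb.mul hfb) (clip_sq_le_mul hb.le hbD)
    have e3 : |(1 - η * mb) * l (clip D)| ≤ 2 * truncErr L D := by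
      rw [abs_mul]
      refine mul_le_mul ?_ hlf (abs_nonneg _) (by norm_num)
      have e4 : |η * mb| ≤ 1 / 4 := by
        rw [abs_mul, abs_of_pos hη0]
        exact (mul_le_mul_of_nonneg_left hmbb hη0.le).trans hηb
      have := abs_sub 1 (η * mb)
      rw [abs_one] at this
      linarith
    have := (_root_.abs_le.1 e3).1
    rw [e1]
    linarith [mul_le_mul_of_nonneg_left e2 hη0.le]
  have hrQf : (t + g) * D ≤ r * Q (clip D) - g * D := by
    have e1 : n * truncErr L D ≤ g / 2 * D := by
      have : n / D * truncErr L (1 * D) * D = n * truncErr L D := by rw [one_mul]; field_simp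
      have := mul_le_mul_of_nonneg_right h3 hD.le
      linarith
    have e2 : r * truncErr L D ≤ n * truncErr L D :=
      mul_le_mul_of_nonneg_right hrn' (hL.truncErr_nonneg D)
    have e3 := mul_le_mul_of_nonneg_left hQf hr0
    have e4 : (1 - g / K) * (n * (η * S)) ≤ r * (η * S) := by
      have := mul_le_mul_of_nonneg_right hr (show 0 ≤ η * S by positivity)
      linarith
    have e5 : (1 - g / K) * (n * (η * S)) = (K - g) * D := by
      rw [← mul_assoc (n : ℝ), hηS]; field_simp
    have e6 : K = t + 4 * g := by rw [hg]; ring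
    rw [e5, e6] at e4
    linarith
  have hA : iterExp Q a r (ind {x | t * D ≤ coordSum id a r x}ᶜ) x ≤ 1 / 4 := by
    have e1 := hQ.iter_ind_le_clip (y := D) (n := r) (a := a)
      (A := {x | t * D ≤ coordSum id a r x}ᶜ)
      (B := {x | g * D ≤ |coordSum (clip D) a r x - r * Q (clip D)|})
      (fun x hx hi => by
        have hx' : coordSum id a r x < t * D := not_le.1 hx
        have := coordSum_eq_clip (s := 1) le_rfl hi
        simp only [one_mul] at this
        change g * D ≤ |coordSum (clip D) a r x - r * Q (clip D)|
        rw [show coordSum (clip D) a r x = coordSum id a r x from this, abs_sub_comm]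
        refine le_trans ?_ (le_abs_self _)
        linarith [mul_pos hg0 hD]) x
    have e2 := hQ.iter_cheb_centered hfb (hQle _ (hfb.pow 2) fun _ => sq_nonneg _)
      (show 0 < g * D by positivity) a r x
    have e3 : 3 * (r * (3 / 2 * L fun x => clip D x ^ 2)) / (g * D) ^ 2 ≤ 1 / 8 := by
      have hv0 : 0 ≤ L fun x => clip D x ^ 2 := hL.nonneg (hfb.pow 2) fun _ => sq_nonneg _
      refine le_trans ?_ h4
      calc _ ≤ 3 * (n * (3 / 2 * L fun x => clip D x ^ 2)) / (g * D) ^ 2 := by gcongr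
        _ = _ := by rw [mul_pow, hDsq]; field_simp; ring
    have e4 : r * tail Q D ≤ 1 / 8 := by
      refine le_trans ?_ h5
      have h7 : tail Q D ≤ 3 / 2 * tail L D := hQle _ (isBdd_ind _) (ind_nonneg _)
      calc r * tail Q D ≤ n * (3 / 2 * tail L D) :=
            mul_le_mul hrn' h7 (hQ.tail_nonneg D) hn0.le
        _ = _ := by ring
    linarith
  -- the density along the block
  have hlogb : ∀ x, |Real.log (w x)| ≤ 4 * (η * b) := fun x =>
    (abs_log_one_add_le (hu2 x)).trans (by linarith [hub x])
  have hlogbd : IsBdd fun x => Real.log (w x) := ⟨_, hlogb⟩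
  -- Since `u` is centered under `l`, the mean log-density is the quadratic entropy up to the cubic
  -- error.
  have hQh : Q (fun x => Real.log (w x)) ≤ η ^ 2 * S / 2 + 4 * (2 * (η * b)) ^ 3 := by
    have hpt : ∀ x, w x * Real.log (w x) ≤
        u x + (1 / 2 * u x ^ 2 + 4 * (2 * (η * b)) ^ 3) := by
      intro x
      have e1 := mul_log_one_add_le (hu2 x)
      have e2 := pow_le_pow_left₀ (abs_nonneg _) (hub x) 3
      simp only [hw]
      linarith
    have b1 := (hubd.pow 2).const_mul (1 / 2)
    have e1 := hl.mono _ _ (hwb.mul hlogbd) (hubd.add (b1.add (IsBdd.const _))) hpt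
    rw [hl.add_eq _ _ hubd (b1.add (IsBdd.const _)), hl.add_const b1, hl.mul_eq (hubd.pow 2),
      hlu] at e1
    simp only [hQdef]
    linarith
  have hrQh : r * Q (fun x => Real.log (w x)) ≤ (K ^ 2 / S + δ₁) * Λ := by
    have e0 : 0 ≤ η ^ 2 * S / 2 + 4 * (2 * (η * b)) ^ 3 := by positivity
    have e1 : n * (η ^ 2 * S / 2) = K ^ 2 / S * Λ := by
      have : n * (η ^ 2 * S / 2) = n * η ^ 2 * S / 2 := by ring
      rw [this, hη2]; field_simp
    have e2 : n * (4 * (2 * (η * b)) ^ 3) ≤ δ₁ * Λ := by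
      have e3 : n * (4 * (2 * (η * b)) ^ 3) = 32 * b ^ 3 * (n * η ^ 2) * η := by ring
      have e4 : 32 * b ^ 3 * (n * η ^ 2) * η = 64 * b ^ 3 * (K / S) ^ 3 * (D / n) * Λ := by
        rw [hη2, hη]; field_simp; norm_num
      rw [e3, e4]
      exact mul_le_mul_of_nonneg_right h2 hΛ.le
    calc r * Q (fun x => Real.log (w x)) ≤ r * (η ^ 2 * S / 2 + 4 * (2 * (η * b)) ^ 3) :=
          mul_le_mul_of_nonneg_left hQh hr0
      _ ≤ n * (η ^ 2 * S / 2 + 4 * (2 * (η * b)) ^ 3) := mul_le_mul_of_nonneg_right hrn' e0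
      _ ≤ _ := by linarith
  have hB : iterExp Q a r (ind {x | (1 - 2 * δ₁) * Λ ≤
      coordSum (fun y => Real.log (w y)) a r x}) x ≤ 1 / 8 := by
    have e0 : 0 < δ₁ * Λ := by positivity
    have e1 := hQ.iter_mono (isBdd_ind {x | (1 - 2 * δ₁) * Λ ≤
      coordSum (fun y => Real.log (w y)) a r x}) (isBdd_ind {x | δ₁ * Λ ≤
      |coordSum (fun y => Real.log (w y)) a r x - r * Q (fun x => Real.log (w x))|})
      (ind_mono fun x hx => by
        have hx' : (1 - 2 * δ₁) * Λ ≤ coordSum (fun y => Real.log (w y)) a r x := hx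
        change δ₁ * Λ ≤ |coordSum (fun y => Real.log (w y)) a r x -
          r * Q (fun x => Real.log (w x))|
        refine le_trans ?_ (le_abs_self _)
        have : K ^ 2 / S = 1 - 4 * δ₁ := by rw [hδ₁]; ring
        rw [this] at hrQh
        linarith) a r x
    have e2 := hQ.iter_cheb_centered hlogbd (v := (4 * (η * b)) ^ 2)
      (hQ.le_const (hlogbd.pow 2) fun x => by
        rw [← sq_abs]; exact pow_le_pow_left₀ (abs_nonneg _) (hlogb x) 2) e0 a r x
    refine e1.trans (e2.trans (le_trans ?_ h6))
    calc _ ≤ 3 * (n * (4 * (η * b)) ^ 2) / (δ₁ * Λ) ^ 2 := by gcongr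
      _ = 48 * b ^ 2 * (n * η ^ 2) / (δ₁ * Λ) ^ 2 := by ring
      _ = _ := by rw [hη2]; field_simp; norm_num
  -- The two exceptional events have tilted values at most `1/4` and `1/8`, which leaves more than
  -- the required half.
  refine le_trans ?_ (hL.iter_le_of_le hl.toIsUpperExp hlL (isBdd_ind _) a r x)
  refine le_trans ?_ htl
  rw [div_eq_mul_inv]
  exact mul_le_mul_of_nonneg_left (by norm_num; linarith) (Real.exp_pos _).le

end IsUpperExp

/-- The divergence half of Borel–Cantelli, from `1 - p ≤ exp (-p)`. -/
theorem tendsto_prod_one_sub {p : ℕ → ℝ} (h0 : ∀ k, 0 ≤ p k) (h1 : ∀ k, p k ≤ 1)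
    (hp : ¬ Summable p) (k₀ : ℕ) :
    Tendsto (fun K => ∏ k ∈ Finset.Ico k₀ K, (1 - p k)) atTop (𝓝 0) := by
  have ht := (not_summable_iff_tendsto_nat_atTop_of_nonneg h0).1 hp
  have ht2 : Tendsto (fun K => Real.exp (-(∑ k ∈ Finset.range K, p k -
      ∑ k ∈ Finset.range k₀, p k))) atTop (𝓝 0) :=
    Real.tendsto_exp_neg_atTop_nhds_zero.comp
      (tendsto_atTop_add_const_right _ (-∑ k ∈ Finset.range k₀, p k) ht)
  refine squeeze_zero' (Eventually.of_forall fun K =>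
    Finset.prod_nonneg fun k _ => sub_nonneg.2 (h1 k)) ?_ ht2
  filter_upwards [eventually_ge_atTop k₀] with K hK
  rw [← Finset.sum_Ico_eq_sub _ hK, ← Finset.sum_neg_distrib, Real.exp_sum]
  refine Finset.prod_le_prod (fun k _ => sub_nonneg.2 (h1 k)) fun k _ => ?_
  linarith [Real.add_one_le_exp (-p k)]

/-- The logarithm of `(j!)²` is at most `2 j log j`, hence eventually at most `j ^ (1 / (1 - δ))`.
So the success probabilities of blocks ending at `(j!)²` dominate a multiple of the harmonic series.
-/
theorem eventually_inv_le_exp_llog {δ : ℝ} (hδ : 0 < δ) (hδ1 : δ < 1) :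
    ∀ᶠ j : ℕ in atTop,
      1 / (j : ℝ) ≤ Real.exp (-((1 - δ) * llog (((j.factorial) ^ 2 : ℕ) : ℝ))) := by
  have hq : 0 < 1 - δ := by linarith
  have h1 := (isLittleO_log_rpow_atTop (show 0 < δ / (1 - δ) by positivity)).bound
    (show (0 : ℝ) < 1 / 2 by norm_num)
  have h2 := tendsto_natCast_atTop_atTop (R := ℝ) |>.eventually h1
  filter_upwards [h2, eventually_ge_atTop 3] with j hj hj3
  have hj3' : (3 : ℝ) ≤ j := by exact_mod_cast hj3
  have hj0 : (0 : ℝ) < j := by linarith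
  have he := Real.exp_one_lt_three
  have hlog1 : 1 ≤ Real.log j := (Real.le_log_iff_exp_le hj0).2 (by linarith)
  have hn : (((j.factorial) ^ 2 : ℕ) : ℝ) ≤ (j : ℝ) ^ (2 * j) := by
    have h : j.factorial ^ 2 ≤ (j ^ j) ^ 2 := Nat.pow_le_pow_left (Nat.factorial_le_pow j) 2
    rw [← pow_mul, mul_comm] at h
    exact_mod_cast h
  have h3 : lg (((j.factorial) ^ 2 : ℕ) : ℝ) ≤ 2 * j * Real.log j := by
    refine (lg_mono hn).trans_eq ?_
    have : Real.exp 1 ≤ (j : ℝ) ^ (2 * j) := by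
      have : (j : ℝ) ^ 1 ≤ (j : ℝ) ^ (2 * j) := pow_le_pow_right₀ (by linarith) (by omega)
      rw [pow_one] at this
      linarith
    rw [lg, max_eq_right this, Real.log_pow]
    push_cast; ring
  have h4 : 2 * j * Real.log j ≤ (j : ℝ) ^ (1 / (1 - δ)) := by
    have e : 1 / (1 - δ) = 1 + δ / (1 - δ) := by field_simp; ring
    rw [e, Real.rpow_add hj0, Real.rpow_one]
    rw [Real.norm_of_nonneg (by linarith), Real.norm_of_nonneg (by positivity)] at hj
    nlinarith
  have h5 : llog (((j.factorial) ^ 2 : ℕ) : ℝ) ≤ 1 / (1 - δ) * Real.log j := by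
    refine (lg_mono (h3.trans h4)).trans_eq ?_
    have : Real.exp 1 ≤ (j : ℝ) ^ (1 / (1 - δ)) := by nlinarith
    rw [lg, max_eq_right this, Real.log_rpow hj0]
  rw [one_div, ← Real.exp_log (inv_pos.2 hj0), Real.log_inv]
  refine Real.exp_le_exp.2 (neg_le_neg ?_)
  calc (1 - δ) * llog (((j.factorial) ^ 2 : ℕ) : ℝ) ≤ (1 - δ) * (1 / (1 - δ) * Real.log j) :=
        mul_le_mul_of_nonneg_left h5 hq.le
    _ = Real.log j := by field_simp

namespace IsUpperExp
variable {L : (ℝ → ℝ) → ℝ} (hL : IsUpperExp L)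
include hL

/-- Sums of few variables are small. -/
theorem eventually_iter_abs_le (ha : Summable (dyadicTail L))
    (hmean : ∀ s : ℝ, |s| = 1 → Tendsto (fun c => L (fun x => s * clip c x)) atTop (𝓝 0))
    {g κ : ℝ} (hg : 0 < g) (hκ : 0 < κ) :
    ∀ᶠ n : ℕ in atTop, ∀ r ≤ n, ∀ x,
      iterExp L 0 r (ind {x | g * lilNorm n ≤ |coordSum id 0 r x|}) x ≤ κ * (r / n) := by
  have hsq : (0 : ℝ) < κ * g ^ 2 / 9 := by positivity
  have ev1 := (hL.tendsto_clip_sq ha).eventually_le_const hsq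
  have ev2 := ((hL.tendsto_mul_truncErr ha one_pos le_rfl).pow 2).eventually_le_const
    (show (0 : ℝ) ^ 2 < κ * g ^ 2 / 9 by simpa using hsq)
  have ev3 := (hL.tendsto_mul_tail ha).eventually_le_const (show (0 : ℝ) < κ / 3 by positivity)
  filter_upwards [ev1, ev2, ev3, eventually_ge_atTop 1] with n h1 h2 h3 hn r hr x
  have hn0 : (0 : ℝ) < n := by exact_mod_cast hn
  have hr' : (r : ℝ) ≤ n := by exact_mod_cast hr
  have hr0 : (0 : ℝ) ≤ r := r.cast_nonneg
  have hrn : (r : ℝ) / n ≤ 1 := (div_le_one hn0).2 hr'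
  have hrn0 : 0 ≤ (r : ℝ) / n := by positivity
  have hD := lilNorm_pos hn
  have hΛ := llog_pos n
  have hDsq := lilNorm_sq n
  rw [one_mul] at h2
  set D := lilNorm n
  have hfb := isBdd_clip hD.le
  have e1 := hL.iter_ind_le_clip (y := D) (n := r) (a := 0)
    (A := {x | g * D ≤ |coordSum id 0 r x|}) (B := {x | g * D ≤ |coordSum (clip D) 0 r x|})
    (fun x hx hi => by
      have := coordSum_eq_clip (s := 1) le_rfl hi
      simp only [one_mul] at this
      change g * D ≤ |coordSum (clip D) 0 r x|
      rwa [show coordSum (clip D) 0 r x = coordSum id 0 r x from this]) x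
  have m1 := hL.mean_le_truncErr ha (s := 1) (by simp) (hmean 1 (by simp)) (one_le_lilNorm hn)
  have m2 := hL.mean_le_truncErr ha (s := -1) (by simp) (hmean (-1) (by simp)) (one_le_lilNorm hn)
  simp only [one_mul, neg_mul] at m1 m2
  have e2 := hL.iter_cheb hfb le_rfl m1 m2 (show 0 < g * D by positivity) 0 r x
  have e3 : r * tail L D ≤ κ / 3 * (r / n) := by
    calc r * tail L D = (n * tail L D) * (r / n) := by field_simp
      _ ≤ _ := mul_le_mul_of_nonneg_right h3 hrn0
  -- The variance part is linear in `r` and the bias part quadratic. Keeping the factor `r / n` is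
  -- what later makes the contributions of the past summable over the blocks.
  have e4 : 3 * (r * (L fun x => clip D x ^ 2) + r ^ 2 * truncErr L D ^ 2) / (g * D) ^ 2 =
      3 / (2 * g ^ 2) * ((L fun x => clip D x ^ 2) / llog n) * (r / n) +
      3 / g ^ 2 * (n / D * truncErr L D) ^ 2 * ((r / n) * (r / n)) := by
    rw [mul_add, add_div]
    congr 1
    · rw [mul_pow, hDsq]; field_simp
    · field_simp
  have e5 : 3 / (2 * g ^ 2) * ((L fun x => clip D x ^ 2) / llog n) ≤ κ / 3 := by
    calc _ ≤ 3 / (2 * g ^ 2) * (κ * g ^ 2 / 9) := mul_le_mul_of_nonneg_left h1 (by positivity)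
      _ = κ / 6 := by field_simp; norm_num
      _ ≤ κ / 3 := by linarith
  have e6 : 3 / g ^ 2 * (n / D * truncErr L D) ^ 2 ≤ κ / 3 := by
    calc _ ≤ 3 / g ^ 2 * (κ * g ^ 2 / 9) := mul_le_mul_of_nonneg_left h2 (by positivity)
      _ = κ / 3 := by field_simp; norm_num
  have e7 := mul_le_mul_of_nonneg_right e5 hrn0
  have e8 : 3 / g ^ 2 * (n / D * truncErr L D) ^ 2 * ((r / n) * (r / n)) ≤
      κ / 3 * (r / n * 1) :=
    mul_le_mul e6 (mul_le_mul_of_nonneg_left hrn hrn0) (by positivity) (by positivity)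
  rw [e4] at e2
  linarith

/-- The lower bound in the law of the iterated logarithm. -/
theorem exists_iter_ge (ha : Summable (dyadicTail L))
    (hmean : ∀ s : ℝ, |s| = 1 → Tendsto (fun c => L (fun x => s * clip c x)) atTop (𝓝 0))
    {b K t : ℝ} (hb : 0 < b) (hK : 0 < K) (hKS : K ^ 2 < L (fun x => clip b x ^ 2)) (ht : t < K)
    (n₀ : ℕ) {ε : ℝ} (hε : 0 < ε) (x : ℕ → ℝ) : ∃ N,
      1 - ε ≤ iterExp L 0 N
        (ind {x | ∃ m ∈ Finset.Icc n₀ N, t * lilNorm m ≤ coordSum id 0 m x}) x := by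
  -- The block has to reach `t'`, so that a past of size at most `(t' - t) d_n` still leaves `t`.
  obtain ⟨t', htt', ht'⟩ := exists_between ht
  obtain ⟨δ, θ, hδ, hδ1, hθ, hblock⟩ := hL.eventually_block_ge ha hmean hb hK hKS ht'
  have hpast := hL.eventually_iter_abs_le ha hmean (sub_pos.2 htt') one_pos
  -- Squares of factorials grow fast enough for `c k / c (k + 1) = (k + 1)⁻²` to be summable, and
  -- slowly enough for the success probabilities to have a divergent sum.
  let c : ℕ → ℕ := fun k => k.factorial ^ 2
  have hc : Monotone c := fun i j hij => Nat.pow_le_pow_left (Nat.factorial_le hij) 2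
  have hck : ∀ k, k ≤ c k := fun k =>
    (Nat.self_le_factorial k).trans (Nat.le_self_pow two_ne_zero _)
  have hct : Tendsto (fun k => c (k + 1)) atTop atTop :=
    tendsto_atTop_mono (fun k => (Nat.le_succ k).trans (hck (k + 1))) tendsto_id
  have hratio : ∀ k, ((c k : ℕ) : ℝ) / c (k + 1) = 1 / (((k + 1 : ℕ) : ℝ)) ^ 2 := fun k => by
    have h1 : ((k.factorial : ℕ) : ℝ) ≠ 0 := by exact_mod_cast k.factorial_ne_zero
    have h2 : (((k + 1 : ℕ) : ℝ)) ≠ 0 := by positivity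
    simp only [c, Nat.factorial_succ]
    rw [Nat.cast_pow, Nat.cast_pow, Nat.cast_mul]
    field_simp
  have hsum : Summable fun k : ℕ => 1 / (((k + 1 : ℕ) : ℝ)) ^ 2 :=
    (summable_nat_add_iff 1).2 (Real.summable_one_div_nat_pow.2 one_lt_two)
  have hsq0 : Tendsto (fun k : ℕ => 1 / (((k + 1 : ℕ) : ℝ)) ^ 2) atTop (𝓝 0) :=
    hsum.tendsto_atTop_zero
  let p : ℕ → ℝ := fun k => Real.exp (-((1 - δ) * llog ((c (k + 1) : ℕ) : ℝ))) / 2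
  have hp0 : ∀ k, 0 ≤ p k := fun k => by positivity
  have hp1 : ∀ k, p k ≤ 1 := fun k => by
    have : Real.exp (-((1 - δ) * llog ((c (k + 1) : ℕ) : ℝ))) ≤ 1 :=
      Real.exp_le_one_iff.2 (neg_nonpos.2 (mul_nonneg (by linarith) (llog_pos _).le))
    simp only [p]; linarith
  have hpns : ¬ Summable p := by
    intro h
    have h1 := ((tendsto_add_atTop_nat 1).eventually (eventually_inv_le_exp_llog hδ hδ1))
    have h2 : Summable fun k : ℕ => 1 / (((k + 1 : ℕ) : ℝ)) := by
      refine Summable.of_norm_bounded_eventually_nat (h.mul_left 2) ?_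
      filter_upwards [h1] with k hk
      rw [Real.norm_of_nonneg (by positivity)]
      simp only [p, c]
      linarith
    exact Real.not_summable_one_div_natCast
      ((summable_nat_add_iff (f := fun k : ℕ => 1 / (k : ℝ)) 1).1 h2)
  have evθ := hsq0.eventually_le_const hθ
  have htl : ∀ᶠ k₀ in atTop, ∑' k, 1 / (((k + k₀ + 1 : ℕ) : ℝ)) ^ 2 ≤ ε / 2 :=
    (tendsto_sum_nat_add fun k : ℕ => 1 / (((k + 1 : ℕ) : ℝ)) ^ 2).eventually_le_const
      (by positivity)
  obtain ⟨k₁, hk₁⟩ := eventually_atTop.1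
    ((hct.eventually hblock).and ((hct.eventually hpast).and evθ))
  obtain ⟨k₀, hk₀t, hk₀⟩ := (htl.and (eventually_ge_atTop (max k₁ n₀))).exists
  have hkk : ∀ k, k₀ ≤ k → k₁ ≤ k := fun k hk => (le_max_left _ _).trans (hk₀.trans hk)
  obtain ⟨M, hMprod, hM⟩ := (((tendsto_prod_one_sub hp0 hp1 hpns k₀).eventually_le_const
    (show (0 : ℝ) < ε / 2 by positivity)).and (eventually_ge_atTop k₀)).exists
  let G : ℕ → Set (ℕ → ℝ) := fun k =>
    {x | t' * lilNorm (c (k + 1)) ≤ coordSum id (c k) (c (k + 1) - c k) x}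
  let P : ℕ → Set (ℕ → ℝ) := fun k =>
    {x | (t' - t) * lilNorm (c (k + 1)) ≤ |coordSum id 0 (c k) x|}
  have hcc : ∀ k, c k + (c (k + 1) - c k) = c (k + 1) := fun k => by
    have : c k ≤ c (k + 1) := hc (Nat.le_succ k)
    omega
  have hbl := hL.iter_blocks hc (g := fun k => ind (G k)) (p := p)
    (fun k x => ind_nonneg _ x) (fun k x => ind_le_one _ x)
    (fun k => noDepFrom_ind (A := G k) fun x z hxz hx => by
      change t' * lilNorm (c (k + 1)) ≤ coordSum id (c k) (c (k + 1) - c k) z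
      rw [← coordSum_congr id (c k) (c (k + 1) - c k) fun i hi => hxz i (by rwa [hcc] at hi)]
      exact hx)
    (k₀ := k₀) hp1 (fun k hk x => by
      refine (hk₁ k (hkk k hk)).1 _ (Nat.sub_le _ _) ?_ _ _
      rw [Nat.cast_sub (hc (Nat.le_succ k))]
      have h1 := hratio k
      have h2 := (hk₁ k (hkk k hk)).2.2
      rw [← h1, div_le_iff₀ (by exact_mod_cast (by positivity : 0 < c (k + 1)))] at h2
      linarith) M hM x
  refine ⟨c M, ?_⟩
  set E : Set (ℕ → ℝ) := {x | ∃ m ∈ Finset.Icc n₀ (c M), t * lilNorm m ≤ coordSum id 0 m x}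
  -- A successful block either has a small past, and then the whole sum is large, or is counted
  -- among the bad pasts.
  have hpt : ∀ x, 1 - ∏ k ∈ Finset.Ico k₀ M, (1 - ind (G k) x) ≤
      ind E x + ∑ k ∈ Finset.Ico k₀ M, ind (P k) x := by
    intro x
    have hS0 : 0 ≤ ∑ k ∈ Finset.Ico k₀ M, ind (P k) x := Finset.sum_nonneg fun k _ => ind_nonneg _ _
    by_cases hG : ∃ k ∈ Finset.Ico k₀ M, x ∈ G k
    · obtain ⟨k, hk, hxG⟩ := hG
      have hprod : 0 ≤ ∏ k ∈ Finset.Ico k₀ M, (1 - ind (G k) x) :=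
        Finset.prod_nonneg fun k _ => sub_nonneg.2 (ind_le_one _ _)
      by_cases hP : x ∈ P k
      · have := Finset.single_le_sum (f := fun k => ind (P k) x) (fun k _ => ind_nonneg _ _) hk
        simp only [ind_of_mem hP] at this
        linarith [ind_nonneg E x]
      · have hxE : x ∈ E := by
          have hk' := Finset.mem_Ico.1 hk
          refine ⟨c (k + 1), Finset.mem_Icc.2 ⟨?_, hc hk'.2⟩, ?_⟩
          · exact (le_max_right k₁ n₀).trans (hk₀.trans (hk'.1.trans
              ((Nat.le_succ k).trans (hck _))))
          · have h1 : ¬ (t' - t) * lilNorm (c (k + 1)) ≤ |coordSum id 0 (c k) x| := hP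
            have h2 : t' * lilNorm (c (k + 1)) ≤ coordSum id (c k) (c (k + 1) - c k) x := hxG
            have h3 : coordSum id 0 (c (k + 1)) x =
                coordSum id 0 (c k) x + coordSum id (c k) (c (k + 1) - c k) x := by
              rw [← hcc k]
              simp only [coordSum, Finset.sum_range_add, zero_add]
              rw [hcc k]
            rw [h3]
            have h4 := neg_abs_le (coordSum id 0 (c k) x)
            linarith
        rw [ind_of_mem hxE]
        linarith
    · push Not at hG
      rw [Finset.prod_eq_one fun k hk => by rw [ind_of_notMem (hG k hk), sub_zero], sub_self]
      exact add_nonneg (ind_nonneg _ _) hS0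
  have hgb : IsBdd fun x => 1 - ∏ k ∈ Finset.Ico k₀ M, (1 - ind (G k) x) :=
    (IsBdd.const 1).sub (IsBdd.prod _ fun k _ => (IsBdd.const 1).sub (isBdd_ind _))
  have hPb : IsBdd fun x => ∑ k ∈ Finset.Ico k₀ M, ind (P k) x := IsBdd.sum _ fun k _ => isBdd_ind _
  have h1 := (hL.iter_mono hgb ((isBdd_ind E).add hPb) hpt 0 (c M) x).trans
    (hL.iter_add_le (isBdd_ind E) hPb 0 (c M) x)
  have h2 : iterExp L 0 (c M) (fun x => ∑ k ∈ Finset.Ico k₀ M, ind (P k) x) x ≤ ε / 2 := by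
    refine (hL.iter_sum_le _ (fun k _ => isBdd_ind _) _ _ _).trans ?_
    have h3 : ∀ k ∈ Finset.Ico k₀ M, iterExp L 0 (c M) (ind (P k)) x ≤
        1 / (((k + 1 : ℕ) : ℝ)) ^ 2 := by
      intro k hk
      have hk' := Finset.mem_Ico.1 hk
      rw [hL.iter_eq_of_noDep (n := c k) (hc hk'.2.le)]
      · have := (hk₁ k (hkk k hk'.1)).2.1 (c k) (hc (Nat.le_succ k)) x
        rwa [one_mul, hratio k] at this
      · exact noDepFrom_ind fun x z hxz hx => by
          change (t' - t) * lilNorm (c (k + 1)) ≤ |coordSum id 0 (c k) z|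
          rw [← coordSum_congr id 0 (c k) fun i hi => hxz i (by omega)]
          exact hx
    refine (Finset.sum_le_sum h3).trans (le_trans ?_ hk₀t)
    rw [Finset.sum_Ico_eq_sum_range]
    have hs2 : Summable fun k => 1 / (((k + k₀ + 1 : ℕ) : ℝ)) ^ 2 :=
      (summable_nat_add_iff (f := fun k : ℕ => 1 / (((k + 1 : ℕ) : ℝ)) ^ 2) k₀).2 hsum
    refine le_trans (le_of_eq ?_) (hs2.sum_le_tsum (Finset.range (M - k₀)) fun k _ => by positivity)
    exact Finset.sum_congr rfl fun k _ => by rw [add_comm k₀ k]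
  linarith

end IsUpperExp

/-! ### Perturbation of the partial sums -/

theorem abs_coordSum_sub_le {N m : ℕ} (hm : m ≤ N) {η : ℝ} (hη : 0 ≤ η) {x z : ℕ → ℝ}
    (h : ∀ i < N, |x i - z i| < η / (N + 1)) :
    |coordSum id 0 m x - coordSum id 0 m z| ≤ η := by
  have hN : (0 : ℝ) < N + 1 := by positivity
  rw [coordSum, coordSum, ← Finset.sum_sub_distrib]
  refine (Finset.abs_sum_le_sum_abs _ _).trans ?_
  have h1 : ∀ i ∈ Finset.range m, |id (x (0 + i)) - id (z (0 + i))| ≤ η / (N + 1) := fun i hi => by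
    rw [zero_add]
    exact (h i ((Finset.mem_range.1 hi).trans_le hm)).le
  refine (Finset.sum_le_card_nsmul _ _ _ h1).trans ?_
  rw [Finset.card_range, nsmul_eq_mul, ← mul_div_assoc, div_le_iff₀ hN]
  have : (m : ℝ) ≤ N := by exact_mod_cast hm
  nlinarith

/-- Perturbing each of `N` coordinates by less than `(ρ - ρ') / (N + 1)` moves a partial sum by at
most `ρ - ρ'`, and `d_m ≥ 1`. This supplies the margin in the capacity comparisons. -/
theorem mul_lilNorm_le_of_close {N m : ℕ} (hm : m ≤ N) {ρ ρ' : ℝ} (hρ : ρ' < ρ) {x z : ℕ → ℝ}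
    (h : ∀ i < N, |x i - z i| < (ρ - ρ') / (N + 1)) (hx : ρ * lilNorm m ≤ coordSum id 0 m x) :
    ρ' * lilNorm m ≤ coordSum id 0 m z := by
  rcases Nat.eq_zero_or_pos m with rfl | hm0
  · simp [coordSum, lilNorm]
  have h1 := (abs_le.1 (abs_coordSum_sub_le hm (sub_pos.2 hρ).le h)).2
  have h2 := one_le_lilNorm hm0
  nlinarith [mul_le_mul_of_nonneg_left h2 (sub_pos.2 hρ).le]

theorem mul_lilNorm_le_abs_of_close {N m n : ℕ} (hm : m ≤ N) (hn : 1 ≤ n) {ρ ρ' : ℝ} (hρ : ρ' < ρ)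
    {x z : ℕ → ℝ} (h : ∀ i < N, |x i - z i| < (ρ - ρ') / (N + 1))
    (hx : ρ * lilNorm n ≤ |coordSum id 0 m x|) : ρ' * lilNorm n ≤ |coordSum id 0 m z| := by
  have h1 := abs_coordSum_sub_le hm (sub_pos.2 hρ).le h
  have h2 := one_le_lilNorm hn
  have h3 := abs_sub_abs_le_abs_sub (coordSum id 0 m x) (coordSum id 0 m z)
  nlinarith [mul_le_mul_of_nonneg_left h2 (sub_pos.2 hρ).le]

/-! ### The moment condition -/

theorem llog_sq_le {t : ℝ} (ht : 0 ≤ t) : llog (t ^ 2) ≤ 2 * llog t := by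
  have he : 1 ≤ Real.exp 1 := Real.one_le_exp zero_le_one
  have h1 : lg (t ^ 2) ≤ 2 * lg t := by
    have h2 : max (Real.exp 1) (t ^ 2) ≤ max (Real.exp 1) t ^ 2 := by
      refine max_le ?_ (pow_le_pow_left₀ ht (le_max_right _ _) 2)
      have := le_max_left (Real.exp 1) t
      nlinarith
    refine (Real.log_le_log (lt_max_of_lt_left (Real.exp_pos 1)) h2).trans_eq ?_
    rw [Real.log_pow]; rfl
  exact (lg_mono h1).trans (lg_mul_le one_le_two _)

/-- If `|y| ≤ r d_n` then `y² / llog |y| ≤ 4 r² n`. -/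
theorem sq_div_llog_le {r y : ℝ} (hr : 1 ≤ r) {n : ℕ} (hn : 1 ≤ n) (hy : |y| ≤ r * lilNorm n) :
    y ^ 2 / llog |y| ≤ 4 * r ^ 2 * n := by
  have h1 := sq_div_llog_mono (abs_nonneg y) hy
  rw [sq_abs] at h1
  refine h1.trans ?_
  rw [div_le_iff₀ (llog_pos _), mul_pow, lilNorm_sq]
  have h2 : llog n ≤ 2 * llog (r * lilNorm n) := by
    have h3 := llog_sq_le (Real.sqrt_nonneg n)
    rw [Real.sq_sqrt (Nat.cast_nonneg n)] at h3
    refine h3.trans (mul_le_mul_of_nonneg_left (llog_mono ?_) two_pos.le)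
    refine (sqrt_le_lilNorm n).trans ?_
    nlinarith [lilNorm_nonneg n]
  have h4 : (0 : ℝ) ≤ r ^ 2 * n := by positivity
  nlinarith [mul_le_mul_of_nonneg_left h2 h4]

/-- The variable is nonnegative and `V` of the whole space is one, so the negative part of the
Choquet integral vanishes. -/
theorem momentCondition_iff {Ω : Type*} [MeasurableSpace Ω] {S : SubLinearExpectationSpace Ω}
    {V : Set Ω → ℝ≥0∞} (hV : S.IsUpperCapacity V) (X : Ω → ℝ) :
    MomentCondition V X ↔
      ∫⁻ t in Set.Ioi (0 : ℝ), V {ω | t ≤ X ω ^ 2 / llog |X ω|} < ⊤ := by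
  have h : ∫⁻ t in Set.Iio (0 : ℝ), (1 - V {ω | t ≤ X ω ^ 2 / lg (lg |X ω|)}) = 0 := by
    rw [setLIntegral_congr_fun (g := fun _ => 0) measurableSet_Iio]
    · simp
    · intro t ht
      have : {ω | t ≤ X ω ^ 2 / lg (lg |X ω|)} = Set.univ := by
        refine Set.eq_univ_of_forall fun ω => ?_
        exact (le_of_lt ht).trans (div_nonneg (sq_nonneg _) (llog_pos |X ω|).le)
      simp only [this, hV.univ, tsub_self]
  rw [MomentCondition, choquet, h, EReal.coe_ennreal_zero, sub_zero, ← EReal.coe_ennreal_top,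
    EReal.coe_ennreal_lt_coe_ennreal_iff]
  rfl

/-- The intervals `(u j / 2, u j]` are disjoint, have half the length `u j`, and `F` is at least `F
(u j)` on them. -/
theorem tsum_mul_le_lintegral {F : ℝ → ℝ≥0∞} (hF : Antitone F) {u : ℕ → ℝ} (hu0 : ∀ j, 0 < u j)
    (hu : ∀ j, 2 * u j ≤ u (j + 1)) :
    ∑' j, ENNReal.ofReal (u j) * F (u j) ≤ 2 * ∫⁻ t in Set.Ioi (0 : ℝ), F t := by
  have hmono : ∀ i j, i < j → u i ≤ u j / 2 := by
    intro i j hij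
    have hm : Monotone u := monotone_nat_of_le_succ fun n => by linarith [hu n, hu0 n]
    have := (hu i).trans (hm hij)
    linarith
  have hd : Pairwise (Function.onFun Disjoint fun j => Set.Ioc (u j / 2) (u j)) := by
    intro i j hij
    rcases lt_or_gt_of_ne hij with h | h
    · exact Set.disjoint_left.2 fun t ht ht' => by linarith [ht.2, ht'.1, hmono i j h]
    · exact Set.disjoint_left.2 fun t ht ht' => by linarith [ht.1, ht'.2, hmono j i h]
  have h1 : ∑' j, ∫⁻ t in Set.Ioc (u j / 2) (u j), F t ≤ ∫⁻ t in Set.Ioi (0 : ℝ), F t := by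
    rw [← lintegral_iUnion (fun j => measurableSet_Ioc) hd]
    refine lintegral_mono_set (Set.iUnion_subset fun j t ht => ?_)
    exact (half_pos (hu0 j)).trans ht.1
  refine le_trans ?_ (mul_le_mul_right h1 2)
  rw [← ENNReal.tsum_mul_left]
  refine ENNReal.tsum_le_tsum fun j => ?_
  have h2 : F (u j) * ENNReal.ofReal (u j / 2) ≤ ∫⁻ t in Set.Ioc (u j / 2) (u j), F t := by
    have h3 : ∫⁻ _ in Set.Ioc (u j / 2) (u j), F (u j) = F (u j) * ENNReal.ofReal (u j / 2) := by
      rw [lintegral_const, Measure.restrict_apply_univ, Real.volume_Ioc, sub_half]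
    rw [← h3]
    exact setLIntegral_mono' measurableSet_Ioc fun t ht => hF ht.2
  refine le_trans (le_of_eq ?_) (mul_le_mul_right h2 2)
  rw [ENNReal.ofReal_div_of_pos two_pos, ENNReal.ofReal_ofNat, mul_comm (F (u j)), ← mul_assoc,
    ENNReal.mul_div_cancel two_ne_zero ENNReal.ofNat_ne_top]

/-- On cells of length `C` an antitone function is at most its value at the left end; the first cell
is bounded with `F ≤ 1`. -/
theorem lintegral_le_tsum {F : ℝ → ℝ≥0∞} (hF : Antitone F) (hF1 : ∀ t, F t ≤ 1) {C : ℝ}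
    (hC : 0 < C) : ∫⁻ t in Set.Ioi (0 : ℝ), F t ≤
      ENNReal.ofReal C * (1 + ∑' n : ℕ, F (C * (n + 1))) := by
  have hcov : Set.Ioi (0 : ℝ) ⊆ ⋃ n : ℕ, Set.Ico (C * n) (C * (n + 1)) := by
    intro t ht
    refine Set.mem_iUnion.2 ⟨⌊t / C⌋₊, ?_, ?_⟩
    · rw [← le_div_iff₀' hC]
      exact Nat.floor_le (div_nonneg (le_of_lt ht) hC.le)
    · rw [← div_lt_iff₀' hC]
      exact Nat.lt_floor_add_one _
  calc ∫⁻ t in Set.Ioi (0 : ℝ), F t ≤ ∫⁻ t in ⋃ n : ℕ, Set.Ico (C * n) (C * (n + 1)), F t :=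
        lintegral_mono_set hcov
    _ ≤ ∑' n : ℕ, ∫⁻ t in Set.Ico (C * n) (C * (n + 1)), F t := lintegral_iUnion_le _ _
    _ ≤ ∑' n : ℕ, ENNReal.ofReal C * F (C * n) := by
        refine ENNReal.tsum_le_tsum fun n => ?_
        have h3 : ∫⁻ _ in Set.Ico (C * n) (C * (n + 1)), F (C * n) =
            ENNReal.ofReal C * F (C * n) := by
          rw [lintegral_const, Measure.restrict_apply_univ, Real.volume_Ico, mul_comm]
          ring_nf
        rw [← h3]
        exact setLIntegral_mono' measurableSet_Ico fun t ht => hF ht.1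
    _ ≤ _ := by
        rw [ENNReal.tsum_mul_left, tsum_eq_zero_add' ENNReal.summable]
        push_cast
        gcongr
        exact hF1 _

namespace SubLinearExpectationSpace
variable {Ω : Type*} [MeasurableSpace Ω] {S : SubLinearExpectationSpace Ω}
  {V : Set Ω → ℝ≥0∞} {Y : ℕ → Ω → ℝ}

theorem iterExp_one_ind (L : (ℝ → ℝ) → ℝ) (A : Set ℝ) (x : ℕ → ℝ) :
    iterExp L 0 1 (ind {x | x 0 ∈ A}) x = L (ind A) := by
  simp only [iterExp, stepExp]
  congr 1

theorem IID.measurable (hY : S.IID Y) (i : ℕ) : Measurable (Y i) := S.measurable_of_mem _ (hY.mem i)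

theorem measurableSet_le_abs (hY : S.IID Y) (t : ℝ) : MeasurableSet {ω | t ≤ |Y 0 ω|} :=
  measurableSet_le measurable_const (hY.measurable 0).abs

/-- With its companion below: the tails under `V` and under the upper law agree up to an arbitrarily
small shift, which the dyadic form of the moment condition tolerates. -/
theorem tail_le_capacity (hV : S.IsUpperCapacity V) (hY : S.IID Y) {s t : ℝ} (hst : s < t) :
    ENNReal.ofReal (tail (S.upperLaw (Y 0)) t) ≤ V {ω | s ≤ |Y 0 ω|} := by
  have h := S.iterExp_le_capacity hY (N := 1) (A := {x | x 0 ∈ {x : ℝ | t ≤ |x|}})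
    (B := {x | s ≤ |x 0|}) (sub_pos.2 hst) (fun x hx z hz => by
      have h1 := abs_sub_abs_le_abs_sub (x 0) (z 0)
      have h2 := hz 0 one_pos
      have h3 : t ≤ |x 0| := hx
      change s ≤ |z 0|
      linarith) hV (measurableSet_le_abs hY s) 0
  rwa [iterExp_one_ind] at h

theorem capacity_le_tail (hV : S.IsUpperCapacity V) (hY : S.IID Y) {s t : ℝ} (hst : s < t) :
    V {ω | t ≤ |Y 0 ω|} ≤ ENNReal.ofReal (tail (S.upperLaw (Y 0)) s) := by
  have h := S.capacity_le_iterExp hY (N := 1) (A := {x | t ≤ |x 0|})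
    (B := {x | x 0 ∈ {x : ℝ | s ≤ |x|}}) (sub_pos.2 hst) (fun x hx z hz => by
      have h1 := abs_sub_abs_le_abs_sub (x 0) (z 0)
      have h2 := hz 0 one_pos
      have h3 : t ≤ |x 0| := hx
      change s ≤ |z 0|
      linarith) hV (measurableSet_le_abs hY t) 0
  rwa [iterExp_one_ind] at h

theorem measurable_sq_div_llog (hY : S.IID Y) :
    Measurable fun ω => Y 0 ω ^ 2 / llog |Y 0 ω| := by
  have hlg : Measurable lg := Real.measurable_log.comp (measurable_const.max measurable_id)
  exact ((hY.measurable 0).pow_const 2).div (hlg.comp (hlg.comp (hY.measurable 0).abs))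

theorem antitone_capacity (hV : S.IsUpperCapacity V) {f : Ω → ℝ} (hf : Measurable f) :
    Antitone fun t : ℝ => V {ω | t ≤ f ω} := fun _ _ hst =>
  hV.mono _ _ (measurableSet_le measurable_const hf) (measurableSet_le measurable_const hf)
    fun _ hω => hst.trans hω

theorem capacity_le_one (hV : S.IsUpperCapacity V) {A : Set Ω} (hA : MeasurableSet A) :
    V A ≤ 1 := (hV.mono _ _ hA MeasurableSet.univ (Set.subset_univ _)).trans_eq hV.univ

theorem summable_dyadicTail (hV : S.IsUpperCapacity V) (hY : S.IID Y)
    (h : MomentCondition V (Y 0)) : Summable (dyadicTail (S.upperLaw (Y 0))) := by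
  have hU := S.isUpperExp_upperLaw (hY.mem 0)
  rw [momentCondition_iff hV] at h
  let F : ℝ → ℝ≥0∞ := fun t => V {ω | t ≤ Y 0 ω ^ 2 / llog |Y 0 ω|}
  have hF : Antitone F := antitone_capacity hV (measurable_sq_div_llog hY)
  -- Half the dyadic level leaves the strict gap needed to pass from the upper law to `V`; it costs
  -- the factor four in `h1`. The levels `u j` at least double because `llog (2 v) ≤ 2 * llog v`.
  let v : ℕ → ℝ := fun j => 2 ^ j / 2
  have hv : ∀ j, 0 < v j := fun j => by positivity
  let u : ℕ → ℝ := fun j => v j ^ 2 / llog (v j)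
  have hu0 : ∀ j, 0 < u j := fun j => div_pos (pow_pos (hv j) 2) (llog_pos _)
  have hu : ∀ j, 2 * u j ≤ u (j + 1) := fun j => by
    have e : v (j + 1) = 2 * v j := by simp only [v]; ring
    simp only [u]
    rw [e, le_div_iff₀ (llog_pos _)]
    have h1 := llog_mul_le one_le_two (v j)
    have h2 : v j ^ 2 / llog (v j) * llog (v j) = v j ^ 2 := div_mul_cancel₀ _ (llog_pos _).ne'
    have h3 := hu0 j
    simp only [u] at h3
    nlinarith
  have h1 : ∀ j, ENNReal.ofReal (dyadicTail (S.upperLaw (Y 0)) j) ≤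
      4 * (ENNReal.ofReal (u j) * F (u j)) := by
    intro j
    have h2 : dyadicTail (S.upperLaw (Y 0)) j ≤ 4 * u j * tail (S.upperLaw (Y 0)) (2 ^ j) := by
      refine mul_le_mul_of_nonneg_right ?_ (hU.tail_nonneg _)
      have h3 : llog (v j) ≤ llog (2 ^ j) := llog_mono (half_le_self (by positivity))
      have e : 4 * u j = 4 ^ j / llog (v j) := by
        simp only [u, v]
        rw [div_pow, ← pow_mul, mul_comm j 2, pow_mul]
        norm_num
        ring
      rw [e]
      exact div_le_div_of_nonneg_left (by positivity) (llog_pos _) h3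
    refine (ENNReal.ofReal_le_ofReal h2).trans ?_
    rw [ENNReal.ofReal_mul (by linarith [hu0 j]), ENNReal.ofReal_mul (by norm_num),
      ENNReal.ofReal_ofNat, mul_assoc]
    gcongr
    refine (tail_le_capacity hV hY (half_lt_self (by positivity))).trans ?_
    refine hV.mono _ _ (measurableSet_le_abs hY _)
      (measurableSet_le measurable_const (measurable_sq_div_llog hY)) fun ω hω => ?_
    have := sq_div_llog_mono (hv j).le hω
    rwa [sq_abs] at this
  have h2 : ∑' j, ENNReal.ofReal (dyadicTail (S.upperLaw (Y 0)) j) ≠ ⊤ := by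
    refine ne_top_of_le_ne_top ?_ (ENNReal.tsum_le_tsum h1)
    rw [ENNReal.tsum_mul_left]
    refine ENNReal.mul_ne_top (by norm_num) (ne_top_of_le_ne_top ?_ (tsum_mul_le_lintegral hF hu0 hu))
    exact ENNReal.mul_ne_top (by norm_num) h.ne
  refine (ENNReal.summable_toReal h2).congr fun j => ?_
  rw [ENNReal.toReal_ofReal (hU.dyadicTail_nonneg j)]

/-- If `Y² / llog |Y|` is at least `C (n + 1)` with `C` just above `4 (2 a)²`, then `|Y|` exceeds `2
a d_{n+1}`. So summable tails would make the Choquet integral finite. -/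
theorem not_summable_tail (hV : S.IsUpperCapacity V) (hY : S.IID Y)
    (h : ¬ MomentCondition V (Y 0)) {a : ℝ} (ha : 1 ≤ a) :
    ¬ Summable fun n : ℕ => tail (S.upperLaw (Y 0)) (a * lilNorm (n + 1)) := by
  intro hs
  have hU := S.isUpperExp_upperLaw (hY.mem 0)
  refine h ((momentCondition_iff hV _).2 ?_)
  have hF := antitone_capacity hV (measurable_sq_div_llog hY)
  have hC : 0 < 4 * (2 * a) ^ 2 + 1 := by positivity
  refine (lintegral_le_tsum hF (fun t => capacity_le_one hV
    (measurableSet_le measurable_const (measurable_sq_div_llog hY))) hC).trans_lt ?_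
  refine ENNReal.mul_lt_top ENNReal.ofReal_lt_top (ENNReal.add_lt_top.2 ⟨ENNReal.one_lt_top, ?_⟩)
  refine lt_of_le_of_lt (ENNReal.tsum_le_tsum fun n => ?_) (hs.tsum_ofReal_lt_top)
  have h1 := lilNorm_pos (n := n + 1) (by omega)
  refine le_trans ?_ (capacity_le_tail hV hY
    (show a * lilNorm (n + 1) < 2 * a * lilNorm (n + 1) by nlinarith))
  refine hV.mono _ _ (measurableSet_le measurable_const (measurable_sq_div_llog hY))
    (measurableSet_le_abs hY _) fun ω hω => ?_
  by_contra hlt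
  have h2 := sq_div_llog_le (show 1 ≤ 2 * a by linarith) (n := n + 1) (by omega) (not_le.1 hlt).le
  have h3 : (4 * (2 * a) ^ 2 + 1) * ((n : ℝ) + 1) ≤ Y 0 ω ^ 2 / llog |Y 0 ω| := hω
  push_cast at h2
  have : (0 : ℝ) < (n : ℝ) + 1 := by positivity
  linarith

/-! ### The conditions on the truncated expectations -/

theorem coe_upperLaw_clip (hY : S.IID Y) {c : ℝ} (hc : 0 ≤ c) :
    (S.upperLaw (Y 0) (fun x => 1 * clip c x) : EReal) =
      S.E fun ω => max (-c) (min (Y 0 ω) c) := by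
  simp only [one_mul]
  exact S.coe_upperLaw (hY.mem 0) (isBddLip_clip hc)

theorem coe_upperLaw_neg_clip (hY : S.IID Y) {c : ℝ} (hc : 0 ≤ c) :
    (S.upperLaw (Y 0) (fun x => -1 * clip c x) : EReal) =
      S.E fun ω => max (-c) (min (-Y 0 ω) c) := by
  rw [S.coe_upperLaw (hY.mem 0) ((isBddLip_clip hc).const_mul (-1))]
  congr 1
  funext ω
  rw [clip, neg_one_mul, ← min_neg_neg, neg_neg, ← max_neg_neg, max_min_distrib_left,
    max_eq_right (by linarith : -c ≤ c), min_comm, max_comm]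

theorem meanZeroCondition_iff (hY : S.IID Y) : S.MeanZeroCondition (Y 0) ↔
    ∀ s : ℝ, |s| = 1 →
      Tendsto (fun c => S.upperLaw (Y 0) (fun x => s * clip c x)) atTop (𝓝 0) := by
  have h1 : S.HasTruncExp (Y 0) 0 ↔
      Tendsto (fun c => S.upperLaw (Y 0) (fun x => 1 * clip c x)) atTop (𝓝 0) := by
    rw [HasTruncExp, ← EReal.tendsto_coe, EReal.coe_zero]
    refine tendsto_congr' ?_
    filter_upwards [eventually_ge_atTop 0] with c hc using (coe_upperLaw_clip hY hc).symm
  have h2 : S.HasTruncExp (fun ω => -Y 0 ω) 0 ↔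
      Tendsto (fun c => S.upperLaw (Y 0) (fun x => -1 * clip c x)) atTop (𝓝 0) := by
    rw [HasTruncExp, ← EReal.tendsto_coe, EReal.coe_zero]
    refine tendsto_congr' ?_
    filter_upwards [eventually_ge_atTop 0] with c hc using (coe_upperLaw_neg_clip hY hc).symm
  rw [MeanZeroCondition, h1, h2]
  refine ⟨fun h s hs => ?_, fun h => ⟨h 1 (by simp), h (-1) (by simp)⟩⟩
  rcases eq_or_eq_neg_of_abs_eq hs with rfl | rfl
  exacts [h.1, h.2]

theorem isBddLip_clip_sq {c : ℝ} (hc : 0 ≤ c) : IsBddLip fun x : ℝ => clip c x ^ 2 := by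
  refine isBddLip_of_abs_le (C := c ^ 2) (K := Real.toNNReal (2 * c)) (fun x => ?_) fun x y => ?_
  · rw [abs_pow]
    exact pow_le_pow_left₀ (abs_nonneg _) (abs_clip_le hc x) 2
  · obtain ⟨-, K, hK⟩ := isBddLip_clip hc
    have h1 : |clip c x - clip c y| ≤ |x - y| := by
      have h := ((LipschitzWith.id (α := ℝ)).min_const c).const_max (-c) |>.dist_le_mul x y
      simpa [Real.dist_eq, clip] using h
    have h2 : |clip c x + clip c y| ≤ 2 * c :=
      (abs_add_le _ _).trans (by linarith [abs_clip_le hc x, abs_clip_le hc y])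
    rw [sq_sub_sq, abs_mul, Real.coe_toNNReal _ (by linarith)]
    exact mul_le_mul h2 h1 (abs_nonneg _) (by linarith)

theorem clip_sq_eq_min {c : ℝ} (hc : 0 ≤ c) (x : ℝ) : clip c x ^ 2 = min (x ^ 2) (c ^ 2) := by
  rw [← sq_abs, abs_clip hc, ← sq_abs x]
  rcases le_total |x| c with h | h
  · rw [min_eq_left h, min_eq_left (pow_le_pow_left₀ (abs_nonneg _) h 2)]
  · rw [min_eq_right h, min_eq_right (pow_le_pow_left₀ hc h 2)]

theorem isUpperStd_iff {X : Ω → ℝ} {σ : ℝ≥0∞} : S.IsUpperStd X σ ↔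
    Tendsto (fun c : ℝ => S.E (fun ω => min (X ω ^ 2) c)) atTop
      (𝓝 ((σ ^ 2 : ℝ≥0∞) : EReal)) := by
  refine tendsto_congr' ?_
  filter_upwards [eventually_ge_atTop 0] with c hc
  congr 1
  funext ω
  exact max_eq_right (le_trans (by linarith) (le_min (sq_nonneg _) hc))

/-- Truncated second moments increase with the level, so the limit is a supremum and is approached
by the squares of clipped variables. Levels are nonnegative because only then does `clip` truncate.
-/
theorem isLUB_upperStd (hY : S.IID Y) {σ : ℝ≥0∞} (hσ : S.IsUpperStd (Y 0) σ) :
    IsLUB (Set.range fun b : Set.Ici (0 : ℝ) =>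
      (S.upperLaw (Y 0) (fun x => clip b x ^ 2) : EReal)) ((σ ^ 2 : ℝ≥0∞) : EReal) := by
  have hU := S.isUpperExp_upperLaw (hY.mem 0)
  have hmono : Monotone fun b : Set.Ici (0 : ℝ) =>
      (S.upperLaw (Y 0) (fun x => clip b x ^ 2) : EReal) := fun b c hbc => by
    refine EReal.coe_le_coe_iff.2 (hU.mono _ _ ((isBdd_clip b.2).pow 2) ((isBdd_clip c.2).pow 2)
      fun x => ?_)
    rw [clip_sq_eq_min b.2, clip_sq_eq_min c.2]
    exact min_le_min le_rfl (pow_le_pow_left₀ (Set.mem_Ici.1 b.2) (Subtype.coe_le_coe.2 hbc) 2)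
  refine isLUB_of_tendsto_atTop hmono ?_
  have h1 : Tendsto (fun b : Set.Ici (0 : ℝ) => (b : ℝ) ^ 2) atTop atTop :=
    (tendsto_pow_atTop two_ne_zero).comp ((tendsto_comp_val_Ici_atTop (f := id)).2 tendsto_id)
  refine ((isUpperStd_iff.1 hσ).comp h1).congr fun b => ?_
  rw [S.coe_upperLaw (hY.mem 0) (isBddLip_clip_sq b.2)]
  simp only [Function.comp, clip_sq_eq_min b.2]

theorem upperLaw_clip_sq_le (hY : S.IID Y) {σ : ℝ≥0∞} (hσ : S.IsUpperStd (Y 0) σ) {s : ℝ}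
    (hs : 0 ≤ s) (hσs : σ ≤ ENNReal.ofReal s) {b : ℝ} (hb : 0 ≤ b) :
    S.upperLaw (Y 0) (fun x => clip b x ^ 2) ≤ s ^ 2 := by
  have h1 := (isLUB_upperStd hY hσ).1 ⟨⟨b, hb⟩, rfl⟩
  have h2 : ((σ ^ 2 : ℝ≥0∞) : EReal) ≤ ((s ^ 2 : ℝ) : EReal) := by
    have h3 : σ ^ 2 ≤ ENNReal.ofReal (s ^ 2) := by
      rw [ENNReal.ofReal_pow hs]; gcongr
    refine (EReal.coe_ennreal_le_coe_ennreal_iff.2 h3).trans_eq ?_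
    rw [EReal.coe_ennreal_ofReal, max_eq_left (sq_nonneg s)]
  exact EReal.coe_le_coe_iff.1 (h1.trans h2)

theorem exists_lt_upperLaw_clip_sq (hY : S.IID Y) {σ : ℝ≥0∞} (hσ : S.IsUpperStd (Y 0) σ) {K : ℝ}
    (hK : 0 < K) (hσK : ENNReal.ofReal K < σ) :
    ∃ b, 0 < b ∧ K ^ 2 < S.upperLaw (Y 0) (fun x => clip b x ^ 2) := by
  have h3 : ENNReal.ofReal (K ^ 2) < σ ^ 2 := by
    rw [ENNReal.ofReal_pow hK.le]
    exact ENNReal.pow_lt_pow_left two_ne_zero hσK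
  have h2 : ((K ^ 2 : ℝ) : EReal) < ((σ ^ 2 : ℝ≥0∞) : EReal) := by
    refine lt_of_eq_of_lt ?_ (EReal.coe_ennreal_lt_coe_ennreal_iff.2 h3)
    rw [EReal.coe_ennreal_ofReal, max_eq_left (sq_nonneg K)]
  obtain ⟨_, ⟨⟨b, hb⟩, rfl⟩, h, -⟩ := (isLUB_upperStd hY hσ).exists_between h2
  have h4 : K ^ 2 < S.upperLaw (Y 0) (fun x => clip b x ^ 2) := EReal.coe_lt_coe_iff.1 h
  refine ⟨b, lt_of_le_of_ne hb fun h0 => ?_, h4⟩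
  subst h0
  have h5 : (fun x => clip 0 x ^ 2) = fun _ => (0 : ℝ) := by
    funext x
    rw [clip_sq_eq_min le_rfl]
    simp [sq_nonneg]
  rw [h5, (S.isUpperExp_upperLaw (hY.mem 0)).const] at h4
  nlinarith

end SubLinearExpectationSpace

/-! ### Necessity of the moment, mean and variance conditions. -/

/-- The event that `|S_m| ≥ M d_m` for some `m` with `n ≤ m ≤ N`. -/
def exceedEvent (M : ℝ) (n N : ℕ) : Set (ℕ → ℝ) :=
  {x | ∃ m ∈ Finset.Icc n N, M * lilNorm m ≤ |coordSum id 0 m x|}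

theorem partialSum_eq_coordSum {Ω : Type*} (Y : ℕ → Ω → ℝ) (m : ℕ) (ω : Ω) :
    partialSum Y m ω = coordSum id 0 m fun i => Y i ω := by
  simp [partialSum, coordSum]

namespace SubLinearExpectationSpace
variable {Ω : Type*} [MeasurableSpace Ω] {S : SubLinearExpectationSpace Ω}
  {V : Set Ω → ℝ≥0∞} {Y : ℕ → Ω → ℝ}

theorem measurable_partialSum (hY : S.IID Y) (m : ℕ) : Measurable (partialSum Y m) :=
  Finset.measurable_fun_sum _ fun i _ => hY.measurable i

theorem measurable_coordSum (hY : S.IID Y) (m : ℕ) :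
    Measurable fun ω => coordSum id 0 m fun i => Y i ω := by
  simp only [← partialSum_eq_coordSum]
  exact measurable_partialSum hY m

theorem measurable_supAbsRatio (hY : S.IID Y) (n N : ℕ) : Measurable (supAbsRatio Y n N) :=
  Measurable.biSup (Finset.Icc n N : Set ℕ) (Finset.countable_toSet _) fun m _ =>
    measurable_coe_real_ereal.comp ((measurable_partialSum hY m).abs.div_const _)

theorem measurable_supRatio (hY : S.IID Y) (n N : ℕ) : Measurable (supRatio Y n N) :=
  Measurable.biSup (Finset.Icc n N : Set ℕ) (Finset.countable_toSet _) fun m _ =>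
    measurable_coe_real_ereal.comp ((measurable_partialSum hY m).div_const _)

theorem measurableSet_exceedEvent (hY : S.IID Y) (M : ℝ) (n N : ℕ) :
    MeasurableSet {ω | (fun i => Y i ω) ∈ exceedEvent M n N} := by
  have : {ω | (fun i => Y i ω) ∈ exceedEvent M n N} =
      ⋃ m ∈ Finset.Icc n N, {ω | M * lilNorm m ≤ |coordSum id 0 m fun i => Y i ω|} := by
    ext ω; simp [exceedEvent]
  rw [this]
  exact Finset.measurableSet_biUnion _ fun m _ =>
    measurableSet_le measurable_const (measurable_coordSum hY m).abs

/-- Raising the level gives the room for a Lipschitz function, and the capacities increase with `N`,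
hence stay below their limit. A single starting index `n ≥ 1` is enough for all contradictions that
follow. -/
theorem exists_iterExp_exceedEvent_lt (hV : S.IsUpperCapacity V) (hY : S.IID Y)
    (h : ∃ (n₀ : ℕ) (M : ℝ), ∀ n ≥ n₀, ∃ l < (1 : ℝ≥0∞),
      Tendsto (fun N : ℕ => V {ω | (M : EReal) ≤ supAbsRatio Y n N ω}) atTop (𝓝 l)) :
    ∃ M ≥ (1 : ℝ), ∃ n ≥ 1, ∃ ε > 0, ∀ N,
      iterExp (S.upperLaw (Y 0)) 0 N (ind (exceedEvent M n N)) 0 < 1 - ε := by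
  obtain ⟨n₀, M, h⟩ := h
  obtain ⟨l, hl, hlim⟩ := h (max n₀ 1) (le_max_left _ _)
  have hn : 1 ≤ max n₀ 1 := le_max_right _ _
  set n := max n₀ 1
  have hms : ∀ N, MeasurableSet {ω | (M : EReal) ≤ supAbsRatio Y n N ω} := fun N =>
    measurableSet_le measurable_const (measurable_supAbsRatio hY n N)
  have hmono : Monotone fun N : ℕ => V {ω | (M : EReal) ≤ supAbsRatio Y n N ω} := by
    intro N N' hN
    refine hV.mono _ _ (hms N) (hms N') fun ω hω => le_trans (show (M : EReal) ≤ supAbsRatio Y n N ω from hω) ?_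
    exact biSup_mono fun m hm => Finset.Icc_subset_Icc le_rfl hN hm
  have hl1 : l.toReal < 1 := by
    simpa using (ENNReal.toReal_lt_toReal hl.ne_top ENNReal.one_ne_top).2 hl
  refine ⟨max 1 (M + 1), le_max_left _ _, n, hn, (1 - l.toReal) / 2, by linarith, fun N => ?_⟩
  have hgap : max 0 M < max 1 (M + 1) :=
    max_lt (lt_max_of_lt_left one_pos) (lt_max_of_lt_right (by linarith))
  have h1 := S.iterExp_le_capacity hY (N := N) (A := exceedEvent (max 1 (M + 1)) n N)
    (B := exceedEvent (max 0 M) n N) (δ := (max 1 (M + 1) - max 0 M) / (N + 1))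
    (div_pos (sub_pos.2 hgap) (by positivity)) (by
      rintro x ⟨m, hm, hx⟩ z hz
      have hm' := Finset.mem_Icc.1 hm
      exact ⟨m, hm, mul_lilNorm_le_abs_of_close hm'.2 (hn.trans hm'.1) hgap hz hx⟩)
    hV (measurableSet_exceedEvent hY _ n N) 0
  have h2 : V {ω | (fun i => Y i ω) ∈ exceedEvent (max 0 M) n N} ≤ l := by
    refine (hV.mono _ _ (measurableSet_exceedEvent hY _ n N) (hms N) ?_).trans
      (hmono.ge_of_tendsto hlim N)
    rintro ω ⟨m, hm, hω⟩
    have hd := lilNorm_pos (hn.trans (Finset.mem_Icc.1 hm).1)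
    refine le_trans ?_ (le_biSup (fun m : ℕ => ((|partialSum Y m ω| / lilNorm m : ℝ) : EReal)) hm)
    rw [EReal.coe_le_coe_iff, le_div_iff₀ hd, partialSum_eq_coordSum]
    exact le_trans (mul_le_mul_of_nonneg_right (le_max_right _ _) hd.le) hω
  have h3 := (ENNReal.ofReal_le_iff_le_toReal hl.ne_top).1 (h1.trans h2)
  linarith

end SubLinearExpectationSpace

namespace IsUpperExp
variable {L : (ℝ → ℝ) → ℝ} (hL : IsUpperExp L)
include hL

/-- If the tails along the normalizing constants are not summable, the partial sums exceed any
multiple of these constants. -/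
theorem exists_exceedEvent_of_not_summable {M : ℝ} (hM : 1 ≤ M)
    (h : ¬ Summable fun n : ℕ => tail L (2 * M * lilNorm (n + 1))) (n : ℕ) {ε : ℝ}
    (hε : 0 < ε) (x : ℕ → ℝ) :
    ∃ N, 1 - ε ≤ iterExp L 0 N (ind (exceedEvent M n N)) x := by
  obtain ⟨N, hN, hnN⟩ := (((tendsto_prod_one_sub (fun k => hL.tail_nonneg _)
    (fun k => hL.tail_le_one _) h n).eventually_le_const hε).and (eventually_ge_atTop n)).exists
  -- Each coordinate is an independent block of length one.
  let G : ℕ → Set (ℕ → ℝ) := fun k => {x | x k ∈ {y : ℝ | 2 * M * lilNorm (k + 1) ≤ |y|}}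
  have hstep : ∀ k x, iterExp L k 1 (ind (G k)) x = tail L (2 * M * lilNorm (k + 1)) := by
    intro k x
    simp only [iterExp, stepExp, tail]
    congr 1
    funext y
    by_cases hy : 2 * M * lilNorm (k + 1) ≤ |y|
    · rw [ind_of_mem (A := {y : ℝ | 2 * M * lilNorm (k + 1) ≤ |y|}) hy, ind_of_mem]
      simpa [G] using hy
    · rw [ind_of_notMem (A := {y : ℝ | 2 * M * lilNorm (k + 1) ≤ |y|}) hy, ind_of_notMem]
      simpa [G] using hy
  have hbl := hL.iter_blocks (c := id) monotone_id (g := fun k => ind (G k))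
    (p := fun k => tail L (2 * M * lilNorm (k + 1)))
    (fun k x => ind_nonneg _ x) (fun k x => ind_le_one _ x)
    (fun k => noDepFrom_ind (A := G k) fun x z hxz hx => by
      change z k ∈ {y : ℝ | 2 * M * lilNorm (k + 1) ≤ |y|}
      rw [← hxz k (Nat.lt_succ_self k)]
      exact hx) (fun k => hL.tail_le_one _) (k₀ := n)
    (fun k _ x => by
      simp only [id, Nat.add_sub_cancel_left]
      exact (hstep k x).ge) N hnN x
  refine ⟨N, ?_⟩
  refine le_trans (by linarith) (hbl.trans (hL.iter_mono ?_ (isBdd_ind _) (fun x => ?_) 0 N x))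
  · exact (IsBdd.const 1).sub (IsBdd.prod _ fun k _ => (IsBdd.const 1).sub (isBdd_ind _))
  by_cases hG : ∃ k ∈ Finset.Ico n N, x ∈ G k
  · obtain ⟨k, hk, hxG⟩ := hG
    have hk' := Finset.mem_Ico.1 hk
    have hprod : 0 ≤ ∏ k ∈ Finset.Ico n N, (1 - ind (G k) x) :=
      Finset.prod_nonneg fun k _ => sub_nonneg.2 (ind_le_one _ _)
    have hE : x ∈ exceedEvent M n N := by
      have h1 : 2 * M * lilNorm (k + 1) ≤ |x k| := hxG
      have h2 : coordSum id 0 (k + 1) x = coordSum id 0 k x + x k := by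
        simp [coordSum, Finset.sum_range_succ]
      -- A summand is a difference of consecutive partial sums, so one of the two is at least half
      -- as large.
      have h3 : |x k| ≤ |coordSum id 0 (k + 1) x| + |coordSum id 0 k x| := by
        have := abs_sub (coordSum id 0 (k + 1) x) (coordSum id 0 k x)
        rwa [h2, add_sub_cancel_left, ← h2] at this
      have h4 := mul_le_mul_of_nonneg_left (lilNorm_mono (Nat.le_succ k))
        (show 0 ≤ M by linarith)
      by_cases h5 : M * lilNorm k ≤ |coordSum id 0 k x|
      · exact ⟨k, Finset.mem_Icc.2 ⟨hk'.1, hk'.2.le⟩, h5⟩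
      · exact ⟨k + 1, Finset.mem_Icc.2 ⟨hk'.1.trans (Nat.le_succ k), hk'.2⟩, by
          push Not at h5; linarith⟩
    rw [ind_of_mem hE]
    linarith
  · push Not at hG
    rw [Finset.prod_eq_one fun k hk => by rw [ind_of_notMem (hG k hk), sub_zero], sub_self]
    exact ind_nonneg _ _

/-- If the truncated means do not vanish, the partial sums grow linearly. -/
theorem exists_exceedEvent_of_mean (ha : Summable (dyadicTail L)) {s γ : ℝ} (hs : |s| = 1)
    (hγ : 0 < γ) (hf : ∃ᶠ c in atTop, γ ≤ L fun x => s * clip c x) (M : ℝ) (n₀ : ℕ) {ε : ℝ}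
    (hε : 0 < ε) (x : ℕ → ℝ) :
    ∃ N, 1 - ε ≤ iterExp L 0 N (ind (exceedEvent M n₀ N)) x := by
  -- Under the moment condition, raising a high level changes the mean by at most `γ / 2`, so one
  -- high level with mean at least `γ` controls all higher ones.
  have hmean : ∀ᶠ y in atTop, γ / 2 ≤ L fun x => s * clip y x := by
    obtain ⟨c, hc, hc', hc1⟩ := (hf.and_eventually
      (((hL.tendsto_truncErr ha).eventually_le_const (half_pos hγ)).and
        (eventually_ge_atTop 1))).exists
    filter_upwards [eventually_ge_atTop c] with y hy
    linarith [hL.clip_le_clip_add ha hc1 hy hs]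
  -- Chebyshev's bound for the average, rewritten with `d_n² = 2 n llog n`.
  have hvar : Tendsto (fun n : ℕ => 24 / γ ^ 2 * (((L fun x => clip (lilNorm n) x ^ 2) / llog n) *
      (lilNorm n / n) ^ 2)) atTop (𝓝 0) := by
    simpa using ((hL.tendsto_clip_sq ha).mul (tendsto_lilNorm_div.pow 2)).const_mul (24 / γ ^ 2)
  have hMn : ∀ᶠ n : ℕ in atTop, M * (lilNorm n / n) ≤ γ / 4 := by
    have := tendsto_lilNorm_div.const_mul M
    rw [mul_zero] at this
    exact this.eventually_le_const (by positivity)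
  obtain ⟨n, hn1, hn2, hn3, hn4, hn5⟩ := ((tendsto_lilNorm.eventually hmean).and
    ((hvar.eventually_le_const (half_pos hε)).and
    (((hL.tendsto_mul_tail ha).eventually_le_const (half_pos hε)).and
    (hMn.and (eventually_ge_atTop (max n₀ 1)))))).exists
  have hn : 1 ≤ n := (le_max_right _ _).trans hn5
  have hn0 : (0 : ℝ) < n := by exact_mod_cast hn
  have hΛ := llog_pos n
  have hDsq := lilNorm_sq n
  set D := lilNorm n
  have hD : 0 < D := lilNorm_pos hn
  have hfb : IsBdd fun x => s * clip D x := (isBdd_clip hD.le).const_mul s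
  have hs2 : s ^ 2 = 1 := by rw [← sq_abs, hs, one_pow]
  -- Under a linear functional that attains the truncated mean, the weak law of large numbers makes
  -- the sum of order `n`.
  obtain ⟨l, hl, hlL, hlf⟩ := hL.exists_linear hfb
  have hv : (l fun y => (s * clip D y) ^ 2) ≤ L fun x => clip D x ^ 2 := by
    simp only [mul_pow, hs2, one_mul]
    exact hlL _ ((isBdd_clip hD.le).pow 2)
  have ht : (0 : ℝ) < n * (γ / 4) := by positivity
  have hcheb := hl.iter_cheb_centered hfb hv ht 0 n x
  set B : Set (ℕ → ℝ) := {x | n * (γ / 4) ≤ |coordSum (fun x => s * clip D x) 0 n x|}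
  set B' : Set (ℕ → ℝ) :=
    {x | n * (γ / 4) ≤ |coordSum (fun x => s * clip D x) 0 n x - n * l fun x => s * clip D x|}
  have hpt : ∀ x, (1 : ℝ) ≤ ind B x + ind B' x := by
    intro x
    by_cases hx : x ∈ B'
    · rw [ind_of_mem hx]; linarith [ind_nonneg B x]
    · have hB : x ∈ B := by
        have h1 : |coordSum (fun x => s * clip D x) 0 n x - n * l fun x => s * clip D x| <
          n * (γ / 4) := not_le.1 hx
        have h2 := (_root_.abs_lt.1 h1).1
        have h3 : n * (γ / 2) ≤ n * l fun x => s * clip D x :=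
          mul_le_mul_of_nonneg_left (hn1.trans_eq hlf.symm) hn0.le
        exact le_trans (by linarith) (le_abs_self (coordSum (fun x => s * clip D x) 0 n x))
      rw [ind_of_mem hB]; linarith [ind_nonneg B' x]
  have h1 := (hl.iter_mono (IsBdd.const 1) ((isBdd_ind B).add (isBdd_ind B')) hpt 0 n x).trans
    (hl.iter_add_le (isBdd_ind B) (isBdd_ind B') 0 n x)
  rw [hl.iter_const] at h1
  have h2 := hL.iter_le_of_le hl.toIsUpperExp hlL (isBdd_ind B) 0 n x
  have h3 := hL.iter_ind_le_clip (y := D) (n := n) (a := 0) (A := B) (B := exceedEvent M n₀ n)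
    (fun x hx hi => by
      refine ⟨n, Finset.mem_Icc.2 ⟨(le_max_left _ _).trans hn5, le_rfl⟩, ?_⟩
      have h4 : n * (γ / 4) ≤ |coordSum (fun x => s * clip D x) 0 n x| := hx
      rw [coordSum_eq_clip le_rfl hi, abs_mul, hs, one_mul] at h4
      refine le_trans ?_ h4
      calc M * D = n * (M * (D / n)) := by field_simp
        _ ≤ n * (γ / 4) := mul_le_mul_of_nonneg_left hn4 hn0.le) x
  have h5 : 3 * (n * L fun x => clip D x ^ 2) / (n * (γ / 4)) ^ 2 =
      24 / γ ^ 2 * (((L fun x => clip D x ^ 2) / llog n) * (D / n) ^ 2) := by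
    rw [div_pow, hDsq]
    field_simp
    ring
  rw [h5] at hcheb
  refine ⟨n, ?_⟩
  linarith

/-- If the truncated means do not exceed any positive number in the limit, they vanish. -/
theorem tendsto_mean_of_forall (h : ∀ s : ℝ, |s| = 1 → ∀ γ > 0,
      ¬ ∃ᶠ c in atTop, γ ≤ L fun x => s * clip c x) {s : ℝ} (hs : |s| = 1) :
    Tendsto (fun c => L (fun x => s * clip c x)) atTop (𝓝 0) := by
  rw [tendsto_order]
  refine ⟨fun a ha => ?_, fun a ha => ?_⟩
  -- The lower bound comes from the opposite sign, since the values at a function and its negative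
  -- have a nonnegative sum.
  · filter_upwards [not_frequently.1 (h (-s) (by rwa [abs_neg]) (-a) (neg_pos.2 ha)),
      eventually_ge_atTop 0] with c hc hc0
    have h1 := hL.neg_neg_le ((isBdd_clip hc0).const_mul s)
    simp only [← neg_mul] at h1
    linarith
  · filter_upwards [not_frequently.1 (h s hs a ha)] with c hc using not_le.1 hc

end IsUpperExp

namespace SubLinearExpectationSpace
variable {Ω : Type*} [MeasurableSpace Ω] {S : SubLinearExpectationSpace Ω}
  {V : Set Ω → ℝ≥0∞} {Y : ℕ → Ω → ℝ}

/-- Necessity in the law of the iterated logarithm. -/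
theorem moment_mean_std_of_capacity_lt_one (hV : S.IsUpperCapacity V) (hY : S.IID Y) {σ : ℝ≥0∞}
    (hσ : S.IsUpperStd (Y 0) σ)
    (h : ∃ (n₀ : ℕ) (M : ℝ), ∀ n ≥ n₀, ∃ l < (1 : ℝ≥0∞),
      Tendsto (fun N : ℕ => V {ω | (M : EReal) ≤ supAbsRatio Y n N ω}) atTop (𝓝 l)) :
    MomentCondition V (Y 0) ∧ S.MeanZeroCondition (Y 0) ∧ σ < ⊤ := by
  have hU := S.isUpperExp_upperLaw (hY.mem 0)
  obtain ⟨M, hM, n, hn, ε, hε, hlt⟩ := exists_iterExp_exceedEvent_lt hV hY h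
  have hmom : MomentCondition V (Y 0) := by
    by_contra hmom
    obtain ⟨N, hN⟩ := hU.exists_exceedEvent_of_not_summable hM
      (not_summable_tail hV hY hmom (by linarith)) n hε 0
    exact (hlt N).not_ge hN
  have ha := summable_dyadicTail hV hY hmom
  have hmean : ∀ s : ℝ, |s| = 1 →
      Tendsto (fun c => S.upperLaw (Y 0) (fun x => s * clip c x)) atTop (𝓝 0) := by
    refine fun s hs => hU.tendsto_mean_of_forall (fun s hs γ hγ hf => ?_) hs
    obtain ⟨N, hN⟩ := hU.exists_exceedEvent_of_mean ha hs hγ hf M n hε 0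
    exact (hlt N).not_ge hN
  refine ⟨hmom, (meanZeroCondition_iff hY).2 hmean, lt_top_iff_ne_top.2 fun htop => ?_⟩
  -- With infinite variance the lower bound is available above any level, in particular above `M`.
  obtain ⟨b, hb, hbK⟩ := exists_lt_upperLaw_clip_sq hY hσ (K := M + 1) (by linarith)
    (htop ▸ ENNReal.ofReal_lt_top)
  obtain ⟨N, hN⟩ := hU.exists_iter_ge ha hmean hb (by linarith) hbK (lt_add_one M) n hε 0
  refine (hlt N).not_ge (hN.trans (hU.iter_mono (isBdd_ind _) (isBdd_ind _)
    (ind_mono ?_) 0 N 0))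
  rintro x ⟨m, hm, hx⟩
  exact ⟨m, hm, le_trans hx (le_abs_self _)⟩

end SubLinearExpectationSpace

/-! ### Sufficiency: from block estimates to capacities. -/

namespace SubLinearExpectationSpace
variable {Ω : Type*} [MeasurableSpace Ω] {S : SubLinearExpectationSpace Ω}
  {V : Set Ω → ℝ≥0∞} {Y : ℕ → Ω → ℝ}

theorem outerCap_le_tsum {A : Set Ω} (s : ℕ → ℕ → Set Ω) (hs : ∀ q k, MeasurableSet (s q k))
    (hA : A ⊆ ⋃ q, ⋃ k, s q k) : S.outerCap A ≤ ∑' q, ∑' k, S.upCap (s q k) := by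
  refine (iInf_le_of_le (fun n => s n.unpair.1 n.unpair.2) (iInf₂_le_of_le (fun n => hs _ _)
    (fun ω hω => ?_) le_rfl)).trans_eq ?_
  · obtain ⟨q, hq⟩ := Set.mem_iUnion.1 (hA hω)
    obtain ⟨k, hk⟩ := Set.mem_iUnion.1 hq
    exact Set.mem_iUnion.2 ⟨Nat.pair q k, by simpa using hk⟩
  · rw [← ENNReal.tsum_prod, ← Nat.pairEquiv.symm.tsum_eq]
    rfl

theorem capacity_biUnion_le (hV : S.IsUpperCapacity V) {A : ℕ → Set Ω}
    (hA : ∀ k, MeasurableSet (A k)) (t : Finset ℕ) : V (⋃ k ∈ t, A k) ≤ ∑ k ∈ t, V (A k) := by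
  classical
  induction t using Finset.induction_on with
  | empty => simp [hV.empty]
  | insert a t hat ih =>
    rw [Finset.set_biUnion_insert, Finset.sum_insert hat]
    exact (hV.union_le _ _ (hA a) (Finset.measurableSet_biUnion _ fun k _ => hA k)).trans
      (by gcongr)

theorem one_le_capacity_add_compl (hV : S.IsUpperCapacity V) {A : Set Ω} (hA : MeasurableSet A) :
    1 ≤ V A + V Aᶜ := by
  rw [← hV.univ, ← Set.union_compl_self A]
  exact hV.union_le _ _ hA hA.compl

theorem measurableSet_blockEvent (hY : S.IID Y) (ρ : ℝ) (R k : ℕ) :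
    MeasurableSet {ω | (fun i => Y i ω) ∈ blockEvent ρ R k} := by
  have : {ω | (fun i => Y i ω) ∈ blockEvent ρ R k} = ⋃ i ∈ Finset.Ico R (4 * R),
      ⋃ m ∈ Finset.range ((i + 1) * 4 ^ k + 1),
        {ω | ρ * lilNorm ((i + 1) * 4 ^ k) ≤ |coordSum id 0 m fun i => Y i ω|} := by
    ext ω; simp [blockEvent]
  rw [this]
  exact Finset.measurableSet_biUnion _ fun i _ => Finset.measurableSet_biUnion _ fun m _ =>
    measurableSet_le measurable_const (measurable_coordSum hY m).abs

theorem blockEvent_of_close {ρ ρ' : ℝ} (hρ : ρ' < ρ) (R k : ℕ) {x : ℕ → ℝ}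
    (hx : x ∈ blockEvent ρ R k) (z : ℕ → ℝ) (hz : ∀ i < 4 * R * 4 ^ k,
      |x i - z i| < (ρ - ρ') / (((4 * R * 4 ^ k : ℕ) : ℝ) + 1)) : z ∈ blockEvent ρ' R k := by
  obtain ⟨i, hi, m, hm, h⟩ := hx
  refine ⟨i, hi, m, hm, mul_lilNorm_le_abs_of_close (hm.trans ?_) ?_ hρ hz h⟩
  · exact Nat.mul_le_mul_right _ (Finset.mem_Ico.1 hi).2
  · exact Nat.mul_pos (Nat.succ_pos i) (by positivity)

/-- Summable bounds for the capacities of the block events. -/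
theorem exists_blockEvent_bound (hV : S.IsUpperCapacity V) (hY : S.IID Y) {σ : ℝ≥0∞}
    (hσ : S.IsUpperStd (Y 0) σ) (ha : Summable (dyadicTail (S.upperLaw (Y 0))))
    (hmean : ∀ s : ℝ, |s| = 1 →
      Tendsto (fun c => S.upperLaw (Y 0) (fun x => s * clip c x)) atTop (𝓝 0))
    {ρ : ℝ} (hρ : σ < ENNReal.ofReal ρ) :
    ∃ R ≥ 1, ∃ ρ' ≥ (0 : ℝ), ρ' * (1 + 1 / (R : ℕ)) ≤ ρ ∧ ∃ u : ℕ → ℝ, Summable u ∧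
      (∀ k, 0 ≤ u k) ∧
      (∀ k, S.upCap {ω | (fun i => Y i ω) ∈ blockEvent ρ' R k} ≤ ENNReal.ofReal (u k)) ∧
      ∀ k, V {ω | (fun i => Y i ω) ∈ blockEvent ρ' R k} ≤ ENNReal.ofReal (u k) := by
  have hU := S.isUpperExp_upperLaw (hY.mem 0)
  have hσr : σ.toReal < ρ := (ENNReal.lt_ofReal_iff_toReal_lt hρ.ne_top).1 hρ
  -- Three gaps are used: from `s` to `ρ₂` for the exponential bound, from `ρ₂` to `ρ₁` for the
  -- Lipschitz comparison, and from `ρ₁` to `ρ` for the grid factor `1 + 1/R`.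
  obtain ⟨s, hs, hsρ⟩ := exists_between hσr
  obtain ⟨ρ₂, hs2, h2ρ⟩ := exists_between hsρ
  obtain ⟨ρ₁, h21, h1ρ⟩ := exists_between h2ρ
  have hs0 : 0 < s := ENNReal.toReal_nonneg.trans_lt hs
  have hρ1 : 0 < ρ₁ := by linarith
  obtain ⟨R, hR⟩ := exists_nat_gt (ρ₁ / (ρ - ρ₁))
  have hR0 : (0 : ℝ) < R := (div_pos hρ1 (sub_pos.2 h1ρ)).trans hR
  rw [div_lt_iff₀ (sub_pos.2 h1ρ)] at hR
  have hsum := hU.summable_blockEvent ha hmean hs0 hs2 (fun y hy => upperLaw_clip_sq_le hY hσ hs0.le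
    ((ENNReal.le_ofReal_iff_toReal_le hρ.ne_top hs0.le).2 hs.le) hy) R 0
  have hδ : ∀ k, 0 < (ρ₁ - ρ₂) / (((4 * R * 4 ^ k : ℕ) : ℝ) + 1) := fun k =>
    div_pos (sub_pos.2 h21) (by positivity)
  refine ⟨R, by exact_mod_cast hR0, ρ₁, hρ1.le, ?_, _, hsum,
    fun k => hU.iter_nonneg (isBdd_ind _) (ind_nonneg _) _ _ _, fun k => ?_, fun k => ?_⟩
  · rw [mul_add, mul_one, mul_one_div, ← le_sub_iff_add_le', div_le_iff₀ hR0]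
    linarith
  · exact S.upCap_le_iterExp hY (hδ k) (fun x hx => blockEvent_of_close h21 R k hx) 0
  · exact S.capacity_le_iterExp hY (hδ k) (fun x hx => blockEvent_of_close h21 R k hx) hV
      (measurableSet_blockEvent hY _ _ _) 0

theorem tsum_ofReal_add {u : ℕ → ℝ} (hu : Summable u) (h0 : ∀ k, 0 ≤ u k) (k₀ : ℕ) :
    ∑' k, ENNReal.ofReal (u (k + k₀)) = ENNReal.ofReal (∑' k, u (k + k₀)) :=
  (ENNReal.ofReal_tsum_of_nonneg (fun _ => h0 _) ((summable_nat_add_iff k₀).2 hu)).symm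

/-- The upper half of the law of the iterated logarithm. -/
theorem outerCap_limsup_eq_zero (hV : S.IsUpperCapacity V) (hY : S.IID Y) {σ : ℝ≥0∞}
    (hσ : S.IsUpperStd (Y 0) σ) (ha : Summable (dyadicTail (S.upperLaw (Y 0))))
    (hmean : ∀ s : ℝ, |s| = 1 →
      Tendsto (fun c => S.upperLaw (Y 0) (fun x => s * clip c x)) atTop (𝓝 0)) :
    S.outerCap {ω | (σ : EReal) <
        limsup (fun n : ℕ => ((|partialSum Y n ω| / lilNorm n : ℝ) : EReal)) atTop} = 0 := by
  rcases eq_or_ne σ ⊤ with rfl | hσt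
  · have h : {ω | ((⊤ : ℝ≥0∞) : EReal) <
        limsup (fun n : ℕ => ((|partialSum Y n ω| / lilNorm n : ℝ) : EReal)) atTop} = ∅ := by
      ext ω; simp
    rw [h, ← nonpos_iff_eq_zero]
    refine (outerCap_le_tsum (S := S) (fun _ _ => ∅) (fun _ _ => MeasurableSet.empty)
      (Set.empty_subset _)).trans ?_
    have h0 : S.upCap ∅ = 0 := by
      rw [← nonpos_iff_eq_zero]
      refine (iInf₂_le_of_le (fun _ => 0) (S.const_mem 0) (iInf_le_of_le (by simp) le_rfl)).trans ?_
      rw [S.const 0]; simp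
    simp [h0]
  rw [← nonpos_iff_eq_zero]
  refine ENNReal.le_of_forall_pos_le_add fun ε hε _ => ?_
  rw [zero_add]
  have hε' : (ε : ℝ≥0∞) ≠ 0 := by simpa using hε.ne'
  -- The event is covered by countably many levels above `σ`; the tail of block events at level `q`
  -- is given the share `e q` of `ε`.
  obtain ⟨e, he0, hesum⟩ := ENNReal.exists_pos_sum_of_countable hε' ℕ
  have hq : ∀ q : ℕ, σ < ENNReal.ofReal (σ.toReal + 1 / ((q : ℝ) + 1)) := fun q => by
    rw [ENNReal.lt_ofReal_iff_toReal_lt hσt]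
    exact lt_add_of_pos_right _ (by positivity)
  choose R hR ρ' hρ'0 hρ' u hu hu0 hcap _ using fun q =>
    exists_blockEvent_bound hV hY hσ ha hmean (hq q)
  have hk : ∀ q, ∃ k₀, ∑' k, u q (k + k₀) ≤ e q := fun q =>
    ((tendsto_sum_nat_add (u q)).eventually_le_const (by exact_mod_cast he0 q)).exists
  choose k₀ hk₀ using hk
  refine (outerCap_le_tsum
    (fun q k => {ω | (fun i => Y i ω) ∈ blockEvent (ρ' q) (R q) (k + k₀ q)})
    (fun q k => measurableSet_blockEvent hY _ _ _) fun ω hω => ?_).trans ?_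
  · obtain ⟨r, hσr, hr⟩ := EReal.lt_iff_exists_real_btwn.1 hω
    have hσr' : σ.toReal < r := by
      rw [← EReal.coe_lt_coe_iff, EReal.coe_ennreal_toReal hσt]
      exact hσr
    obtain ⟨q, hqr⟩ := exists_nat_one_div_lt (sub_pos.2 hσr')
    obtain ⟨m, hm, hmk⟩ := ((frequently_lt_of_lt_limsup (by isBoundedDefault) hr).and_eventually
      (eventually_ge_atTop (max 1 (R q * 4 ^ k₀ q)))).exists
    have hd := lilNorm_pos ((le_max_left _ _).trans hmk)
    have hm' : (σ.toReal + 1 / ((q : ℝ) + 1)) * lilNorm m ≤ |coordSum id 0 m fun i => Y i ω| := by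
      rw [← partialSum_eq_coordSum, ← le_div_iff₀ hd]
      exact le_trans (by linarith) (EReal.coe_lt_coe_iff.1 hm).le
    obtain ⟨k, hk, -, hx⟩ := mem_blockEvent (hR q) (hρ'0 q) (hρ' q) hm'
      ((le_max_right _ _).trans hmk)
    obtain ⟨j, rfl⟩ := Nat.exists_eq_add_of_le' hk
    exact Set.mem_iUnion.2 ⟨q, Set.mem_iUnion.2 ⟨j, hx⟩⟩
  · refine (ENNReal.tsum_le_tsum fun q => ?_).trans hesum.le
    refine (ENNReal.tsum_le_tsum fun k => hcap q _).trans ?_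
    rw [tsum_ofReal_add (hu q) (hu0 q)]
    exact (ENNReal.ofReal_le_ofReal (hk₀ q)).trans_eq (ENNReal.ofReal_coe_nnreal)

/-- The event that the supremum exceeds a given number above the upper standard deviation has a
small capacity. -/
theorem eventually_capacity_supRatio_gt_le (hV : S.IsUpperCapacity V) (hY : S.IID Y) {σ : ℝ≥0∞}
    (hσ : S.IsUpperStd (Y 0) σ) (ha : Summable (dyadicTail (S.upperLaw (Y 0))))
    (hmean : ∀ s : ℝ, |s| = 1 →
      Tendsto (fun c => S.upperLaw (Y 0) (fun x => s * clip c x)) atTop (𝓝 0))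
    {σ₂ : EReal} (hσ₂ : (σ : EReal) < σ₂) {ε : ℝ} (hε : 0 < ε) :
    ∀ᶠ n in atTop, ∀ N, V {ω | supRatio Y n N ω ≤ σ₂}ᶜ ≤ ENNReal.ofReal ε := by
  obtain ⟨r, hσr, hr⟩ := EReal.lt_iff_exists_real_btwn.1 hσ₂
  have hσt : σ ≠ ⊤ := by
    rintro rfl
    simp at hσr
  have hσr' : σ < ENNReal.ofReal r := by
    rw [ENNReal.lt_ofReal_iff_toReal_lt hσt, ← EReal.coe_lt_coe_iff, EReal.coe_ennreal_toReal hσt]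
    exact hσr
  obtain ⟨R, hR, ρ', hρ'0, hρ', u, hu, hu0, -, hcap⟩ :=
    exists_blockEvent_bound hV hY hσ ha hmean hσr'
  obtain ⟨k₀, hk₀⟩ := ((tendsto_sum_nat_add u).eventually_le_const hε).exists
  filter_upwards [eventually_ge_atTop (max 1 (R * 4 ^ k₀))] with n hn N
  -- For finite `N` finitely many blocks suffice, so finite sub-additivity of `V` is enough, with a
  -- bound uniform in `N`.
  have hsub : {ω | supRatio Y n N ω ≤ σ₂}ᶜ ⊆
      ⋃ k ∈ Finset.range (N + 1), {ω | (fun i => Y i ω) ∈ blockEvent ρ' R (k + k₀)} := by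
    intro ω hω
    have h1 : σ₂ < supRatio Y n N ω := not_le.1 hω
    obtain ⟨m, hm⟩ := lt_iSup_iff.1 h1
    obtain ⟨hmN, hm⟩ := lt_iSup_iff.1 hm
    have hmN' := Finset.mem_Icc.1 hmN
    have hd := lilNorm_pos (((le_max_left _ _).trans hn).trans hmN'.1)
    have hm' : r * lilNorm m ≤ |coordSum id 0 m fun i => Y i ω| := by
      refine le_trans ?_ (le_abs_self _)
      rw [← partialSum_eq_coordSum, ← le_div_iff₀ hd]
      exact (EReal.coe_lt_coe_iff.1 (hr.trans hm)).le
    obtain ⟨k, hk, hkm, hx⟩ := mem_blockEvent hR hρ'0 hρ' hm'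
      (((le_max_right _ _).trans hn).trans hmN'.1)
    obtain ⟨j, rfl⟩ := Nat.exists_eq_add_of_le' hk
    refine Set.mem_iUnion₂.2 ⟨j, Finset.mem_range.2 ?_, hx⟩
    have := hmN'.2
    omega
  refine (hV.mono _ _ (measurableSet_le (measurable_supRatio hY n N) measurable_const).compl
    (Finset.measurableSet_biUnion _ fun k _ => measurableSet_blockEvent hY _ _ _) hsub).trans ?_
  refine (capacity_biUnion_le hV (fun k => measurableSet_blockEvent hY _ _ _) _).trans ?_
  refine (Finset.sum_le_sum fun k _ => hcap _).trans ?_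
  refine (ENNReal.sum_le_tsum _).trans ?_
  rw [tsum_ofReal_add hu hu0]
  exact ENNReal.ofReal_le_ofReal hk₀

/-- The lower half of the law of the iterated logarithm. -/
theorem eventually_le_capacity_supRatio (hV : S.IsUpperCapacity V) (hY : S.IID Y) {σ : ℝ≥0∞}
    (hσ : S.IsUpperStd (Y 0) σ) (ha : Summable (dyadicTail (S.upperLaw (Y 0))))
    (hmean : ∀ s : ℝ, |s| = 1 →
      Tendsto (fun c => S.upperLaw (Y 0) (fun x => s * clip c x)) atTop (𝓝 0))
    {σ₁ : ℝ} (hσ₁ : (σ₁ : EReal) < σ) {ε : ℝ} (hε : 0 < ε) (hε1 : ε < 1) :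
    ∀ᶠ n in atTop, ∃ N ≥ n,
      ENNReal.ofReal (1 - ε) ≤ V {ω | (σ₁ : EReal) ≤ supRatio Y n N ω} := by
  have hU := S.isUpperExp_upperLaw (hY.mem 0)
  have hms : ∀ n N, MeasurableSet {ω | (σ₁ : EReal) ≤ supRatio Y n N ω} := fun n N =>
    measurableSet_le measurable_const (measurable_supRatio hY n N)
  have hsup : ∀ n N m, 1 ≤ n → m ∈ Finset.Icc n N → ∀ ω,
      σ₁ * lilNorm m ≤ coordSum id 0 m (fun i => Y i ω) → (σ₁ : EReal) ≤ supRatio Y n N ω := by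
    intro n N m hn hm ω h
    refine le_trans ?_ (le_biSup (fun m : ℕ => ((partialSum Y m ω / lilNorm m : ℝ) : EReal)) hm)
    rwa [EReal.coe_le_coe_iff, le_div_iff₀ (lilNorm_pos (hn.trans (Finset.mem_Icc.1 hm).1)),
      partialSum_eq_coordSum]
  -- The variance may vanish, so negative levels are treated apart: the sum at the single time `n`
  -- is already small with high probability.
  rcases lt_or_ge σ₁ 0 with h0 | h0
  · have hg : 0 < -σ₁ / 2 := by linarith
    have hgap : -σ₁ / 2 < -σ₁ := by linarith
    filter_upwards [hU.eventually_iter_abs_le ha hmean hg hε, eventually_ge_atTop 1] with n hn hn1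
    refine ⟨n, le_rfl, ?_⟩
    have h1 := S.capacity_le_iterExp hY (N := n) (A := {x | -σ₁ * lilNorm n ≤ |coordSum id 0 n x|})
      (B := {x | -σ₁ / 2 * lilNorm n ≤ |coordSum id 0 n x|})
      (δ := (-σ₁ - -σ₁ / 2) / ((n : ℝ) + 1)) (div_pos (sub_pos.2 hgap) (by positivity))
      (fun x hx z hz => mul_lilNorm_le_abs_of_close le_rfl hn1 hgap hz hx) hV
      (measurableSet_le measurable_const (measurable_coordSum hY n).abs) 0
    have h2 := hn n le_rfl 0
    rw [div_self (by positivity), mul_one] at h2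
    have h3 : V {ω | (σ₁ : EReal) ≤ supRatio Y n n ω}ᶜ ≤ ENNReal.ofReal ε := by
      refine (hV.mono _ _ (hms n n).compl (measurableSet_le measurable_const
        (measurable_coordSum hY n).abs) fun ω hω => ?_).trans
        (h1.trans (ENNReal.ofReal_le_ofReal h2))
      by_contra hlt
      have h4 : |coordSum id 0 n fun i => Y i ω| < -σ₁ * lilNorm n := not_le.1 hlt
      refine hω (hsup n n n hn1 (Finset.mem_Icc.2 ⟨le_rfl, le_rfl⟩) ω ?_)
      have := (abs_lt.1 h4).1
      linarith
    have h5 := (one_le_capacity_add_compl hV (hms n n)).trans (add_le_add_right h3 _)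
    rw [ENNReal.ofReal_sub _ hε.le, ENNReal.ofReal_one]
    exact tsub_le_iff_right.2 h5
  · have hσ₁' : ENNReal.ofReal σ₁ < σ := by
      rw [← EReal.coe_ennreal_lt_coe_ennreal_iff, EReal.coe_ennreal_ofReal, max_eq_left h0]
      exact hσ₁
    obtain ⟨K', hK', hK'σ⟩ := ENNReal.lt_iff_exists_nnreal_btwn.1 hσ₁'
    have hσK : σ₁ < K' := by
      rwa [← ENNReal.ofReal_coe_nnreal, ENNReal.ofReal_lt_ofReal_iff_of_nonneg h0] at hK'
    have hK0 : (0 : ℝ) < K' := h0.trans_lt hσK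
    obtain ⟨b, hb, hbK⟩ := exists_lt_upperLaw_clip_sq hY hσ hK0 (by simpa using hK'σ)
    obtain ⟨t, ht, htK⟩ := exists_between hσK
    filter_upwards [eventually_ge_atTop 1] with n hn1
    obtain ⟨N, hN⟩ := hU.exists_iter_ge ha hmean hb hK0 hbK htK n hε 0
    -- For smaller `N` the index range is empty and the functional would be zero.
    have hnN : n ≤ N := by
      by_contra hlt
      have he : {x : ℕ → ℝ | ∃ m ∈ Finset.Icc n N, t * lilNorm m ≤ coordSum id 0 m x} = ∅ := by
        ext x
        simp [Finset.Icc_eq_empty hlt]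
      have he2 : ind (∅ : Set (ℕ → ℝ)) = fun _ => 0 := by
        funext x; exact ind_of_notMem (Set.notMem_empty x)
      rw [he, he2, hU.iter_const] at hN
      linarith
    refine ⟨N, hnN, (ENNReal.ofReal_le_ofReal hN).trans ?_⟩
    let B : Set (ℕ → ℝ) := {x | ∃ m ∈ Finset.Icc n N, σ₁ * lilNorm m ≤ coordSum id 0 m x}
    have hB : MeasurableSet {ω | (fun i => Y i ω) ∈ B} := by
      have : {ω | (fun i => Y i ω) ∈ B} =
          ⋃ m ∈ Finset.Icc n N, {ω | σ₁ * lilNorm m ≤ coordSum id 0 m fun i => Y i ω} := by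
        ext ω; simp [B]
      rw [this]
      exact Finset.measurableSet_biUnion _ fun m _ =>
        measurableSet_le measurable_const (measurable_coordSum hY m)
    refine (S.iterExp_le_capacity hY (B := B) (δ := (t - σ₁) / ((N : ℝ) + 1))
      (div_pos (sub_pos.2 ht) (by positivity)) ?_ hV hB 0).trans (hV.mono _ _ hB (hms n N) ?_)
    · rintro x ⟨m, hm, hx⟩ z hz
      exact ⟨m, hm, mul_lilNorm_le_of_close (Finset.mem_Icc.1 hm).2 ht hz hx⟩
    · rintro ω ⟨m, hm, hω⟩
      exact hsup n N m hn1 hm ω hω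

/-- Sub-additivity bounds the capacity of an intersection below by that of the first event minus
that of the complement of the second. The upper estimate is uniform in `N`, so `N` can be chosen for
the lower one. -/
theorem tendsto_iSup_capacity (hV : S.IsUpperCapacity V) (hY : S.IID Y) {σ : ℝ≥0∞}
    (hσ : S.IsUpperStd (Y 0) σ) (ha : Summable (dyadicTail (S.upperLaw (Y 0))))
    (hmean : ∀ s : ℝ, |s| = 1 →
      Tendsto (fun c => S.upperLaw (Y 0) (fun x => s * clip c x)) atTop (𝓝 0))
    {σ₁ : ℝ} {σ₂ : EReal} (hσ₁ : (σ₁ : EReal) < σ)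
    (hσ₂ : (σ : EReal) < σ₂ ∨ ((σ : EReal) = ⊤ ∧ σ₂ = ⊤)) :
    Tendsto (fun n : ℕ => ⨆ (N : ℕ) (_ : n ≤ N),
        V {ω | (σ₁ : EReal) ≤ supRatio Y n N ω ∧ supRatio Y n N ω ≤ σ₂}) atTop (𝓝 1) := by
  have hmA : ∀ n N, MeasurableSet {ω | (σ₁ : EReal) ≤ supRatio Y n N ω} := fun n N =>
    measurableSet_le measurable_const (measurable_supRatio hY n N)
  have hmB : ∀ n N, MeasurableSet {ω | supRatio Y n N ω ≤ σ₂} := fun n N =>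
    measurableSet_le (measurable_supRatio hY n N) measurable_const
  have hup : ∀ ε > 0, ∀ᶠ n in atTop, ∀ N,
      V {ω | supRatio Y n N ω ≤ σ₂}ᶜ ≤ ENNReal.ofReal ε := by
    intro ε hε
    rcases hσ₂ with h | ⟨-, rfl⟩
    · exact eventually_capacity_supRatio_gt_le hV hY hσ ha hmean h hε
    · refine Eventually.of_forall fun n N => ?_
      simp [hV.empty]
  rw [tendsto_order]
  refine ⟨fun a ha1 => ?_, fun a ha1 => Eventually.of_forall fun n => lt_of_le_of_lt ?_ ha1⟩
  · have ha2 : a.toReal < 1 := by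
      simpa using (ENNReal.toReal_lt_toReal ha1.ne_top ENNReal.one_ne_top).2 ha1
    have ha0 : 0 ≤ a.toReal := ENNReal.toReal_nonneg
    have hε : 0 < (1 - a.toReal) / 3 := by linarith
    filter_upwards [hup _ hε, eventually_le_capacity_supRatio hV hY hσ ha hmean hσ₁ hε
      (by linarith)] with n h1 h2
    obtain ⟨N, hnN, hN⟩ := h2
    refine lt_of_lt_of_le ?_ (le_iSup₂_of_le N hnN le_rfl)
    by_contra hle
    push Not at hle
    have h3 : V {ω | (σ₁ : EReal) ≤ supRatio Y n N ω} ≤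
        V {ω | (σ₁ : EReal) ≤ supRatio Y n N ω ∧ supRatio Y n N ω ≤ σ₂} +
          V {ω | supRatio Y n N ω ≤ σ₂}ᶜ := by
      refine (hV.mono _ _ (hmA n N) (((hmA n N).inter (hmB n N)).union (hmB n N).compl)
        fun ω hω => ?_).trans (hV.union_le _ _ ((hmA n N).inter (hmB n N)) (hmB n N).compl)
      by_cases h : supRatio Y n N ω ≤ σ₂
      exacts [Or.inl ⟨hω, h⟩, Or.inr h]
    have h4 := (hN.trans h3).trans (add_le_add hle (h1 N))
    have h5 : a + ENNReal.ofReal ((1 - a.toReal) / 3) =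
        ENNReal.ofReal (a.toReal + (1 - a.toReal) / 3) := by
      rw [ENNReal.ofReal_add ha0 hε.le, ENNReal.ofReal_toReal ha1.ne_top]
    rw [h5, ENNReal.ofReal_le_ofReal_iff (by linarith)] at h4
    linarith
  · exact iSup₂_le fun N _ => capacity_le_one hV ((hmA n N).inter (hmB n N))

end SubLinearExpectationSpace

theorem mainTheorem3 {Ω : Type*} [MeasurableSpace Ω] (S : SubLinearExpectationSpace Ω)
    (V : Set Ω → ℝ≥0∞) (hV : S.IsUpperCapacity V)
    (Y : ℕ → Ω → ℝ) (hY : S.IID Y)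
    (σ : ℝ≥0∞) (hσ : S.IsUpperStd (Y 0) σ) :
    (MomentCondition V (Y 0) → S.MeanZeroCondition (Y 0) →
      S.outerCap {ω | (σ : EReal) <
        limsup (fun n : ℕ => ((|partialSum Y n ω| / lilNorm n : ℝ) : EReal)) atTop} = 0 ∧
      ∀ (σ₁ : ℝ) (σ₂ : EReal), (σ₁ : EReal) < (σ : EReal) →
        ((σ : EReal) < σ₂ ∨ ((σ : EReal) = ⊤ ∧ σ₂ = ⊤)) →
        Tendsto (fun n : ℕ => ⨆ (N : ℕ) (_ : n ≤ N),
            V {ω | (σ₁ : EReal) ≤ supRatio Y n N ω ∧ supRatio Y n N ω ≤ σ₂})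
          atTop (𝓝 1)) ∧
    ((∃ (n₀ : ℕ) (M : ℝ), ∀ n ≥ n₀, ∃ l < (1 : ℝ≥0∞),
        Tendsto (fun N : ℕ => V {ω | (M : EReal) ≤ supAbsRatio Y n N ω}) atTop (𝓝 l)) →
      MomentCondition V (Y 0) ∧ S.MeanZeroCondition (Y 0) ∧
      Tendsto (fun c : ℝ => S.E (fun ω => min (Y 0 ω ^ 2) c)) atTop
        (𝓝 ((σ ^ 2 : ℝ≥0∞) : EReal)) ∧ σ ^ 2 < ⊤) := by
  refine ⟨fun hmom hmean => ?_, fun h => ?_⟩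
  · have ha := SubLinearExpectationSpace.summable_dyadicTail hV hY hmom
    have hm := (SubLinearExpectationSpace.meanZeroCondition_iff hY).1 hmean
    exact ⟨SubLinearExpectationSpace.outerCap_limsup_eq_zero hV hY hσ ha hm,
      fun σ₁ σ₂ h₁ h₂ =>
        SubLinearExpectationSpace.tendsto_iSup_capacity hV hY hσ ha hm h₁ h₂⟩
  · obtain ⟨hmom, hmean, hfin⟩ := SubLinearExpectationSpace.moment_mean_std_of_capacity_lt_one hV hY hσ h
    exact ⟨hmom, hmean, SubLinearExpectationSpace.isUpperStd_iff.1 hσ, ENNReal.pow_lt_top hfin⟩
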